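/- Let $K$ be a finite extension of $\mathbb{Q}_p$ with algebraic closure $\bar K$, let $K_u\subset\bar K$ be its maximal unramified extension, let $I=\mathrm{Gal}(\bar K/K_u)$, and let $E/K$ be a ramified quadratic extension in $\bar K$, with $\tau$ the nontrivial element of $\mathrm{Gal}(E/K)$. Let $\mathbf{G}=\mathbf{U}(V)$ be the quasi-split unitary group over $K$ of a Hermitian space $V$ over $E$ of one of the following two kinds. Either $V$ is an orthogonal sum of $m\ge 0$ hyperbolic planes, with basis $v_{\pm1},\dots,v_{\pm m}$ such that $\phi(v_i,v_{-i})=1$ and all other products of basis vectors vanish (then $\mathbf{G}=\mathbf{U}_{2m}$). Or $V$ is the orthogonal sum of such a space with a line spanned by $v_0$ with $\phi(v_0,v_0)\in K^\times$ (then $\mathbf{G}=\mathbf{U}_{2m+1}$). Let $\mathbf{S}\subset\mathbf{G}$ be the maximal torus of those elements for which all basis vectors are eigenvectors, and let $\chi_i$ be the eigenvalue character of $\mathbf{S}_{\bar K}$ belonging to $v_i$ and the inclusion $E\subset\bar K$. The $\chi_i$ form a basis of $X^*(\mathbf{S})$, and an element of $\mathrm{Gal}(\bar K/K)$ that is nontrivial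 on $E$ maps $\chi_i$ to $-\chi_{-i}$. The Weyl group $W=N_{\mathbf{G}}(\mathbf{S})/\mathbf{S}$ acts on $X^*(\mathbf{S})$ through all permutations of the $\chi_i$, and $W^{I}$ consists of the permutations commuting with $\chi_i\mapsto\chi_{-i}$. A signed cycle $\chi_{i_1}\mapsto\chi_{\pm i_2}\mapsto\cdots\mapsto\chi_{\pm i_r}\mapsto\chi_{\pm i_1}$ of $\sigma\in W^{I}$ (with $i_1,\dots,i_r\in\{1,\dots,m\}$ distinct) has length $r$ and is negative if $\sigma^r(\chi_{i_1})=\chi_{-i_1}$. For $r\ge1$ and $s=2r$, let $K_s$ be the unramified extension of $K$ of degree $s$ and $E_s=EK_s$. Let $\tau_s\in\mathrm{Gal}(E_s/K)$ be the nontrivial element fixing $K_s$, let $\sigma_s\in\mathrm{Gal}(E_s/K)$ be the element that fixes $E$ and restricts to the Frobenius of $K_s/K$, and let $L=L_r$ be the subfield of $E_s$ fixed by $\tau_s\sigma_s^{r}$. Put $\mathbf{T}_s=\mathrm{Res}_{L/K}\,\mathbf{U}_1(E_s/L)$, where $\mathbf{U}_1(E_s/L)$ is the group of elements of norm $1$,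 and write $\mathbf{U}_1=\mathbf{U}_1(E/K)$. Let $\mathbf{T}\subset\mathbf{G}$ be a maximal torus over $K$ that is relatively unramified ($\mathbf{T}$ and $\mathbf{S}$ become isomorphic over $K_u$) and anisotropic, and whose stable class corresponds to $\sigma\in W^{I}$. That is, for some $g\in\mathbf{G}(\bar K)$ with $\mathbf{T}=g\mathbf{S}g^{-1}$, the cocycle $\gamma\mapsto g^{-1}\gamma(g)\in W$ is inflated from the cocycle of $\mathrm{Gal}(K_u/K)$ that sends the Frobenius to $\sigma$. Then all signed cycles of $\sigma$ are negative. If $r_1,\dots,r_j$ are their lengths and $s_i=2r_i$, then, as tori over $K$, 1. if $\mathbf{G}=\mathbf{U}_{2m+1}$, then $\mathbf{T}\simeq\prod_{i=1}^j\mathbf{T}_{s_i}\times\mathbf{U}_1$; 2. if $\mathbf{G}=\mathbf{U}_{2m}$, then $\mathbf{T}\simeq\prod_{i=1}^j\mathbf{T}_{s_i}$. -/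

import Mathlib

open CategoryTheory
open scoped TensorProduct

universe u

namespace UnitaryTori

noncomputable section

/-! ### Group functors (functors of points of group schemes) -/

/-- Group-valued functors on commutative `k`-algebras. Affine group schemes over `k` are treated
through their functors of points; by Yoneda, isomorphisms of affine group schemes over `k` are the
same as isomorphisms of these functors. -/
abbrev GroupFunctor (k : Type u) [CommRing k] := CommAlgCat.{u} k ⥤ GrpCat.{u}

/-- The multiplicative group. -/
def Gm (k : Type u) [CommRing k] : GroupFunctor k where
  obj R := GrpCat.of Rˣ
  map f := GrpCat.ofHom (Units.map (f.hom : _ →* _))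

/-- The direct product of a family of group functors. -/
def piFunctor {k : Type u} [CommRing k] {ι : Type} (F : ι → GroupFunctor k) : GroupFunctor k where
  obj R := GrpCat.of (∀ i, (F i).obj R)
  map f := GrpCat.ofHom (MonoidHom.pi fun i => ((F i).map f).hom.comp (Pi.evalMonoidHom _ i))

/-- The direct product of two group functors. -/
def productFunctor {k : Type u} [CommRing k] (F G : GroupFunctor k) : GroupFunctor k where
  obj R := GrpCat.of (F.obj R × G.obj R)
  map f := GrpCat.ofHom ((F.map f).hom.prodMap (G.map f).hom)

/-- Restriction of scalars from commutative `l`-algebras to commutative `k`-algebras. -/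
def restrictAlg (k l : Type u) [CommRing k] [CommRing l] [Algebra k l] :
    CommAlgCat.{u} l ⥤ CommAlgCat.{u} k where
  obj A := @CommAlgCat.of k _ A _ (Algebra.restrictScalars k l A)
  map {A B} f :=
    letI := Algebra.restrictScalars k l A
    letI := Algebra.restrictScalars k l B
    CommAlgCat.ofHom
      { toRingHom := (f.hom.toRingHom : A →+* B)
        commutes' := fun r => f.hom.commutes (algebraMap k l r) }

/-- The base change `F_l` of a group functor along `k → l`. -/
def baseChange {k : Type u} [CommRing k] (l : Type u) [CommRing l] [Algebra k l]
    (F : GroupFunctor k) : GroupFunctor l :=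
  restrictAlg k l ⋙ F

/-- The functor `R ↦ l ⊗[k] R` from `k`-algebras to `l`-algebras. -/
def extendAlg (k l : Type u) [CommRing k] [CommRing l] [Algebra k l] :
    CommAlgCat.{u} k ⥤ CommAlgCat.{u} l where
  obj R := CommAlgCat.of l (l ⊗[k] R)
  map f := CommAlgCat.ofHom (Algebra.TensorProduct.map (AlgHom.id l l) f.hom)
  map_id R := by
    ext x
    simp
  map_comp f g := by
    ext x
    simp [Algebra.TensorProduct.map_id_comp]

/-- The Weil restriction `Res_{l/k} F`, i.e. `R ↦ F (l ⊗[k] R)`. -/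
def weilRestriction (k : Type u) {l : Type u} [CommRing k] [CommRing l] [Algebra k l]
    (F : GroupFunctor l) : GroupFunctor k :=
  extendAlg k l ⋙ F

/-- A subgroup functor of a group functor. -/
structure SubgroupFunctor {k : Type u} [CommRing k] (G : GroupFunctor k) where
  carrier (R : CommAlgCat.{u} k) : Subgroup (G.obj R)
  map_mem {R S : CommAlgCat.{u} k} (f : R ⟶ S) {x : G.obj R} :
    x ∈ carrier R → (G.map f).hom x ∈ carrier S

/-- The group functor underlying a subgroup functor. -/
def SubgroupFunctor.toFunctor {k : Type u} [CommRing k] {G : GroupFunctor k}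
    (T : SubgroupFunctor G) : GroupFunctor k where
  obj R := GrpCat.of (T.carrier R)
  map f := GrpCat.ofHom
    (((G.map f).hom.comp (T.carrier _).subtype).codRestrict (T.carrier _)
      fun x => T.map_mem f x.2)

/-! ### Tori -/

/-- A torus over a field `k`: an affine group scheme over `k` that becomes isomorphic to `𝔾ₘ ^ d`
over an algebraic closure of `k`, for some `d`. -/
def IsTorus {k : Type u} [Field k] (F : GroupFunctor k) : Prop :=
  (F ⋙ forget GrpCat.{u}).IsCorepresentable ∧
    ∃ d : ℕ, Nonempty (baseChange (AlgebraicClosure k) F ≅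
      piFunctor fun _ : Fin d => Gm (AlgebraicClosure k))

/-- A maximal torus of `G`: a subtorus, defined over `k`, not properly contained in another
subtorus defined over `k`. (Subtori are automatically closed, since a monomorphism of affine
algebraic groups over a field is a closed immersion.) -/
def IsMaximalTorus {k : Type u} [Field k] {G : GroupFunctor k} (T : SubgroupFunctor G) : Prop :=
  IsTorus T.toFunctor ∧
    ∀ T' : SubgroupFunctor G, IsTorus T'.toFunctor →
      (∀ R, T.carrier R ≤ T'.carrier R) → ∀ R, T'.carrier R ≤ T.carrier R

/-- A torus is anisotropic if it has no nontrivial character defined over the base field. -/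
def IsAnisotropic {k : Type u} [Field k] (F : GroupFunctor k) : Prop :=
  ∀ (χ : F ⟶ Gm k) (R : CommAlgCat.{u} k) (x : F.obj R), (χ.app R).hom x = 1

/-! ### Norm-one tori -/

/-- The norm `R ⊗[F] E → R` is compatible with homomorphisms `R → S` of `F`-algebras. -/
theorem norm_map {F E R S : Type u} [Field F] [Field E] [Algebra F E] [CommRing R] [Algebra F R]
    [CommRing S] [Algebra F S] (f : R →ₐ[F] S) (x : R ⊗[F] E) :
    Algebra.norm S (Algebra.TensorProduct.map f (AlgHom.id F E) x) = f (Algebra.norm R x) := by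
  classical
  rcases subsingleton_or_nontrivial S with hS | hS
  · exact Subsingleton.elim _ _
  have hR : Nontrivial R := f.toRingHom.domain_nontrivial
  let b := Module.Free.chooseBasis F E
  by_cases hfin : Finite (Module.Free.ChooseBasisIndex F E)
  · have hrepr : ∀ (y : R ⊗[F] E) (i), (Algebra.TensorProduct.basis S b).repr
        (Algebra.TensorProduct.map f (AlgHom.id F E) y) i =
          f ((Algebra.TensorProduct.basis R b).repr y i) := by
      intro y i
      induction y with
      | zero => simp
      | add y z hy hz => simp [hy, hz]
      | tmul r e => simp [Algebra.TensorProduct.basis_repr_tmul]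
    have := Fintype.ofFinite (Module.Free.ChooseBasisIndex F E)
    rw [Algebra.norm_eq_matrix_det (Algebra.TensorProduct.basis S b),
      Algebra.norm_eq_matrix_det (Algebra.TensorProduct.basis R b), AlgHom.map_det]
    congr 1
    ext i j
    have hj : Algebra.TensorProduct.basis S b j = Algebra.TensorProduct.map f (AlgHom.id F E)
        (Algebra.TensorProduct.basis R b j) := by simp
    rw [AlgHom.mapMatrix_apply, Matrix.map_apply, Algebra.leftMulMatrix_eq_repr_mul,
      Algebra.leftMulMatrix_eq_repr_mul, hj, ← map_mul, hrepr]
  · have key : ∀ (A : Type u) [CommRing A] [Algebra F A] [Nontrivial A],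
        ¬ Module.Finite A (A ⊗[F] E) := fun A _ _ _ h =>
      hfin (Module.Finite.finite_basis (Algebra.TensorProduct.basis A b))
    rw [Algebra.norm_eq_one_of_not_module_finite (key S),
      Algebra.norm_eq_one_of_not_module_finite (key R), map_one]

/-- The unitary group `U₁(E/F)` in one variable of a quadratic extension `E/F` of fields: the group
of elements of norm `1`, i.e. `R ↦ {x ∈ (R ⊗[F] E)ˣ | N(x) = 1}`. -/
def unitaryOne (F E : Type u) [Field F] [Field E] [Algebra F E] : GroupFunctor F where
  obj R := GrpCat.of ((Algebra.norm R : (R ⊗[F] E) →* R).comp (Units.coeHom _)).ker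
  map {R S} f := GrpCat.ofHom
    (((Units.map (Algebra.TensorProduct.map f.hom (AlgHom.id F E) : R ⊗[F] E →* S ⊗[F] E)).comp
      (Subgroup.subtype _)).codRestrict _ fun x => by
        have hx : Algebra.norm R ((x : (R ⊗[F] E)ˣ) : R ⊗[F] E) = 1 := x.2
        exact (norm_map f.hom _).trans ((congrArg f.hom hx).trans (map_one _)))
  map_id R := by
    ext x
    simp
  map_comp {R S T} f g := by
    ext x
    have h (y : R ⊗[F] E) : Algebra.TensorProduct.map (g.hom.comp f.hom) (AlgHom.id F E) y =
        Algebra.TensorProduct.map g.hom (AlgHom.id F E)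
          (Algebra.TensorProduct.map f.hom (AlgHom.id F E) y) := by
      induction y with
      | zero => simp
      | add y z hy hz => simp only [map_add, hy, hz]
      | tmul r e => simp
    exact h _

/-! ### Unitary groups of Hermitian spaces -/

section Unitary

variable (K : Type u) {E : Type u} [Field K] [Field E] [Algebra K E] (τ : E ≃ₐ[K] E)

/-- The conjugation `τ ⊗ id` of `E ⊗[K] R`. -/
def conj (R : Type u) [CommRing R] [Algebra K R] : E ⊗[K] R →ₐ[K] E ⊗[K] R :=
  Algebra.TensorProduct.map (τ : E →ₐ[K] E) (AlgHom.id K R)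

variable {ι : Type} [Fintype ι] [DecidableEq ι] (H : Matrix ι ι E)

/-- The `R`-points of the unitary group of the Hermitian space `E ^ ι` whose form
`φ(v, w) = vᵀ H τ(w)` has Gram matrix `H`: the `g ∈ GL_ι(E ⊗[K] R)` with `gᵀ H τ(g) = H`. -/
def unitaryPoints (R : Type u) [CommRing R] [Algebra K R] :
    Subgroup (GL ι (E ⊗[K] R)) where
  carrier := {g | (g : Matrix ι ι (E ⊗[K] R)).transpose *
    H.map (algebraMap E (E ⊗[K] R)) * (g : Matrix ι ι (E ⊗[K] R)).map (conj K τ R) =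
      H.map (algebraMap E (E ⊗[K] R))}
  one_mem' := by
    simp [Matrix.map_one]
  mul_mem' := by
    intro a b ha hb
    simp only [Set.mem_ofPred_eq, Units.val_mul, Matrix.transpose_mul, Matrix.map_mul] at ha hb ⊢
    calc _ = (b : Matrix ι ι (E ⊗[K] R)).transpose * ((a : Matrix ι ι (E ⊗[K] R)).transpose *
          H.map (algebraMap E (E ⊗[K] R)) * (a : Matrix ι ι (E ⊗[K] R)).map (conj K τ R)) *
          (b : Matrix ι ι (E ⊗[K] R)).map (conj K τ R) := by simp only [Matrix.mul_assoc]
      _ = _ := by rw [ha, hb]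
  inv_mem' := by
    intro a ha
    simp only [Set.mem_ofPred_eq] at ha ⊢
    have h1 : (a : Matrix ι ι (E ⊗[K] R)) * ((a⁻¹ : GL ι (E ⊗[K] R)) : Matrix ι ι (E ⊗[K] R)) = 1 :=
      a.mul_inv
    have h2 := congrArg (fun M => M.map (conj K τ R)) h1
    have h3 := congrArg Matrix.transpose h1
    simp only [Matrix.map_mul, Matrix.transpose_mul, Matrix.transpose_one] at h2 h3
    rw [Matrix.map_one _ (map_zero _) (map_one _)] at h2
    rw [← ha]
    generalize ((a⁻¹ : GL ι (E ⊗[K] R)) : Matrix ι ι (E ⊗[K] R)) = c at *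
    generalize (a : Matrix ι ι (E ⊗[K] R)) = b at *
    rw [ha]
    calc c.transpose * H.map (algebraMap E (E ⊗[K] R)) * c.map (conj K τ R)
        = c.transpose * b.transpose * H.map (algebraMap E (E ⊗[K] R)) *
            (b.map (conj K τ R) * c.map (conj K τ R)) := by
          nth_rewrite 1 [← ha]
          simp only [Matrix.mul_assoc]
      _ = _ := by rw [h2, h3, Matrix.one_mul, Matrix.mul_one]

/-- The map `E ⊗[K] R → E ⊗[K] S` induced by a homomorphism `R → S`. -/
def coeffMap (E : Type u) [Field E] [Algebra K E] {R S : Type u} [CommRing R] [Algebra K R]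
    [CommRing S] [Algebra K S] (f : R →ₐ[K] S) : E ⊗[K] R →ₐ[E] E ⊗[K] S :=
  Algebra.TensorProduct.map (AlgHom.id E E) f

theorem coeffMap_conj {R S : Type u} [CommRing R] [Algebra K R] [CommRing S] [Algebra K S]
    (f : R →ₐ[K] S) (x : E ⊗[K] R) :
    coeffMap K E f (conj K τ R x) = conj K τ S (coeffMap K E f x) := by
  induction x with
  | zero => simp
  | add y z hy hz => simp [hy, hz]
  | tmul r e => simp [coeffMap, conj]

theorem map_mem_unitaryPoints {R S : Type u} [CommRing R] [Algebra K R] [CommRing S] [Algebra K S]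
    (f : R →ₐ[K] S) {g : GL ι (E ⊗[K] R)} (hg : g ∈ unitaryPoints K τ H R) :
    Matrix.GeneralLinearGroup.map (coeffMap K E f : E ⊗[K] R →+* E ⊗[K] S) g ∈
      unitaryPoints K τ H S := by
  have hg' : (g : Matrix ι ι (E ⊗[K] R)).transpose *
    H.map (algebraMap E (E ⊗[K] R)) * (g : Matrix ι ι (E ⊗[K] R)).map (conj K τ R) =
      H.map (algebraMap E (E ⊗[K] R)) := hg
  have hH : (H.map (algebraMap E (E ⊗[K] R))).map (coeffMap K E f) =
      H.map (algebraMap E (E ⊗[K] S)) := by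
    ext i j
    exact (coeffMap K E f).commutes _
  have hc : ((g : Matrix ι ι (E ⊗[K] R)).map (conj K τ R)).map (coeffMap K E f) =
      ((g : Matrix ι ι (E ⊗[K] R)).map (coeffMap K E f)).map (conj K τ S) := by
    ext i j
    exact coeffMap_conj K τ f _
  have h := congrArg (fun M => M.map (coeffMap K E f)) hg'
  simp only [Matrix.map_mul] at h
  rw [hH, hc, Matrix.transpose_map] at h
  exact h

/-- The unitary group `U(V) ⊂ Res_{E/K} GL(V)` as a group functor over `K`. -/
def unitaryGroup : GroupFunctor K where
  obj R := GrpCat.of (unitaryPoints K τ H R)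
  map {R S} f := GrpCat.ofHom
    (((Matrix.GeneralLinearGroup.map (coeffMap K E f.hom : E ⊗[K] R →+* E ⊗[K] S)).comp
      (Subgroup.subtype _)).codRestrict _ fun x => map_mem_unitaryPoints K τ H f.hom x.2)
  map_id R := by
    ext x i j
    change coeffMap K E (AlgHom.id K R) _ = _
    simp [coeffMap]
  map_comp f g := by
    ext x i j
    change coeffMap K E (g.hom.comp f.hom) _ = coeffMap K E g.hom (coeffMap K E f.hom _)
    simp [coeffMap, Algebra.TensorProduct.map_id_comp]

/-- The torus `S ⊂ U(V)` of those elements for which all basis vectors are eigenvectors. -/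
def diagonalTorus : SubgroupFunctor (unitaryGroup K τ H) where
  carrier R := Subgroup.comap (unitaryPoints K τ H R).subtype
    ((Units.map (Matrix.diagonalRingHom ι (E ⊗[K] R) : (ι → E ⊗[K] R) →* _)).range)
  map_mem {R S} f x hx := by
    obtain ⟨d, hd⟩ := hx
    refine ⟨Units.map (RingHom.compLeft (coeffMap K E f.hom : E ⊗[K] R →+* E ⊗[K] S) ι :
      (ι → E ⊗[K] R) →* (ι → E ⊗[K] S)) d, ?_⟩
    ext i j
    have h := congrArg (fun M : GL ι (E ⊗[K] R) => coeffMap K E f.hom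
      ((M : Matrix ι ι (E ⊗[K] R)) i j)) hd
    refine Eq.trans ?_ h
    by_cases hij : i = j
    · subst hij
      simp
    · simp [Matrix.diagonal_apply_ne _ hij]

end Unitary

/-! ### The quasi-split unitary groups `U_{2m}` and `U_{2m+1}` -/

/-- The index set `{±1, …, ±m}` together with `d` extra indices. For `d = 0` and `d = 1` it indexes
the standard bases `{v_i, v_{-i}}` of `ℍ ^ m` and `{v_i, v_{-i}, v_0}` of `ℍ ^ m ⊕ L`. -/
abbrev Idx (m d : ℕ) := (Fin m × ℤˣ) ⊕ Fin d

/-- The involution `i ↦ -i` of the index set (with `-0 = 0`). -/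
def negIdx (m d : ℕ) : Equiv.Perm (Idx m d) where
  toFun := Sum.map (fun x => (x.1, -x.2)) id
  invFun := Sum.map (fun x => (x.1, -x.2)) id
  left_inv x := by rcases x with x | x <;> simp
  right_inv x := by rcases x with x | x <;> simp

/-- The Gram matrix of the orthogonal sum of `m` hyperbolic planes and `d` lines of
discriminant `c`: `φ(v_i, v_{-i}) = 1`, `φ(v_0, v_0) = c`, and all other products of basis
vectors vanish. -/
def gram {E : Type u} [Field E] (m d : ℕ) (c : E) : Matrix (Idx m d) (Idx m d) E := fun a b =>
  if b = negIdx m d a then Sum.elim (fun _ => 1) (fun _ => c) a else 0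

/-- The group of those elements of the Weyl group `W` that are fixed by inertia, equivalently by
the Galois group. Here `W` acts faithfully on `X^*(S)` and is identified in this way with the group
of all permutations of the basis `χ_i` of eigenvalue characters; an element of the Galois group
acts on `W` by conjugation in `Aut X^*(S)`, hence trivially or (if it is nontrivial on `E`, where it
maps `χ_i` to `-χ_{-i}`) as conjugation by `i ↦ -i`. -/
def weylInertia (m d : ℕ) : Subgroup (Equiv.Perm (Idx m d)) :=
  Subgroup.centralizer {negIdx m d}

/-- `i, j ∈ {1, …, m}` lie in the same signed cycle of `w`: some power of `w` maps
`χ_i` to `χ_j` or `χ_{-j}`. -/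
def signedCycleSetoid {m d : ℕ} (w : weylInertia m d) : Setoid (Fin m) where
  r i j := ∃ (k : ℤ) (ε : ℤˣ), ((w : Equiv.Perm (Idx m d)) ^ k) (Sum.inl (i, 1)) = Sum.inl (j, ε)
  iseqv := by
    have hneg : ∀ (k : ℤ) (x : Idx m d), ((w : Equiv.Perm (Idx m d)) ^ k) (negIdx m d x) =
        negIdx m d (((w : Equiv.Perm (Idx m d)) ^ k) x) := by
      intro k x
      have h : Commute (negIdx m d) (w : Equiv.Perm (Idx m d)) :=
        Subgroup.mem_centralizer_iff.1 w.2 _ rfl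
      exact (DFunLike.congr_fun (h.zpow_right k).eq x).symm
    have hflip : ∀ (k : ℤ) (i j : Fin m) (ε δ : ℤˣ),
        ((w : Equiv.Perm (Idx m d)) ^ k) (Sum.inl (i, ε)) = Sum.inl (j, δ) →
        ((w : Equiv.Perm (Idx m d)) ^ k) (Sum.inl (i, -ε)) = Sum.inl (j, -δ) := by
      intro k i j ε δ h
      have := hneg k (Sum.inl (i, ε))
      rw [h] at this
      exact this
    refine ⟨fun i => ⟨0, 1, rfl⟩, ?_, ?_⟩
    · rintro i j ⟨k, ε, h⟩
      have h' : ((w : Equiv.Perm (Idx m d)) ^ (-k)) (Sum.inl (j, ε)) = Sum.inl (i, 1) := by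
        rw [← h, zpow_neg]
        exact Equiv.symm_apply_apply _ _
      rcases Int.units_eq_one_or ε with rfl | rfl
      · exact ⟨-k, 1, h'⟩
      · exact ⟨-k, -1, by simpa using hflip _ _ _ _ _ h'⟩
    · rintro i j l ⟨k, ε, h⟩ ⟨k', ε', h'⟩
      rcases Int.units_eq_one_or ε with rfl | rfl
      · exact ⟨k' + k, ε', by rw [zpow_add, Equiv.Perm.mul_apply, h, h']⟩
      · exact ⟨k' + k, -ε', by
          rw [zpow_add, Equiv.Perm.mul_apply, h, hflip _ _ _ _ _ h']⟩

/-- The signed cycles of `w`. -/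
abbrev SignedCycle {m d : ℕ} (w : weylInertia m d) : Type := Quotient (signedCycleSetoid w)

/-- The length `r` of a signed cycle `χ_{i₁} ↦ χ_{± i₂} ↦ ⋯ ↦ χ_{± i_r} ↦ χ_{± i₁}`. -/
def SignedCycle.length {m d : ℕ} {w : weylInertia m d} (C : SignedCycle w) : ℕ :=
  Nat.card {i : Fin m // Quotient.mk (signedCycleSetoid w) i = C}

/-- A signed cycle of length `r` is negative if `w ^ r` maps `χ_i` to `χ_{-i}` for `i` in it. -/
def SignedCycle.IsNegative {m d : ℕ} {w : weylInertia m d} (C : SignedCycle w) : Prop :=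
  ∀ i : Fin m, Quotient.mk (signedCycleSetoid w) i = C →
    ((w : Equiv.Perm (Idx m d)) ^ C.length) (Sum.inl (i, 1)) = Sum.inl (i, -1)

/-! ### Unramified extensions and Frobenius elements of a `p`-adic field -/

section Arithmetic

variable (p : ℕ) [Fact p.Prime] (K : Type u) [Field K] [Algebra ℚ_[p] K]

/-- The ring of integers of a finite extension `K` of `ℚ_p`: the integral closure of `ℤ_p`. -/
abbrev ringOfIntegers : Subalgebra (PadicInt.subring p) K := integralClosure (PadicInt.subring p) K

variable {K}

/-- `M/K` is finite and unramified. -/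
def IsUnramified (M : IntermediateField K (AlgebraicClosure K)) : Prop :=
  FiniteDimensional K M ∧
    Algebra.FormallyUnramified (ringOfIntegers p K) (integralClosure (ringOfIntegers p K) M)

variable (K)

/-- The maximal unramified extension `K_u` of `K` in the algebraic closure. -/
def maxUnramified : IntermediateField K (AlgebraicClosure K) :=
  sSup {M | IsUnramified p M}

/-- The unramified extension `K_r` of `K` of degree `r ≥ 1` in the algebraic closure (there is
exactly one, which is thus the compositum of all such extensions). -/
def unramifiedExt (r : ℕ) : IntermediateField K (AlgebraicClosure K) :=
  sSup {M | IsUnramified p M ∧ Module.finrank K M = r}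

variable {K}

/-- `f ∈ Gal(K̄/K)` is a Frobenius element: it induces `x ↦ x ^ q` modulo the maximal ideal of the
ring of integers of `K̄`, where `q` is the cardinality of the residue field of `K`. -/
def IsFrobenius (f : AlgebraicClosure K ≃ₐ[K] AlgebraicClosure K) : Prop :=
  ∀ Q : Ideal (integralClosure (ringOfIntegers p K) (AlgebraicClosure K)), Q.IsMaximal →
    (f.toAlgHom.restrictScalars (ringOfIntegers p K)).mapIntegralClosure.IsArithFrobAt Q

/-! ### Elemental tori -/

variable (E : IntermediateField K (AlgebraicClosure K))

/-- `E_s = E K_s`. -/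
def extE (s : ℕ) : IntermediateField K (AlgebraicClosure K) := E ⊔ unramifiedExt p K s

/-- The field `L = L_r`: for `s = 2 r`, the subfield of `E_s` fixed by `η_s = τ_s σ_s ^ r`, where
`τ_s ∈ Gal(E_s/K)` is the nontrivial element fixing `K_s` and `σ_s ∈ Gal(E_s/K)` is the image of a
Frobenius element fixing `E`. In the definition, `t`, `f` are lifts of `τ_s`, `σ_s` to `K̄`. -/
def fieldL (r : ℕ) : IntermediateField K (AlgebraicClosure K) :=
  extE p E (2 * r) ⊓ IntermediateField.fixedField (Subgroup.closure
    {η | ∃ t f : AlgebraicClosure K ≃ₐ[K] AlgebraicClosure K,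
      (∀ x ∈ unramifiedExt p K (2 * r), t x = x) ∧ (∃ x ∈ extE p E (2 * r), t x ≠ x) ∧
      IsFrobenius p f ∧ (∀ x ∈ E, f x = x) ∧ η = t * f ^ r})

/-- The field `E_s`, `s = 2 r`, as an extension of `L_r`. -/
abbrev extEOverL (r : ℕ) : IntermediateField (fieldL p E r) (AlgebraicClosure K) :=
  IntermediateField.extendScalars (F := fieldL p E r) (E := extE p E (2 * r)) inf_le_left

/-- The elemental torus `T_s = Res_{L/K} U₁(E_s/L)` for `s = 2 r`, `L = L_r`. -/
def elementalTorus (r : ℕ) : GroupFunctor K :=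
  weilRestriction K (unitaryOne (fieldL p E r) (extEOverL p E r))

/-! ### Maximal tori in quasi-split unitary groups -/

variable {E} {τ : E ≃ₐ[K] E} {m d : ℕ} {c : E}

/-- A subtorus `T` of `G` is relatively unramified if it becomes isomorphic to the quasi-split
torus `S` over the maximal unramified extension of `K`. -/
def IsRelativelyUnramified (T : SubgroupFunctor (unitaryGroup K τ (gram m d c))) : Prop :=
  Nonempty (baseChange (maxUnramified p K) T.toFunctor ≅
    baseChange (maxUnramified p K) (diagonalTorus K τ (gram m d c)).toFunctor)

variable (K) in
/-- The algebraic closure as an object of the category of `K`-algebras. -/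
abbrev algClosure : CommAlgCat.{u} K := CommAlgCat.of K (AlgebraicClosure K)

/-- The action of the Galois group on the geometric points of a group functor. -/
def galAct {F : GroupFunctor K} (γ : AlgebraicClosure K ≃ₐ[K] AlgebraicClosure K) :
    F.obj (algClosure K) →* F.obj (algClosure K) :=
  (F.map (CommAlgCat.ofHom (γ : AlgebraicClosure K →ₐ[K] AlgebraicClosure K))).hom

/-- The function on `G(K̄)` sending `g` to the image of its `i`-th diagonal entry under
`E ⊗[K] K̄ → K̄`, `e ⊗ x ↦ e x`. Its restriction to `S` is the character `χ_i`. -/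
def chi (i : Idx m d) (g : (unitaryGroup K τ (gram m d c)).obj (algClosure K)) :
    AlgebraicClosure K :=
  Algebra.TensorProduct.productMap E.val (AlgHom.id K (AlgebraicClosure K))
    ((g.1 : Matrix (Idx m d) (Idx m d) (E ⊗[K] AlgebraicClosure K)) i i)

/-- `n ∈ G(K̄)` normalizes `S` and its class in the Weyl group is `w`, i.e. `n` acts on `X^*(S)`
by `χ_i ↦ χ_{w i}`, where `(n χ)(s) = χ(n⁻¹ s n)`. -/
def RepresentsWeyl (n : (unitaryGroup K τ (gram m d c)).obj (algClosure K))
    (w : Equiv.Perm (Idx m d)) : Prop :=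
  n ∈ Subgroup.normalizer ((diagonalTorus K τ (gram m d c)).carrier (algClosure K) : Set _) ∧
  ∀ s ∈ (diagonalTorus K τ (gram m d c)).carrier (algClosure K), ∀ i,
    chi i (n⁻¹ * s * n) = chi (w i) s

/-- The stable class of the maximal torus `T` corresponds to `w ∈ W^I`: there is `g ∈ G(K̄)` with
`T = g S g⁻¹` such that the `W`-valued cocycle `γ ↦ g⁻¹ γ(g)` is the inflation of the cocycle of
`Gal(K_u/K)` that sends the Frobenius to `w`. -/
def CorrespondsTo (T : SubgroupFunctor (unitaryGroup K τ (gram m d c)))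
    (w : weylInertia m d) : Prop :=
  ∃ g : (unitaryGroup K τ (gram m d c)).obj (algClosure K),
    (∀ x, x ∈ T.carrier (algClosure K) ↔
      g⁻¹ * x * g ∈ (diagonalTorus K τ (gram m d c)).carrier (algClosure K)) ∧
    ∀ (γ f : AlgebraicClosure K ≃ₐ[K] AlgebraicClosure K) (k : ℤ), IsFrobenius p f →
      (∀ x ∈ maxUnramified p K, γ x = (f ^ k) x) →
        RepresentsWeyl (g⁻¹ * galAct γ g) ((w : Equiv.Perm (Idx m d)) ^ k)

end Arithmetic

end

end UnitaryTori

open UnitaryTori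

namespace UnitaryTori

noncomputable section

set_option linter.unusedSectionVars false
set_option linter.unusedVariables false

/-! ### Integers of `p`-adic fields -/

/-! Over K̄, conjugation by g identifies T with S, so T is S with its Galois action twisted by the
cocycle γ ↦ g⁻¹γ(g). Only Weil elements γ = f^k ι are needed, with f a Frobenius element that fixes
E and ι in inertia. They act on the characters χ_i through w^k, followed by χ_i ↦ -χ_{-i} if γ is
nontrivial on E. They are dense in the Galois group, so elements of K̄ ⊗ R fixed by all of them lie
in R. Descent then describes T(R) as the group of families z_i of units of K̄ ⊗ R with γ(z_i) =
z_{w^k i}, or γ(z_i) = (z_{-w^k i})⁻¹ if γ is nontrivial on E (`weilTorus`,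
`toWeilTorus_bijective`).

If an orbit of w differed from its negative, the product of the χ_i over the orbit divided by the
product over the opposite orbit would be a nontrivial character over K, against anisotropy
(`exists_zpow_eq_neg`). So every orbit is stable under negation. The orbit of χ_i, for i in a signed
cycle of length r, then has s = 2r elements, and w^r χ_i = χ_{-i}: the cycle is negative.

A family z is determined by its value u at one base point of each orbit, and the conditions on u are
those of the stabilizer (`evalOrbit_bijective`): u is fixed by the Weil elements that fix E and have
degree k divisible by s, and is inverted by those that are nontrivial on E and have k ≡ r mod s. The
former cut out E_s ⊗ R; the latter act on E_s as the nontrivial element of Gal(E_s/L), so they say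
that u has norm 1 over L ⊗ R. The orbit contributes T_s (`elementalTorus_iso_normTorus`). The orbit
of χ_0 is a point, with s = 1 and r = 0, and contributes U₁ (`unitaryOne_iso_normTorus`).

Two supports are needed. The hypothesis T = gSg⁻¹ concerns K̄-points only; linear independence of
characters extends it to all K̄-algebras (`isDiag_of_natural`, `IsTorus.isConjugateBy`). And K_s,
E_s and L must be recognized as fixed fields of Weil elements (`IsFrobenius.mem_unramifiedExt_iff`,
`IsFrobenius.mem_extE_iff`, `IsFrobenius.mem_fieldL_iff`), which rests on the action of inertia and
Frobenius on residue fields and on roots of unity of order q^s - 1. -/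

theorem finite_quotient_of_finite (A O : Type*) {B : Type*} [CommRing A] [IsLocalRing A]
    [CommRing O] [CommRing B] [Algebra A O] [Module.Finite A O]
    [Finite (A ⧸ IsLocalRing.maximalIdeal A)] [Algebra O B] [Algebra.IsIntegral O B]
    (I : Ideal B) (hI : I.IsMaximal) : Finite (O ⧸ I.under O) := by
  have hP := Ideal.IsMaximal.under O I
  -- Maximal ideals of O lie over the maximal ideal of the local ring A because O is finite over A.
  -- Hence the quotient of O is a finite module over the finite residue field of A.
  have hm : (I.under O).under A = IsLocalRing.maximalIdeal A :=
    IsLocalRing.eq_maximalIdeal (Ideal.IsMaximal.under A (I.under O))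
  have : Finite (A ⧸ (I.under O).under A) := by rwa [hm]
  have : Module.Finite (A ⧸ (I.under O).under A) (O ⧸ I.under O) :=
    Module.Finite.of_restrictScalars_finite A _ _
  exact Module.finite_of_finite (A ⧸ (I.under O).under A)

section Integers

variable (p : ℕ) [Fact p.Prime]

instance : IsDiscreteValuationRing (PadicInt.subring p) :=
  inferInstanceAs (IsDiscreteValuationRing ℤ_[p])

instance : IsFractionRing (PadicInt.subring p) ℚ_[p] :=
  inferInstanceAs (IsFractionRing ℤ_[p] ℚ_[p])

/-- As ℤ_p is integrally closed, x is integral exactly if its minimal polynomial over ℚ_p has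
coefficients in ℤ_p, and the spectral norm is at most 1 exactly if these coefficients have norm at
most 1. -/
theorem isIntegral_iff_spectralNorm_le_one {L : Type*} [Field L] [Algebra ℚ_[p] L]
    [Algebra.IsAlgebraic ℚ_[p] L] (x : L) :
    IsIntegral (PadicInt.subring p) x ↔ spectralNorm ℚ_[p] L x ≤ 1 := by
  have hx : IsIntegral ℚ_[p] x := Algebra.IsIntegral.isIntegral x
  rw [spectralNorm, spectralValue_le_one_iff (minpoly.monic hx)]
  constructor
  · intro h n
    rw [show x = algebraMap L L x from rfl,
      minpoly.isIntegrallyClosed_eq_field_fractions ℚ_[p] L h, Polynomial.coeff_map]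
    exact ((minpoly (PadicInt.subring p) x).coeff n).2
  · intro h
    have hl : minpoly ℚ_[p] x ∈ Polynomial.lifts (algebraMap (PadicInt.subring p) ℚ_[p]) := by
      rw [Polynomial.lifts_iff_coeff_lifts]
      exact fun n => ⟨⟨_, h n⟩, rfl⟩
    obtain ⟨q, hq, -, hqm⟩ := Polynomial.lifts_and_natDegree_eq_and_monic hl (minpoly.monic hx)
    refine ⟨q, hqm, ?_⟩
    rw [IsScalarTower.algebraMap_eq (PadicInt.subring p) ℚ_[p] L, ← Polynomial.eval₂_map, hq]
    exact minpoly.aeval _ x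

variable (K : Type u) [Field K] [Algebra ℚ_[p] K]

/-- The ring of integers of the algebraic closure of `K`. -/
def GeomInt : Type u := integralClosure (ringOfIntegers p K) (AlgebraicClosure K)

instance : CommRing (GeomInt p K) :=
  inferInstanceAs (CommRing (integralClosure (ringOfIntegers p K) (AlgebraicClosure K)))

instance : Algebra (ringOfIntegers p K) (GeomInt p K) :=
  inferInstanceAs (Algebra (ringOfIntegers p K)
    (integralClosure (ringOfIntegers p K) (AlgebraicClosure K)))

instance : Algebra (GeomInt p K) (AlgebraicClosure K) :=
  inferInstanceAs (Algebra (integralClosure (ringOfIntegers p K) (AlgebraicClosure K))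
    (AlgebraicClosure K))

instance : IsScalarTower (ringOfIntegers p K) (GeomInt p K) (AlgebraicClosure K) :=
  IsScalarTower.of_algebraMap_eq' rfl

instance : IsIntegralClosure (GeomInt p K) (ringOfIntegers p K) (AlgebraicClosure K) :=
  inferInstanceAs (IsIntegralClosure
    (integralClosure (ringOfIntegers p K) (AlgebraicClosure K))
    (ringOfIntegers p K) (AlgebraicClosure K))

instance : MulSemiringAction (AlgebraicClosure K ≃ₐ[K] AlgebraicClosure K) (GeomInt p K) :=
  instMulSemiringActionSubtypeMemSubalgebraIntegralClosure (R := ringOfIntegers p K)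
    (K := AlgebraicClosure K)

instance : SMulDistribClass (AlgebraicClosure K ≃ₐ[K] AlgebraicClosure K) (GeomInt p K)
    (AlgebraicClosure K) :=
  ⟨fun g r k => smul_mul' g (algebraMap (GeomInt p K) (AlgebraicClosure K) r) k⟩

instance : Algebra.IsIntegral (ringOfIntegers p K) (GeomInt p K) :=
  IsIntegralClosure.isIntegral_algebra _ (AlgebraicClosure K)

variable [FiniteDimensional ℚ_[p] K]

theorem charZero_of_padic (p : ℕ) [Fact p.Prime] (K : Type u) [Field K] [Algebra ℚ_[p] K] :
    CharZero K :=
  charZero_of_injective_algebraMap (algebraMap ℚ_[p] K).injective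

instance isFractionRing_ringOfIntegers : IsFractionRing (ringOfIntegers p K) K :=
  integralClosure.isFractionRing_of_finite_extension ℚ_[p] K

instance isDedekindDomain_ringOfIntegers : IsDedekindDomain (ringOfIntegers p K) :=
  integralClosure.isDedekindDomain (PadicInt.subring p) ℚ_[p] K

instance finite_ringOfIntegers : Module.Finite (PadicInt.subring p) (ringOfIntegers p K) :=
  IsIntegralClosure.finite _ ℚ_[p] K _

instance isAlgebraic_algebraicClosure_padic : Algebra.IsAlgebraic ℚ_[p] (AlgebraicClosure K) :=
  Algebra.IsAlgebraic.trans ℚ_[p] K (AlgebraicClosure K)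

theorem isIntegral_ringOfIntegers_iff (x : AlgebraicClosure K) :
    IsIntegral (ringOfIntegers p K) x ↔ spectralNorm ℚ_[p] (AlgebraicClosure K) x ≤ 1 := by
  rw [← isIntegral_iff_spectralNorm_le_one]
  exact ⟨fun h => isIntegral_trans (R := PadicInt.subring p) (A := ringOfIntegers p K) x h,
    fun h => h.tower_top⟩

theorem spectralNorm_mul_eq (x y : AlgebraicClosure K) :
    spectralNorm ℚ_[p] (AlgebraicClosure K) (x * y) =
      spectralNorm ℚ_[p] (AlgebraicClosure K) x * spectralNorm ℚ_[p] (AlgebraicClosure K) y :=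
  spectralAlgNorm_mul (K := ℚ_[p]) x y

theorem spectralNorm_le_one (x : GeomInt p K) :
    spectralNorm ℚ_[p] (AlgebraicClosure K) (algebraMap _ _ x) ≤ 1 :=
  (isIntegral_ringOfIntegers_iff p K _).1
    ((Algebra.IsIntegral.isIntegral (R := ringOfIntegers p K) x).algebraMap)

omit [FiniteDimensional ℚ_[p] K] in
theorem geomInt_injective : Function.Injective (algebraMap (GeomInt p K) (AlgebraicClosure K)) :=
  IsIntegralClosure.algebraMap_injective _ (ringOfIntegers p K) _

/-- The spectral norm is multiplicative: the norms of a unit and its inverse are at most 1 with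
product 1, while the inverse of an element of norm 1 has norm 1 and so is integral. -/
theorem isUnit_geomInt_iff (x : GeomInt p K) :
    IsUnit x ↔ spectralNorm ℚ_[p] (AlgebraicClosure K) (algebraMap _ _ x) = 1 := by
  have h1 := spectralNorm_one (K := ℚ_[p]) (L := AlgebraicClosure K)
  constructor
  · rintro ⟨u, rfl⟩
    have h := spectralNorm_mul_eq p K (algebraMap _ _ (u : GeomInt p K))
      (algebraMap _ _ ((u⁻¹ : (GeomInt p K)ˣ) : GeomInt p K))
    rw [← map_mul, u.mul_inv, map_one, h1] at h
    have hu := spectralNorm_le_one p K (u : GeomInt p K)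
    have hv := spectralNorm_le_one p K ((u⁻¹ : (GeomInt p K)ˣ) : GeomInt p K)
    have := spectralNorm_nonneg (K := ℚ_[p])
      (algebraMap (GeomInt p K) (AlgebraicClosure K) (u : GeomInt p K))
    nlinarith
  · intro h
    set y := algebraMap (GeomInt p K) (AlgebraicClosure K) x with hy
    have hx : y ≠ 0 := by
      intro h0
      rw [h0, spectralNorm_zero] at h
      exact zero_ne_one h
    have h' := spectralNorm_mul_eq p K y y⁻¹
    rw [mul_inv_cancel₀ hx, h1, h, one_mul] at h'
    have hi := (isIntegral_ringOfIntegers_iff p K _).2 h'.ge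
    refine IsUnit.of_mul_eq_one (IsIntegralClosure.mk' (GeomInt p K) _ hi) ?_
    apply geomInt_injective
    rw [map_mul, IsIntegralClosure.algebraMap_mk', map_one, ← hy, mul_inv_cancel₀ hx]

/-- The nonunits are the elements of spectral norm less than 1, and the norm is nonarchimedean. Thus
there is a single residue field, on which the whole Galois group acts. -/
instance isLocalRing_geomInt : IsLocalRing (GeomInt p K) := by
  have : Nontrivial (GeomInt p K) := ⟨0, 1, fun h => by
    simpa using congrArg (algebraMap (GeomInt p K) (AlgebraicClosure K)) h⟩
  refine IsLocalRing.of_nonunits_add fun a b ha hb => ?_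
  simp only [mem_nonunits_iff, isUnit_geomInt_iff] at ha hb ⊢
  have ha' := lt_of_le_of_ne (spectralNorm_le_one p K a) ha
  have hb' := lt_of_le_of_ne (spectralNorm_le_one p K b) hb
  rw [map_add]
  refine ne_of_lt (lt_of_le_of_lt (isNonarchimedean_spectralNorm (K := ℚ_[p]) _ _) ?_)
  exact max_lt ha' hb'

instance finite_residue : Finite (ringOfIntegers p K ⧸
    (IsLocalRing.maximalIdeal (GeomInt p K)).under (ringOfIntegers p K)) := by
  have : Finite (PadicInt.subring p ⧸ IsLocalRing.maximalIdeal (PadicInt.subring p)) :=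
    Finite.of_equiv _ (PadicInt.residueField (p := p)).symm.toEquiv
  exact finite_quotient_of_finite (PadicInt.subring p) _ _
    (IsLocalRing.maximalIdeal.isMaximal _)

end Integers

/-! ### Lifting automorphisms of residue fields -/

/-- Automorphisms of a residue field of `B` that fix the residues of the elements fixed by a
closed subgroup `H` of a profinite group are induced by elements of `H`, if there is only one
maximal ideal. -/
theorem exists_lift_residue {B : Type*} [CommRing B] {G : Type u} [Group G] [MulSemiringAction G B]
    [TopologicalSpace G] [CompactSpace G] [TotallyDisconnectedSpace G] [IsTopologicalGroup G]
    (hst : ∀ b : B, IsOpen (MulAction.stabilizer G b : Set G)) (Q : Ideal B) [Q.IsPrime]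
    (H : Subgroup G) (hH : IsClosed (H : Set G)) (e : (B ⧸ Q) ≃+* (B ⧸ Q))
    (he : ∀ a : B, (∀ h ∈ H, h • a = a) → e (Ideal.Quotient.mk Q a) = Ideal.Quotient.mk Q a) :
    ∃ h ∈ H, ∀ x : B, Ideal.Quotient.mk Q (h • x) = e (Ideal.Quotient.mk Q x) := by
  -- With the discrete topology on B, open stabilizers mean a continuous action. For such actions of
  -- profinite groups, decomposition groups surject onto automorphism groups of residue extensions.
  let : TopologicalSpace B := ⊥
  have : DiscreteTopology B := ⟨rfl⟩
  have : ContinuousSMul G B := continuousSMul_iff_stabilizer_isOpen.2 hst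
  have : CompactSpace H := isCompact_iff_compactSpace.1 hH.isCompact
  let A : Subalgebra ℤ B := FixedPoints.subalgebra ℤ B H
  have : SMulCommClass H A B := ⟨fun h a x => by
    have := a.2 h
    rw [Algebra.smul_def, Algebra.smul_def, smul_mul']
    congr 1⟩
  have : Algebra.IsInvariant A B H := ⟨fun b hb => ⟨⟨b, hb⟩, rfl⟩⟩
  let P : Ideal A := Q.under A
  -- The hypothesis `he` is linearity of e over the residues of the invariant ring A.
  let e' : (B ⧸ Q) ≃ₐ[A ⧸ P] (B ⧸ Q) := AlgEquiv.ofRingEquiv (f := e) fun a => by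
    obtain ⟨a, rfl⟩ := Ideal.Quotient.mk_surjective a
    exact he a fun h hh => a.2 ⟨h, hh⟩
  obtain ⟨g, hg⟩ := Ideal.Quotient.stabilizerHom_surjective_of_profinite (G := H) P Q e'
  exact ⟨(g : H), (g : H).2, fun x => DFunLike.congr_fun hg (Ideal.Quotient.mk _ x)⟩

/-! ### Inertia and Frobenius elements over a Dedekind domain with a unique extension -/

section Inertia

variable {K : Type*} {Ω : Type u} (B : Type*) [Field K] [CharZero K]
  [Field Ω] [Algebra K Ω] [IsGalois K Ω]
  [CommRing B] [IsLocalRing B] [Algebra B Ω] [FaithfulSMul B Ω]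
  [MulSemiringAction Gal(Ω/K) B] [SMulDistribClass Gal(Ω/K) B Ω]

local notation "𝔮" => IsLocalRing.maximalIdeal B

/-- The inertia group: the automorphisms that act trivially on the residue field. -/
def inertiaGroup : Subgroup Gal(Ω/K) := Ideal.inertia Gal(Ω/K) 𝔮

variable {B}

theorem mem_inertiaGroup {σ : Gal(Ω/K)} :
    σ ∈ inertiaGroup (K := K) (Ω := Ω) B ↔ ∀ x : B, σ • x - x ∈ 𝔮 := Iff.rfl

variable (B)

theorem algebraMap_gal_smul (σ : Gal(Ω/K)) (b : B) :
    algebraMap B Ω (σ • b) = σ (algebraMap B Ω b) :=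
  algebraMap.smul' σ b Ω

theorem gal_smul_mem (σ : Gal(Ω/K)) {x : B} (hx : x ∈ 𝔮) : σ • x ∈ 𝔮 := by
  rw [IsLocalRing.mem_maximalIdeal, mem_nonunits_iff] at hx ⊢
  intro h
  refine hx ?_
  have := h.map (MulSemiringAction.toRingHom _ B σ⁻¹)
  simpa using this

instance inertiaGroup_normal : (inertiaGroup (K := K) (Ω := Ω) B).Normal := by
  refine ⟨fun ι hι σ => ?_⟩
  rw [mem_inertiaGroup] at hι ⊢
  intro x
  have h := gal_smul_mem B σ (hι (σ⁻¹ • x))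
  rw [smul_sub, smul_inv_smul] at h
  rwa [mul_smul, mul_smul]

theorem isOpen_stabilizer_integers (b : B) :
    IsOpen (MulAction.stabilizer Gal(Ω/K) b : Set Gal(Ω/K)) := by
  convert stabilizer_isOpen_of_isIntegral (K := K) (algebraMap B Ω b) using 1
  ext σ
  change σ • b = b ↔ σ (algebraMap B Ω b) = algebraMap B Ω b
  rw [← algebraMap_gal_smul, (FaithfulSMul.algebraMap_injective B Ω).eq_iff]

/-- The action of a Galois automorphism on the residue field. -/
def residueAut (σ : Gal(Ω/K)) : (B ⧸ 𝔮) ≃+* (B ⧸ 𝔮) :=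
  Ideal.quotientEquiv 𝔮 𝔮 (MulSemiringAction.toRingEquiv _ B σ) (by
    rw [Ideal.map_comap_of_equiv]
    ext x
    refine ⟨fun h => gal_smul_mem B σ⁻¹ h, fun h => ?_⟩
    have := gal_smul_mem B σ h
    change σ • σ⁻¹ • x ∈ 𝔮 at this
    rwa [smul_inv_smul] at this)

theorem residueAut_mk (σ : Gal(Ω/K)) (x : B) :
    residueAut B σ (Ideal.Quotient.mk 𝔮 x) = Ideal.Quotient.mk 𝔮 (σ • x) := rfl

theorem isClosed_fixingSubgroup_finite (N : IntermediateField K Ω) [FiniteDimensional K N] :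
    IsClosed (N.fixingSubgroup : Set Gal(Ω/K)) :=
  IntermediateField.fixingSubgroup_isClosed N

theorem mem_of_fixed_fixingSubgroup (N : IntermediateField K Ω) (x : Ω)
    (h : ∀ σ : Gal(Ω/K), (∀ y ∈ N, σ y = y) → σ x = x) : x ∈ N := by
  rw [← InfiniteGalois.fixedField_fixingSubgroup N, IntermediateField.mem_fixedField_iff]
  intro σ hσ
  exact h σ ((IntermediateField.mem_fixingSubgroup_iff _ _).1 hσ)

/-- An automorphism acting trivially on the residues of a finite subextension `N` agrees on `N`
with an element of the inertia group. -/
theorem exists_inertia_eqOn (σ : Gal(Ω/K)) (N : IntermediateField K Ω) [FiniteDimensional K N]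
    (h : ∀ a : B, algebraMap B Ω a ∈ N → σ • a - a ∈ 𝔮) :
    ∃ ι ∈ inertiaGroup (K := K) (Ω := Ω) B, ∀ x ∈ N, ι x = σ x := by
  -- An automorphism ν over N with the same residue action as σ exists, since σ fixes the residues
  -- of the integral elements of N. Then σν⁻¹ lies in inertia and equals σ on N.
  obtain ⟨ν, hν, hνσ⟩ := exists_lift_residue (isOpen_stabilizer_integers (K := K) (Ω := Ω) B) 𝔮
    N.fixingSubgroup (isClosed_fixingSubgroup_finite N) (residueAut B σ) (fun a ha => by
      rw [residueAut_mk, Ideal.Quotient.eq]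
      refine h a (mem_of_fixed_fixingSubgroup N _ fun ν hν => ?_)
      rw [← algebraMap_gal_smul,
        ha ν ((IntermediateField.mem_fixingSubgroup_iff _ _).2 hν)])
  refine ⟨σ * ν⁻¹, ?_, fun x hx => ?_⟩
  · rw [mem_inertiaGroup]
    intro x
    have := hνσ (ν⁻¹ • x)
    rwa [smul_inv_smul, residueAut_mk, eq_comm, Ideal.Quotient.eq, smul_smul] at this
  · have h1 : ν⁻¹ x = x := (IntermediateField.mem_fixingSubgroup_iff _ _).1 (inv_mem hν) x hx
    rw [AlgEquiv.mul_apply, h1]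

variable (O : Type*) [CommRing O] [IsDedekindDomain O] [Algebra O K] [IsFractionRing O K]
  [Algebra O Ω] [IsScalarTower O K Ω] [Algebra O B] [IsScalarTower O B Ω]
  [IsIntegralClosure B O Ω] [Algebra.IsIntegral O B]
variable [Finite (O ⧸ Ideal.under O (IsLocalRing.maximalIdeal B))]

theorem gal_smul_algebraMap (σ : Gal(Ω/K)) (a : O) : σ • algebraMap O B a = algebraMap O B a := by
  apply FaithfulSMul.algebraMap_injective B Ω
  rw [algebraMap_gal_smul, ← IsScalarTower.algebraMap_apply, IsScalarTower.algebraMap_apply O K Ω,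
    σ.commutes]

/-- A fixed element lies in K and is integral over O, which is integrally closed. -/
theorem mem_range_of_gal_fixed (b : B) (hb : ∀ σ : Gal(Ω/K), σ • b = b) :
    ∃ a : O, algebraMap O B a = b := by
  have h1 : algebraMap B Ω b ∈ (⊥ : IntermediateField K Ω) := by
    rw [InfiniteGalois.mem_bot_iff_fixed]
    intro σ
    rw [← algebraMap_gal_smul, hb]
  obtain ⟨k, hk⟩ := IntermediateField.mem_bot.1 h1
  have h2 : IsIntegral O k := by
    have : IsIntegral O (algebraMap K Ω k) := by
      rw [hk]
      exact (Algebra.IsIntegral.isIntegral (R := O) b).algebraMap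
    exact (isIntegral_algebraMap_iff (algebraMap K Ω).injective).1 this
  obtain ⟨a, rfl⟩ := IsIntegrallyClosed.algebraMap_eq_of_integral h2
  refine ⟨a, FaithfulSMul.algebraMap_injective B Ω ?_⟩
  rw [← hk, ← IsScalarTower.algebraMap_apply, ← IsScalarTower.algebraMap_apply]

/-- An element of the Galois group that acts on the residue field by `x ↦ x ^ q`. -/
def IsFrob (f : Gal(Ω/K)) : Prop :=
  ∀ x : B, f • x - x ^ Nat.card (O ⧸ Ideal.under O 𝔮) ∈ 𝔮

attribute [local instance] Ideal.Quotient.field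

/-- The map x ↦ x ^ q is an automorphism of the residue field, algebraic over a finite field with q
elements, and it fixes the residues of O. So it lifts to the Galois group. -/
theorem exists_isFrob : ∃ f : Gal(Ω/K), IsFrob B O f := by
  have : (Ideal.under O 𝔮).IsMaximal := Ideal.IsMaximal.under O 𝔮
  have : Fintype (O ⧸ Ideal.under O 𝔮) := Fintype.ofFinite _
  obtain ⟨f, -, hf⟩ := exists_lift_residue (isOpen_stabilizer_integers (K := K) (Ω := Ω) B) 𝔮
    ⊤ isClosed_univ
    (FiniteField.frobeniusAlgEquivOfAlgebraic (O ⧸ Ideal.under O 𝔮) (B ⧸ 𝔮)).toRingEquiv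
    (fun a ha => by
      obtain ⟨o, rfl⟩ := mem_range_of_gal_fixed (K := K) (Ω := Ω) B O a fun σ => ha σ trivial
      exact (FiniteField.frobeniusAlgEquivOfAlgebraic (O ⧸ Ideal.under O 𝔮) (B ⧸ 𝔮)).commutes
        (Ideal.Quotient.mk _ o))
  refine ⟨f, fun x => ?_⟩
  rw [← Ideal.Quotient.eq, hf x]
  rw [map_pow, Nat.card_eq_fintype_card]
  rfl

variable {B O}

theorem IsFrob.mul_inertia {f ι : Gal(Ω/K)} (hf : IsFrob B O f)
    (hι : ι ∈ inertiaGroup (K := K) (Ω := Ω) B) : IsFrob B O (f * ι) := by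
  intro x
  have h1 := gal_smul_mem B f (mem_inertiaGroup.1 hι x)
  have h2 := add_mem h1 (hf x)
  rwa [smul_sub, sub_add_sub_cancel, smul_smul] at h2

theorem IsFrob.pow_smul {f : Gal(Ω/K)} (hf : IsFrob B O f) (j : ℕ) (x : B) :
    Ideal.Quotient.mk 𝔮 (f ^ j • x) =
      Ideal.Quotient.mk 𝔮 x ^ (Nat.card (O ⧸ Ideal.under O 𝔮) ^ j) := by
  induction j with
  | zero => simp
  | succ j ih =>
    rw [pow_succ' f, mul_smul, pow_succ, pow_mul, ← ih, ← map_pow, Ideal.Quotient.eq]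
    exact hf _

end Inertia

/-! ### Density of the Weil group -/

section WeilDensity

variable {K : Type*} {Ω : Type u} (B : Type*) [Field K] [CharZero K]
  [Field Ω] [Algebra K Ω] [IsGalois K Ω]
  [CommRing B] [IsLocalRing B] [Algebra B Ω] [FaithfulSMul B Ω]
  [MulSemiringAction Gal(Ω/K) B] [SMulDistribClass Gal(Ω/K) B Ω]
  (O : Type*) [CommRing O] [IsDedekindDomain O] [Algebra O K] [IsFractionRing O K]
  [Algebra O Ω] [IsScalarTower O K Ω] [Algebra O B] [IsScalarTower O B Ω]
  [IsIntegralClosure B O Ω] [Algebra.IsIntegral O B]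
variable [Finite (O ⧸ Ideal.under O (IsLocalRing.maximalIdeal B))]

local notation "𝔮" => IsLocalRing.maximalIdeal B

attribute [local instance] Ideal.Quotient.field

/-- Finitely many elements generate a finite field over k; it is normal, so s restricts to it, and
its automorphisms over k are powers of Frobenius. -/
theorem exists_pow_card_eq_of_finite {k k' : Type*} [Field k] [Finite k] [Field k'] [Algebra k k']
    [Algebra.IsAlgebraic k k'] (s : k' →ₐ[k] k') (T : Set k') (hT : T.Finite) :
    ∃ j : ℕ, ∀ x ∈ Submodule.span k T, s x = x ^ (Nat.card k ^ j) := by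
  have : Finite T := hT
  have : Fintype k := Fintype.ofFinite k
  let F := IntermediateField.adjoin k T
  have : FiniteDimensional k F :=
    IntermediateField.finiteDimensional_adjoin fun x _ => Algebra.IsIntegral.isIntegral x
  have : Finite F := Module.finite_of_finite k
  obtain ⟨j, hj⟩ := (FiniteField.bijective_frobeniusAlgHom_pow k F).2 (s.restrictNormal F)
  refine ⟨j, fun x hx => ?_⟩
  have hxF : x ∈ F := by
    have : Submodule.span k T ≤ Subalgebra.toSubmodule F.toSubalgebra :=
      Submodule.span_le.2 (IntermediateField.subset_adjoin k T)
    exact this hx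
  have h1 := s.restrictNormal_commutes F ⟨x, hxF⟩
  have h2 : ∀ (i : ℕ) (y : F), (FiniteField.frobeniusAlgHom k F ^ i) y = y ^ (Nat.card k ^ i) := by
    intro i y
    rw [AlgHom.coe_pow, FiniteField.coe_frobeniusAlgHom, pow_iterate, Nat.card_eq_fintype_card]
  rw [← hj, h2] at h1
  exact h1.symm

theorem isScalarTower_intermediateField {K Ω : Type*} [Field K] [Field Ω] [Algebra K Ω]
    (O : Type*) [CommRing O] [Algebra O K] [Algebra O Ω] [IsScalarTower O K Ω]
    (N : IntermediateField K Ω) : IsScalarTower O N Ω :=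
  IsScalarTower.of_algebraMap_eq fun r => by
    rw [IsScalarTower.algebraMap_apply O K N, ← IsScalarTower.algebraMap_apply K N Ω,
      ← IsScalarTower.algebraMap_apply O K Ω]

/-- The integers of N form a finite O-module, so their residues span a finite-dimensional space over
the residue field of O. On such a space every automorphism of the residue field acts as a power of
Frobenius, although it need not do so on the whole field. -/
theorem exists_residue_pow (σ : Gal(Ω/K)) (N : IntermediateField K Ω) [FiniteDimensional K N] :
    ∃ j : ℕ, ∀ a : B, algebraMap B Ω a ∈ N → Ideal.Quotient.mk 𝔮 (σ • a) =
      Ideal.Quotient.mk 𝔮 a ^ (Nat.card (O ⧸ Ideal.under O 𝔮) ^ j) := by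
  have : (Ideal.under O 𝔮).IsMaximal := Ideal.IsMaximal.under O 𝔮
  have hON : IsScalarTower O N Ω := isScalarTower_intermediateField O N
  have : IsScalarTower O (integralClosure O N) Ω := IsScalarTower.of_algebraMap_eq fun r =>
    (IsScalarTower.algebraMap_apply O N Ω r)
  have : Module.Finite O (integralClosure O N) := IsIntegralClosure.finite O K N _
  obtain ⟨T, hT⟩ := (Module.Finite.fg_top : (⊤ : Submodule O (integralClosure O N)).FG)
  let φ : integralClosure O N →ₐ[O] B := IsIntegralClosure.lift O B Ω
  let s : (B ⧸ 𝔮) →ₐ[O ⧸ Ideal.under O 𝔮] (B ⧸ 𝔮) :=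
    { (residueAut B σ : (B ⧸ 𝔮) →+* (B ⧸ 𝔮)) with
      commutes' := fun r => by
        obtain ⟨r, rfl⟩ := Ideal.Quotient.mk_surjective r
        exact congrArg (Ideal.Quotient.mk 𝔮) (gal_smul_algebraMap B O σ r) }
  obtain ⟨j, hj⟩ := exists_pow_card_eq_of_finite s
    ((fun t => Ideal.Quotient.mk 𝔮 (φ t)) '' (T : Set (integralClosure O N)))
    (T.finite_toSet.image _)
  refine ⟨j, fun a ha => ?_⟩
  have hint : IsIntegral O (⟨algebraMap B Ω a, ha⟩ : N) := by
    refine (isIntegral_algebraMap_iff (B := Ω) (algebraMap N Ω).injective).1 ?_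
    exact (Algebra.IsIntegral.isIntegral (R := O) a).algebraMap (B := Ω)
  have hφ : φ ⟨_, hint⟩ = a := by
    apply FaithfulSMul.algebraMap_injective B Ω
    exact IsIntegralClosure.algebraMap_lift O B Ω (S := integralClosure O N) ⟨_, hint⟩
  have key : ∀ b : integralClosure O N, Ideal.Quotient.mk 𝔮 (φ b) ∈
      Submodule.span (O ⧸ Ideal.under O 𝔮)
        ((fun t => Ideal.Quotient.mk 𝔮 (φ t)) '' (T : Set (integralClosure O N))) := by
    intro b
    have hb : b ∈ Submodule.span O (T : Set (integralClosure O N)) := by rw [hT]; trivial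
    induction hb using Submodule.span_induction with
    | mem x hx => exact Submodule.subset_span ⟨x, hx, rfl⟩
    | zero => simp
    | add x y _ _ hx hy => rw [map_add, map_add]; exact add_mem hx hy
    | smul r x _ hx =>
      rw [map_smul, Algebra.smul_def, map_mul]
      have := Submodule.smul_mem _ (Ideal.Quotient.mk (Ideal.under O 𝔮) r) hx
      rw [Algebra.smul_def] at this
      exact this
  have := hj _ (key ⟨_, hint⟩)
  rwa [hφ] at this

variable {B O} in
/-- Every element of the Galois group agrees on a finite subextension with an element of the
Weil group. -/
theorem IsFrob.exists_eqOn {f : Gal(Ω/K)} (hf : IsFrob B O f) (σ : Gal(Ω/K))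
    (N : IntermediateField K Ω) [FiniteDimensional K N] :
    ∃ j : ℕ, ∃ ι ∈ inertiaGroup (K := K) (Ω := Ω) B, ∀ x ∈ N, σ x = (f ^ j) (ι x) := by
  obtain ⟨j, hj⟩ := exists_residue_pow B O σ N
  -- Once the exponent j matches on residues, f^{-j}σ acts trivially on the residues of N and can be
  -- replaced by an inertia element there.
  obtain ⟨ι, hι, h⟩ := exists_inertia_eqOn B ((f ^ j)⁻¹ * σ) N (fun a ha => by
    have h1 := hj a ha
    rw [← hf.pow_smul, Ideal.Quotient.eq] at h1
    have h2 := gal_smul_mem B (f ^ j)⁻¹ h1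
    rwa [smul_sub, inv_smul_smul, smul_smul] at h2)
  refine ⟨j, ι, hι, fun x hx => ?_⟩
  rw [h x hx, AlgEquiv.mul_apply]
  exact ((f ^ j).apply_symm_apply _).symm

/-! ### Roots of unity -/

variable {B O}

theorem card_residue_mem : ((Nat.card (O ⧸ Ideal.under O 𝔮) : ℕ) : B) ∈ 𝔮 := by
  have : Fintype (O ⧸ Ideal.under O 𝔮) := Fintype.ofFinite _
  have h : ((Nat.card (O ⧸ Ideal.under O 𝔮) : ℕ) : O ⧸ Ideal.under O 𝔮) = 0 := by
    rw [Nat.card_eq_fintype_card]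
    exact Nat.cast_card_eq_zero _
  rw [← map_natCast (Ideal.Quotient.mk _), Ideal.Quotient.eq_zero_iff_mem] at h
  simpa using h

theorem one_lt_card_residue : 1 < Nat.card (O ⧸ Ideal.under O 𝔮) := by
  have : (Ideal.under O 𝔮).IsMaximal := Ideal.IsMaximal.under O 𝔮
  exact Finite.one_lt_card

theorem card_pow_sub_one_notMem {s : ℕ} (hs : s ≠ 0) :
    ((Nat.card (O ⧸ Ideal.under O 𝔮) ^ s - 1 : ℕ) : B) ∉ 𝔮 := by
  intro h
  have h1 : 1 ≤ Nat.card (O ⧸ Ideal.under O 𝔮) ^ s :=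
    Nat.one_le_pow _ _ (zero_lt_one.trans (one_lt_card_residue (B := B) (O := O)))
  rw [Nat.cast_sub h1, Nat.cast_pow, Nat.cast_one] at h
  have h2 := sub_mem (Ideal.pow_mem_of_mem 𝔮 (card_residue_mem (O := O)) s (Nat.pos_of_ne_zero hs)) h
  rw [sub_sub_cancel] at h2
  exact (Ideal.ne_top_iff_one 𝔮).1 Ideal.IsPrime.ne_top' h2

/-- A Frobenius element maps roots of unity of order prime to `p` to their `q`-th powers. -/
theorem IsFrob.apply_of_pow_eq_one {f : Gal(Ω/K)} (hf : IsFrob B O f) {s : ℕ} (hs : s ≠ 0) {ζ : Ω}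
    (hζ : ζ ^ (Nat.card (O ⧸ Ideal.under O 𝔮) ^ s - 1) = 1) :
    f ζ = ζ ^ Nat.card (O ⧸ Ideal.under O 𝔮) := by
  have : IsDomain B := (FaithfulSMul.algebraMap_injective B Ω).isDomain
  have hn : 0 < Nat.card (O ⧸ Ideal.under O 𝔮) ^ s - 1 :=
    Nat.sub_pos_of_lt (Nat.one_lt_pow hs one_lt_card_residue)
  have hint : IsIntegral O ζ := IsIntegral.of_pow hn (by rw [hζ]; exact isIntegral_one)
  obtain ⟨z, rfl⟩ := IsIntegralClosure.isIntegral_iff (A := B).1 hint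
  have hz : z ^ (Nat.card (O ⧸ Ideal.under O 𝔮) ^ s - 1) = 1 :=
    FaithfulSMul.algebraMap_injective B Ω (by rw [map_pow, hζ, map_one])
  have : SMulCommClass Gal(Ω/K) O B := ⟨fun g r x => by
    rw [Algebra.smul_def, Algebra.smul_def, smul_mul', gal_smul_algebraMap B O]⟩
  have hF : (MulSemiringAction.toAlgHom O B f).IsArithFrobAt 𝔮 := hf
  -- The elements f z and z ^ q have equal residues. Roots of unity whose order is invertible modulo
  -- the maximal ideal are determined by their residues.
  have := hF.apply_of_pow_eq_one hz (card_pow_sub_one_notMem hs)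
  rw [← algebraMap_gal_smul, ← map_pow]
  exact congrArg _ this

/-- Both f and fι are Frobenius elements, so they have the same value on ζ. -/
theorem inertia_apply_of_pow_eq_one {ι : Gal(Ω/K)}
    (hι : ι ∈ inertiaGroup (K := K) (Ω := Ω) B) {s : ℕ} (hs : s ≠ 0) {ζ : Ω}
    (hζ : ζ ^ (Nat.card (O ⧸ Ideal.under O 𝔮) ^ s - 1) = 1) : ι ζ = ζ := by
  obtain ⟨f, hf⟩ := exists_isFrob (K := K) (Ω := Ω) B O
  have h1 := (hf.mul_inertia hι).apply_of_pow_eq_one hs hζ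
  rw [← hf.apply_of_pow_eq_one hs hζ] at h1
  exact f.injective h1

theorem IsFrob.pow_apply_of_pow_eq_one {f : Gal(Ω/K)} (hf : IsFrob B O f) {s : ℕ} (hs : s ≠ 0)
    {ζ : Ω} (hζ : ζ ^ (Nat.card (O ⧸ Ideal.under O 𝔮) ^ s - 1) = 1) (k : ℕ) :
    (f ^ k) ζ = ζ ^ (Nat.card (O ⧸ Ideal.under O 𝔮) ^ k) := by
  induction k with
  | zero => simp
  | succ k ih =>
    rw [pow_succ', AlgEquiv.mul_apply, ih, map_pow, hf.apply_of_pow_eq_one hs hζ, ← pow_mul,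
      pow_succ']

/-- Since f^k sends ζ to its q^k-th power, ζ is fixed exactly if q^s - 1 divides q^k - 1. The gcd of
these numbers is q^(gcd(s,k)) - 1. -/
theorem IsFrob.pow_apply_eq_self_iff {f : Gal(Ω/K)} (hf : IsFrob B O f) {s : ℕ} (hs : s ≠ 0)
    {ζ : Ω} (hζ : IsPrimitiveRoot ζ (Nat.card (O ⧸ Ideal.under O 𝔮) ^ s - 1)) (k : ℕ) :
    (f ^ k) ζ = ζ ↔ s ∣ k := by
  have hq : 1 < Nat.card (O ⧸ Ideal.under O 𝔮) := one_lt_card_residue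
  rw [hf.pow_apply_of_pow_eq_one hs hζ.pow_eq_one]
  generalize Nat.card (O ⧸ Ideal.under O 𝔮) = q at *
  have h0 : ζ ≠ 0 := hζ.ne_zero (Nat.sub_pos_of_lt (Nat.one_lt_pow hs hq)).ne'
  have h1 : 1 ≤ q ^ k := Nat.one_le_pow _ _ (zero_lt_one.trans hq)
  have h2 : ζ ^ q ^ k = ζ ↔ ζ ^ (q ^ k - 1) = 1 := by
    rw [← mul_right_inj' (b := ζ ^ (q ^ k - 1)) h0, mul_one, ← pow_succ', Nat.sub_add_cancel h1]
  rw [h2, hζ.pow_eq_one_iff_dvd]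
  constructor
  · intro h
    have h3 := Nat.pow_sub_one_gcd_pow_sub_one q s k
    rw [Nat.gcd_eq_left h] at h3
    have h4 : q ^ s = q ^ s.gcd k := by
      have := Nat.one_le_pow s q (zero_lt_one.trans hq)
      have := Nat.one_le_pow (s.gcd k) q (zero_lt_one.trans hq)
      omega
    rw [Nat.pow_right_injective hq h4]
    exact Nat.gcd_dvd_right s k
  · rintro ⟨c, rfl⟩
    rw [pow_mul]
    simpa using Nat.sub_dvd_pow_sub_pow (q ^ s) 1 c

end WeilDensity

/-! ### Unramified extensions and inertia -/

section Unramified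

variable {K : Type*} {Ω : Type u} (B : Type*) [Field K] [CharZero K]
  [Field Ω] [Algebra K Ω] [IsGalois K Ω]
  [CommRing B] [IsLocalRing B] [Algebra B Ω] [FaithfulSMul B Ω]
  [MulSemiringAction Gal(Ω/K) B] [SMulDistribClass Gal(Ω/K) B Ω]
  (O : Type*) [CommRing O] [IsDedekindDomain O] [Algebra O K] [IsFractionRing O K]
  [Algebra O Ω] [IsScalarTower O K Ω] [Algebra O B] [IsScalarTower O B Ω]
  [IsIntegralClosure B O Ω] [Algebra.IsIntegral O B]
variable [Finite (O ⧸ Ideal.under O (IsLocalRing.maximalIdeal B))]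

local notation "𝔮" => IsLocalRing.maximalIdeal B


variable {O} in
/-- Formally unramified extensions are fixed by inertia. -/
theorem inertia_apply_of_formallyUnramified (M : IntermediateField K Ω) [FiniteDimensional K M]
    [Algebra.FormallyUnramified O (integralClosure O M)] {ι : Gal(Ω/K)}
    (hι : ι ∈ inertiaGroup (K := K) (Ω := Ω) B) {x : Ω} (hx : x ∈ M) : ι x = x := by
  -- The compositum of M and ι(M) receives both the inclusion of M and ι, and being finite it has
  -- Noetherian integers.
  let N : IntermediateField K Ω := M ⊔ M.map (ι : Ω →ₐ[K] Ω)
  have hfin : FiniteDimensional K (M.map (ι : Ω →ₐ[K] Ω)) := inferInstance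
  have : FiniteDimensional K N := IntermediateField.finiteDimensional_sup _ _
  have hON : IsScalarTower O N Ω := isScalarTower_intermediateField O N
  have : IsScalarTower O (integralClosure O N) Ω := IsScalarTower.of_algebraMap_eq fun r =>
    (IsScalarTower.algebraMap_apply O N Ω r)
  have : Module.Finite O (integralClosure O N) := IsIntegralClosure.finite O K N _
  have : IsNoetherianRing (integralClosure O N) := IsNoetherianRing.of_finite O _
  let φ : integralClosure O N →ₐ[O] B := IsIntegralClosure.lift O B Ω
  have hφ : ∀ y, algebraMap B Ω (φ y) = ((y : N) : Ω) := fun y =>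
    IsIntegralClosure.algebraMap_lift O B Ω y
  let j₁ : M →ₐ[K] N := IntermediateField.inclusion le_sup_left
  let j₂ : M →ₐ[K] N := ((ι : Ω →ₐ[K] Ω).comp M.val).codRestrict N.toSubalgebra fun y =>
    (le_sup_right : M.map (ι : Ω →ₐ[K] Ω) ≤ N) ⟨y, y.2, rfl⟩
  let g₁ : integralClosure O M →ₐ[O] integralClosure O N :=
    (j₁.restrictScalars O).mapIntegralClosure
  let g₂ : integralClosure O M →ₐ[O] integralClosure O N :=
    (j₂.restrictScalars O).mapIntegralClosure
  have hI : Ideal.comap φ 𝔮 ≠ ⊤ := Ideal.comap_ne_top _ Ideal.IsPrime.ne_top'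
  -- The inclusion and ι agree modulo the contracted maximal ideal because ι is in inertia. Its
  -- powers have zero intersection in a Noetherian domain, so formal unramifiedness makes the two
  -- homomorphisms equal.
  have hg : g₁ = g₂ := by
    refine Algebra.FormallyUnramified.ext_of_iInf (I := Ideal.comap φ 𝔮)
      (Ideal.iInf_pow_eq_bot_of_isDomain _ hI) fun y => ?_
    rw [eq_comm, Ideal.Quotient.eq, Ideal.mem_comap, map_sub]
    have : φ (g₂ y) = ι • φ (g₁ y) := by
      apply FaithfulSMul.algebraMap_injective B Ω
      rw [algebraMap_gal_smul, hφ, hφ]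
      rfl
    rw [this]
    exact hι _
  have : Algebra.IsAlgebraic O M := by
    have : Algebra.IsAlgebraic O K := IsLocalization.isAlgebraic _ (nonZeroDivisors O)
    exact Algebra.IsAlgebraic.trans O K M
  -- Equality on integers extends to M, whose elements become integral after multiplication by a
  -- nonzero element of O.
  obtain ⟨d, hd, hint⟩ :=
    (Algebra.IsAlgebraic.isAlgebraic (R := O) (⟨x, hx⟩ : M)).exists_integral_multiple
  have h1 : (((g₁ ⟨_, hint⟩ : integralClosure O N) : N) : Ω) =
      ((g₂ ⟨_, hint⟩ : integralClosure O N) : N) := by rw [hg]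
  have h2 : ((d • (⟨x, hx⟩ : M) : M) : Ω) = algebraMap K Ω (algebraMap O K d) * x := by
    rw [Algebra.smul_def, IsScalarTower.algebraMap_apply O K M]
    rfl
  change ((d • (⟨x, hx⟩ : M) : M) : Ω) = ι ((d • (⟨x, hx⟩ : M) : M) : Ω) at h1
  rw [h2, map_mul, ι.commutes] at h1
  refine (mul_left_cancel₀ ?_ h1).symm
  simpa using hd

/-- The unique maximal ideal of the integers of a finite subextension. -/
theorem eq_comap_lift (N : IntermediateField K Ω) 
    [IsScalarTower O (integralClosure O N) Ω]
    (P : Ideal (integralClosure O N)) [P.IsMaximal] :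
    P = Ideal.comap (IsIntegralClosure.lift O B Ω : integralClosure O N →ₐ[O] B) 𝔮 := by
  let φ : integralClosure O N →ₐ[O] B := IsIntegralClosure.lift O B Ω
  have hφ : ∀ y, algebraMap B Ω (φ y) = ((y : N) : Ω) := fun y =>
    IsIntegralClosure.algebraMap_lift O B Ω y
  have hinj : Function.Injective φ := by
    intro a b hab
    have h := congrArg (algebraMap B Ω) hab
    rw [hφ, hφ] at h
    exact Subtype.ext (Subtype.ext h)
  let : Algebra (integralClosure O N) B := φ.toRingHom.toAlgebra
  have : IsScalarTower O (integralClosure O N) B := IsScalarTower.of_algHom φ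
  have : Algebra.IsIntegral (integralClosure O N) B := Algebra.IsIntegral.tower_top O
  have : FaithfulSMul (integralClosure O N) B := (faithfulSMul_iff_algebraMap_injective _ _).2 hinj
  -- By integrality a maximal ideal of B lies over P, and B has only one.
  obtain ⟨P', hP', hP'P⟩ := Ideal.exists_ideal_over_maximal_of_isIntegral (S := B) P (by
    rw [FaithfulSMul.ker_algebraMap_eq_bot]; exact bot_le)
  rw [← IsLocalRing.eq_maximalIdeal hP', ← hP'P]
  rfl

/-- Finite Galois subextensions fixed by inertia are unramified. -/
theorem formallyUnramified_of_inertia_apply (N : IntermediateField K Ω) [FiniteDimensional K N]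
    [IsGalois K N]
    (h : ∀ ι ∈ inertiaGroup (K := K) (Ω := Ω) B, ∀ x ∈ N, ι x = x) :
    Algebra.FormallyUnramified O (integralClosure O N) := by
  have hON : IsScalarTower O N Ω := isScalarTower_intermediateField O N
  have : IsScalarTower O (integralClosure O N) Ω := IsScalarTower.of_algebraMap_eq fun r =>
    (IsScalarTower.algebraMap_apply O N Ω r)
  have : Module.Finite O (integralClosure O N) := IsIntegralClosure.finite O K N _
  have : IsDedekindDomain (integralClosure O N) := integralClosure.isDedekindDomain O K N
  have : IsFractionRing (integralClosure O N) N :=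
    integralClosure.isFractionRing_of_finite_extension K N
  have : CharZero O := (algebraMap O K).charZero_iff (IsFractionRing.injective O K) |>.2 ‹_›
  have : FaithfulSMul O (integralClosure O N) := by
    rw [faithfulSMul_iff_algebraMap_injective]
    refine Function.Injective.of_comp (f := algebraMap (integralClosure O N) N) ?_
    rw [← RingHom.coe_comp, ← IsScalarTower.algebraMap_eq, IsScalarTower.algebraMap_eq O K N]
    exact (algebraMap K N).injective.comp (IsFractionRing.injective O K)
  have : Module.IsTorsionFree O (integralClosure O N) := inferInstance
  have : IsGaloisGroup Gal(N/K) O (integralClosure O N) :=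
    IsGaloisGroup.of_isFractionRing _ _ _ K N
  rw [Algebra.formallyUnramified_iff_forall]
  rintro ⟨P, hP⟩
  by_cases hP0 : P = ⊥
  · subst hP0
    exact Algebra.isUnramifiedAt_bot
  have hPm : P.IsMaximal := hP.isMaximal hP0
  let φ : integralClosure O N →ₐ[O] B := IsIntegralClosure.lift O B Ω
  have hφ : ∀ y, algebraMap B Ω (φ y) = ((y : N) : Ω) := fun y =>
    IsIntegralClosure.algebraMap_lift O B Ω y
  have hPφ : P = Ideal.comap φ 𝔮 := eq_comap_lift B O N P
  have hPu : P.under O = Ideal.under O 𝔮 := by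
    rw [hPφ, Ideal.under_def, Ideal.under_def]
    change Ideal.comap _ (Ideal.comap (φ : integralClosure O N →+* B) 𝔮) = _
    rw [Ideal.comap_comap]
    congr 1
    exact φ.comp_algebraMap
  have hfin : Finite (O ⧸ P.under O) := by rw [hPu]; infer_instance
  have hmax : (P.under O).IsMaximal := Ideal.IsMaximal.under O P
  have : Finite (P.under O).ResidueField :=
    Finite.of_surjective _ (Ideal.bijective_algebraMap_quotient_residueField (P.under O)).2
  -- A lift of g to Ω acts trivially on the residues of N, hence agrees on N with an element of the
  -- full inertia group, which fixes N by hypothesis.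
  have hinertia : ∀ g ∈ Ideal.inertia Gal(N/K) P, g = 1 := by
    intro g hg
    let σ : Gal(Ω/K) := g.liftNormal Ω
    have hσ : ∀ y : N, σ (y : Ω) = ((g y : N) : Ω) := fun y => g.liftNormal_commutes Ω y
    obtain ⟨ι, hι, hισ⟩ := exists_inertia_eqOn B σ N (fun a ha => by
      have hint : IsIntegral O (⟨algebraMap B Ω a, ha⟩ : N) := by
        refine (isIntegral_algebraMap_iff (B := Ω) (algebraMap N Ω).injective).1 ?_
        exact (Algebra.IsIntegral.isIntegral (R := O) a).algebraMap (B := Ω)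
      have h1 := hg ⟨_, hint⟩
      change _ ∈ P at h1
      rw [hPφ, Ideal.mem_comap, map_sub] at h1
      have h2 : φ ⟨_, hint⟩ = a := FaithfulSMul.algebraMap_injective B Ω (hφ _)
      have h3 : φ (g • ⟨_, hint⟩) = σ • a := by
        apply FaithfulSMul.algebraMap_injective B Ω
        rw [hφ, algebraMap_gal_smul]
        exact (hσ ⟨_, ha⟩).symm
      rwa [h2, h3] at h1)
    ext y
    rw [← hσ, ← hισ _ y.2, h ι hι _ y.2]
    rfl
  have hcard : Nat.card (Ideal.inertia Gal(N/K) P) = 1 := by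
    rw [Subgroup.card_eq_one, Subgroup.eq_bot_iff_forall]
    exact hinertia
  -- The order of the inertia group is the ramification index; over a finite residue field index 1
  -- means unramified.
  rw [Ideal.card_inertia_eq_ramificationIdxIn (P.under O) P,
    Ideal.ramificationIdxIn_eq_ramificationIdx (P.under O) P Gal(N/K)] at hcard
  exact Ideal.ramificationIdx_eq_one_iff.1 hcard

end Unramified

/-! ### Unramified extensions of given degree -/

section Degree

variable {K : Type*} {Ω : Type u} (B : Type*) [Field K] [CharZero K]
  [Field Ω] [Algebra K Ω] [IsGalois K Ω]
  [CommRing B] [IsLocalRing B] [Algebra B Ω] [FaithfulSMul B Ω]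
  [MulSemiringAction Gal(Ω/K) B] [SMulDistribClass Gal(Ω/K) B Ω]
  (O : Type*) [CommRing O] [IsDedekindDomain O] [Algebra O K] [IsFractionRing O K]
  [Algebra O Ω] [IsScalarTower O K Ω] [Algebra O B] [IsScalarTower O B Ω]
  [IsIntegralClosure B O Ω] [Algebra.IsIntegral O B]
variable [Finite (O ⧸ Ideal.under O (IsLocalRing.maximalIdeal B))]

local notation "𝔮" => IsLocalRing.maximalIdeal B



open IntermediateField

variable {B O} in
/-- A finite subextension `M` fixed by inertia is fixed by the `[M : K]`-th power of Frobenius. -/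
theorem IsFrob.pow_finrank_apply {f : Gal(Ω/K)} (hf : IsFrob B O f) (M : IntermediateField K Ω)
    [FiniteDimensional K M] (hM : ∀ ι ∈ inertiaGroup (K := K) (Ω := Ω) B, ∀ x ∈ M, ι x = x)
    {x : Ω} (hx : x ∈ M) : (f ^ Module.finrank K M) x = x := by
  classical
  have hint : IsIntegral K x := Algebra.IsIntegral.isIntegral x
  let R : Finset Ω := ((minpoly K x).rootSet Ω).toFinset
  have hR : ∀ y, y ∈ R ↔ Polynomial.aeval y (minpoly K x) = 0 := fun y => by
    rw [Set.mem_toFinset, Polynomial.mem_rootSet]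
    exact ⟨fun h => h.2, fun h => ⟨minpoly.ne_zero hint, h⟩⟩
  have hRcard : R.card = (minpoly K x).natDegree := by
    rw [Set.toFinset_card]
    exact Polynomial.card_rootSet_eq_natDegree (IsGalois.separable K x) (IsGalois.splits K x)
  have hmem : ∀ σ : Gal(Ω/K), σ x ∈ R := fun σ => by
    rw [hR]
    have h := Polynomial.aeval_algHom_apply (σ : Ω →ₐ[K] Ω) x (minpoly K x)
    rw [minpoly.aeval, map_zero] at h
    exact h
  have hiter : ∀ j : ℕ, (f ^ j) x = f^[j] x := fun j => by
    rw [AlgEquiv.coe_pow]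
  -- The iterates of f on x stay in the finite set R of conjugates of x, and f is injective.
  have hper : 0 < Function.minimalPeriod f x := by
    rw [Function.minimalPeriod_pos_iff_mem_periodicPts]
    by_contra hcon
    have hinj : Function.Injective fun j : ℕ => f^[j] x := by
      intro a b hab
      by_contra hne
      wlog hlt : a < b generalizing a b
      · exact this hab.symm (Ne.symm hne) (lt_of_le_of_ne (not_lt.1 hlt) (Ne.symm hne))
      refine hcon ⟨b - a, Nat.sub_pos_of_lt hlt, ?_⟩
      have h1 : f^[a] (f^[b - a] x) = f^[a] x := by
        rw [← Function.iterate_add_apply, Nat.add_sub_cancel' hlt.le]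
        exact hab.symm
      exact f.injective.iterate a h1
    have := Set.infinite_of_injective_forall_mem hinj (s := (R : Set Ω)) fun j => by
      rw [← hiter]; exact hmem _
    exact this R.finite_toSet
  -- The orbit of x under f is the full set of its conjugates: every Galois automorphism agrees on M
  -- with f^j ι, and ι fixes M. So the period is the degree of x, a divisor of [M : K].
  have hPd : Function.minimalPeriod f x = (minpoly K x).natDegree := by
    rw [← hRcard, ← Finset.card_range (Function.minimalPeriod f x)]
    refine Finset.card_bij (fun j _ => f^[j] x) (fun j _ => by rw [← hiter]; exact hmem _)
      (fun a ha b hb hab => ?_) (fun y hy => ?_)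
    · exact Function.iterate_injOn_Iio_minimalPeriod (Finset.mem_range.1 ha)
        (Finset.mem_range.1 hb) hab
    · obtain ⟨σ, rfl⟩ := minpoly.exists_algEquiv_of_root' hint.isAlgebraic ((hR y).1 hy)
      obtain ⟨j, ι, hι, hj⟩ := hf.exists_eqOn σ M
      refine ⟨j % Function.minimalPeriod f x, Finset.mem_range.2 (Nat.mod_lt _ hper), ?_⟩
      rw [hj x hx, hM ι hι x hx, hiter, Function.iterate_mod_minimalPeriod_eq]
  have hdvd : Function.minimalPeriod f x ∣ Module.finrank K M := by
    rw [hPd]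
    have : minpoly K x = minpoly K (⟨x, hx⟩ : M) :=
      minpoly.algebraMap_eq (algebraMap M Ω).injective (⟨x, hx⟩ : M)
    rw [this]
    exact minpoly.degree_dvd (Algebra.IsIntegral.isIntegral _)
  rw [hiter]
  exact (Function.isPeriodicPt_iff_minimalPeriod_dvd).2 hdvd

/-- By density of the Weil group and triviality of inertia, the Galois group of K(ζ) is generated by
the restriction φ of a Frobenius element. As φ^s = 1, the degree divides s. Conversely the power of
Frobenius with exponent the degree fixes ζ, which forces s to divide the degree. -/
theorem finrank_adjoin_primitiveRoot {s : ℕ} (hs : s ≠ 0) {ζ : Ω}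
    (hζ : IsPrimitiveRoot ζ (Nat.card (O ⧸ Ideal.under O 𝔮) ^ s - 1)) :
    IsGalois K K⟮ζ⟯ ∧ Module.finrank K K⟮ζ⟯ = s ∧
      ∀ ι ∈ inertiaGroup (K := K) (Ω := Ω) B, ∀ x ∈ K⟮ζ⟯, ι x = x := by
  have hn : Nat.card (O ⧸ Ideal.under O 𝔮) ^ s - 1 ≠ 0 :=
    (Nat.sub_pos_of_lt (Nat.one_lt_pow hs one_lt_card_residue)).ne'
  have : NeZero (Nat.card (O ⧸ Ideal.under O 𝔮) ^ s - 1) := ⟨hn⟩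
  have := hζ.intermediateField_adjoin_isCyclotomicExtension K
  have hgal : IsGalois K K⟮ζ⟯ :=
    IsCyclotomicExtension.isGalois {Nat.card (O ⧸ Ideal.under O 𝔮) ^ s - 1} K _
  have hfin : FiniteDimensional K K⟮ζ⟯ :=
    adjoin.finiteDimensional (Algebra.IsIntegral.isIntegral ζ)
  -- Automorphisms that agree on the generator ζ agree on K(ζ).
  have hext : ∀ σ τ : Gal(Ω/K), σ ζ = τ ζ → ∀ x ∈ K⟮ζ⟯, σ x = τ x := by
    intro σ τ h x hx
    have : (τ⁻¹ * σ) ∈ K⟮ζ⟯.fixingSubgroup := by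
      rw [IntermediateField.mem_fixingSubgroup_iff]
      have h1 : K⟮ζ⟯ ≤ fixedField (Subgroup.zpowers (τ⁻¹ * σ)) := by
        rw [adjoin_simple_le_iff, mem_fixedField_iff]
        have h2 : (τ⁻¹ * σ) ζ = ζ := by
          rw [AlgEquiv.mul_apply, h]
          exact τ.symm_apply_apply ζ
        intro g hg
        have h3 : Subgroup.zpowers (τ⁻¹ * σ) ≤ MulAction.stabilizer Gal(Ω/K) ζ := by
          rw [Subgroup.zpowers_le]
          exact h2
        exact h3 hg
      intro y hy
      exact (mem_fixedField_iff _ _).1 (h1 hy) _ (Subgroup.mem_zpowers _)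
    have h4 := (IntermediateField.mem_fixingSubgroup_iff _ _).1 this x hx
    rw [AlgEquiv.mul_apply] at h4
    have h5 := congrArg τ h4
    rwa [show τ (τ⁻¹ (σ x)) = σ x from τ.apply_symm_apply _] at h5
  have hin : ∀ ι ∈ inertiaGroup (K := K) (Ω := Ω) B, ∀ x ∈ K⟮ζ⟯, ι x = x := fun ι hι x hx =>
    hext ι 1 (inertia_apply_of_pow_eq_one hι hs hζ.pow_eq_one) x hx
  refine ⟨hgal, ?_, hin⟩
  obtain ⟨f, hf⟩ := exists_isFrob (K := K) (Ω := Ω) B O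
  let φ : Gal(K⟮ζ⟯/K) := AlgEquiv.restrictNormalHom K⟮ζ⟯ f
  apply Nat.dvd_antisymm
  · have hpow : ∀ k : ℕ, (φ ^ k = 1) ↔ s ∣ k := by
      intro k
      rw [← hf.pow_apply_eq_self_iff hs hζ k]
      have hc : ∀ y : K⟮ζ⟯, (((φ ^ k) y : K⟮ζ⟯) : Ω) = (f ^ k) (y : Ω) := by
        intro y
        rw [← map_pow]
        exact AlgEquiv.restrictNormal_commutes (f ^ k) K⟮ζ⟯ y
      constructor
      · intro h
        have := hc ⟨ζ, mem_adjoin_simple_self K ζ⟩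
        rw [h] at this
        exact this.symm
      · intro h
        ext y
        rw [hc, hext (f ^ k) 1 h _ y.2]
        rfl
    have horder : orderOf φ ∣ s := orderOf_dvd_of_pow_eq_one ((hpow s).2 dvd_rfl)
    have hgen : ∀ g : Gal(K⟮ζ⟯/K), g ∈ Subgroup.zpowers (φ) := by
      intro g
      obtain ⟨j, ι, hι, hj⟩ := hf.exists_eqOn (g.liftNormal Ω) K⟮ζ⟯
      refine ⟨j, ?_⟩
      ext y
      change (((φ ^ (j : ℤ)) y : K⟮ζ⟯) : Ω) = _
      rw [zpow_natCast, ← map_pow]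
      refine (AlgEquiv.restrictNormal_commutes (f ^ j) K⟮ζ⟯ y).trans ?_
      refine Eq.trans ?_ (g.liftNormal_commutes Ω y)
      have := hj y y.2
      rw [hin ι hι y y.2] at this
      exact this.symm
    rw [← IsGalois.card_aut_eq_finrank, ← orderOf_eq_card_of_forall_mem_zpowers hgen]
    exact horder
  · rw [← hf.pow_apply_eq_self_iff hs hζ]
    exact hf.pow_finrank_apply _ hin (mem_adjoin_simple_self K ζ)

end Degree

/-! ### Quadratic extensions -/

section Quadratic

variable {K E : Type*} [Field K] [CharZero K] [Field E] [Algebra K E]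

theorem isGalois_of_finrank_eq_two (hE : Module.finrank K E = 2) : IsGalois K E :=
  have : Algebra.IsQuadraticExtension K E := ⟨hE⟩
  inferInstance

theorem eq_one_or_eq_of_finrank_eq_two (hE : Module.finrank K E = 2) {τ : E ≃ₐ[K] E} (hτ : τ ≠ 1)
    (g : E ≃ₐ[K] E) : g = 1 ∨ g = τ := by
  classical
  have := isGalois_of_finrank_eq_two hE
  have : FiniteDimensional K E := Module.finite_of_finrank_eq_succ hE
  have hc : Fintype.card (E ≃ₐ[K] E) = 2 := by
    rw [← Nat.card_eq_fintype_card, IsGalois.card_aut_eq_finrank, hE]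
  by_contra! h
  have h3 : ({1, τ, g} : Finset (E ≃ₐ[K] E)).card = 3 := by
    rw [Finset.card_eq_three]
    exact ⟨1, τ, g, hτ.symm, h.1.symm, h.2.symm, rfl⟩
  have := Finset.card_le_univ ({1, τ, g} : Finset (E ≃ₐ[K] E))
  omega

theorem apply_apply_of_finrank_eq_two (hE : Module.finrank K E = 2) {τ : E ≃ₐ[K] E} (hτ : τ ≠ 1)
    (x : E) : τ (τ x) = x := by
  rcases eq_one_or_eq_of_finrank_eq_two hE hτ (τ * τ) with h | h
  · exact DFunLike.congr_fun h x
  · exact absurd (mul_eq_left.1 h) hτ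

theorem exists_apply_eq_neg (hE : Module.finrank K E = 2) {τ : E ≃ₐ[K] E} (hτ : τ ≠ 1) :
    ∃ e : E, e ≠ 0 ∧ τ e = -e := by
  obtain ⟨y, hy⟩ := DFunLike.exists_ne hτ
  refine ⟨y - τ y, sub_ne_zero.2 (Ne.symm hy), ?_⟩
  rw [map_sub, apply_apply_of_finrank_eq_two hE hτ, neg_sub]

end Quadratic

/-! ### Frobenius and inertia elements of a `p`-adic field -/

section Padic

variable (p : ℕ) [Fact p.Prime] {K : Type u} [Field K] [Algebra ℚ_[p] K]
  [FiniteDimensional ℚ_[p] K]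

omit [FiniteDimensional ℚ_[p] K] in
instance faithfulSMul_geomInt : FaithfulSMul (GeomInt p K) (AlgebraicClosure K) :=
  (faithfulSMul_iff_algebraMap_injective _ _).2 (geomInt_injective p K)

variable (K) in
/-- The inertia subgroup of the absolute Galois group of `K`. -/
def absInertia : Subgroup (AlgebraicClosure K ≃ₐ[K] AlgebraicClosure K) :=
  inertiaGroup (K := K) (Ω := AlgebraicClosure K) (GeomInt p K)

instance absInertia_normal : (absInertia p K).Normal :=
  have := charZero_of_padic p K
  have : IsGalois K (AlgebraicClosure K) := {}
  inertiaGroup_normal _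

/-- The integers of K̄ have only one maximal ideal, so the condition over all Q is a single
condition. -/
theorem isFrobenius_iff (f : AlgebraicClosure K ≃ₐ[K] AlgebraicClosure K) :
    IsFrobenius p f ↔ IsFrob (GeomInt p K) (ringOfIntegers p K) f := by
  have : IsLocalRing (integralClosure (ringOfIntegers p K) (AlgebraicClosure K)) :=
    isLocalRing_geomInt p K
  constructor
  · intro h
    have hm := IsLocalRing.maximalIdeal.isMaximal (GeomInt p K)
    exact h _ hm
  · intro h Q hQ
    have hQ' : Q = IsLocalRing.maximalIdeal (GeomInt p K) := IsLocalRing.eq_maximalIdeal hQ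
    subst hQ'
    exact h

variable {p}

/-- `γ` is the product of `f ^ k` and an element of inertia. -/
def IsWeil (p : ℕ) [Fact p.Prime] {K : Type u} [Field K] [Algebra ℚ_[p] K]
    [FiniteDimensional ℚ_[p] K] (f γ : AlgebraicClosure K ≃ₐ[K] AlgebraicClosure K) (k : ℤ) :
    Prop :=
  ∃ ι ∈ absInertia p K, γ = f ^ k * ι

variable {f γ δ : AlgebraicClosure K ≃ₐ[K] AlgebraicClosure K} {k l : ℤ}

/-- Inertia is normal, so degrees can be computed in the quotient by it; this makes them add under
products and change sign under inversion. -/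
theorem isWeil_iff : IsWeil p f γ k ↔
    (γ : (AlgebraicClosure K ≃ₐ[K] AlgebraicClosure K) ⧸ absInertia p K) =
      (f : (AlgebraicClosure K ≃ₐ[K] AlgebraicClosure K) ⧸ absInertia p K) ^ k := by
  rw [← QuotientGroup.mk_zpow, eq_comm, QuotientGroup.eq]
  constructor
  · rintro ⟨ι, hι, rfl⟩
    simpa using hι
  · intro h
    exact ⟨_, h, by simp⟩

theorem isWeil_of_mem (h : γ ∈ absInertia p K) : IsWeil p f γ 0 := ⟨γ, h, by simp⟩

theorem isWeil_zpow (f : AlgebraicClosure K ≃ₐ[K] AlgebraicClosure K) (k : ℤ) :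
    IsWeil p f (f ^ k) k := isWeil_iff.2 (by simp)

theorem IsWeil.mul (h : IsWeil p f γ k) (h' : IsWeil p f δ l) : IsWeil p f (γ * δ) (k + l) := by
  rw [isWeil_iff] at *
  rw [QuotientGroup.mk_mul, h, h', zpow_add]

theorem IsWeil.inv (h : IsWeil p f γ k) : IsWeil p f γ⁻¹ (-k) := by
  rw [isWeil_iff] at *
  rw [QuotientGroup.mk_inv, h, zpow_neg]

theorem inertia_apply_of_isUnramified {M : IntermediateField K (AlgebraicClosure K)}
    (hM : IsUnramified p M) {ι : AlgebraicClosure K ≃ₐ[K] AlgebraicClosure K}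
    (hι : ι ∈ absInertia p K) {x : AlgebraicClosure K} (hx : x ∈ M) : ι x = x := by
  have := charZero_of_padic p K
  have : IsGalois K (AlgebraicClosure K) := {}
  have := hM.1
  have := hM.2
  exact inertia_apply_of_formallyUnramified (O := ringOfIntegers p K) (GeomInt p K) M hι hx

/-- The elements fixed by a Galois automorphism. -/
def fixedBy (γ : AlgebraicClosure K ≃ₐ[K] AlgebraicClosure K) :
    IntermediateField K (AlgebraicClosure K) :=
  IntermediateField.fixedField (Subgroup.zpowers γ)

omit [Algebra ℚ_[p] K] [FiniteDimensional ℚ_[p] K] in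
theorem mem_fixedBy {x : AlgebraicClosure K} : x ∈ fixedBy γ ↔ γ x = x := by
  rw [fixedBy, IntermediateField.mem_fixedField_iff]
  refine ⟨fun h => h γ (Subgroup.mem_zpowers γ), fun h g hg => ?_⟩
  have : Subgroup.zpowers γ ≤ MulAction.stabilizer _ x := by
    rw [Subgroup.zpowers_le]
    exact h
  exact this hg

theorem inertia_apply_of_mem_maxUnramified
    {ι : AlgebraicClosure K ≃ₐ[K] AlgebraicClosure K} (hι : ι ∈ absInertia p K)
    {x : AlgebraicClosure K} (hx : x ∈ maxUnramified p K) : ι x = x := by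
  have : maxUnramified p K ≤ fixedBy ι :=
    sSup_le fun M hM y hy => mem_fixedBy.2 (inertia_apply_of_isUnramified hM hι hy)
  exact mem_fixedBy.1 (this hx)

theorem IsWeil.apply_of_mem_maxUnramified (h : IsWeil p f γ k)
    {x : AlgebraicClosure K} (hx : x ∈ maxUnramified p K) : γ x = (f ^ k) x := by
  obtain ⟨ι, hι, rfl⟩ := h
  rw [AlgEquiv.mul_apply, inertia_apply_of_mem_maxUnramified hι hx]

/-- The Weil group is dense in the absolute Galois group. -/
theorem IsFrobenius.exists_isWeil_eqOn (hf : IsFrobenius p f)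
    (σ : AlgebraicClosure K ≃ₐ[K] AlgebraicClosure K)
    (N : IntermediateField K (AlgebraicClosure K)) [FiniteDimensional K N] :
    ∃ γ, ∃ k : ℤ, IsWeil p f γ k ∧ ∀ x ∈ N, γ x = σ x := by
  have := charZero_of_padic p K
  have : IsGalois K (AlgebraicClosure K) := {}
  obtain ⟨j, ι, hι, h⟩ := ((isFrobenius_iff p f).1 hf).exists_eqOn σ N
  refine ⟨f ^ j * ι, j, ⟨ι, hι, by simp⟩, fun x hx => (h x hx).symm⟩

/-- This is the Galois correspondence with Weil elements in place of arbitrary ones. Given σ fixing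
M, density yields a Weil element that agrees with σ on the finite extension N(x). It is only known
to fix the part of M inside N, hence the auxiliary field N. -/
theorem IsFrobenius.mem_of_isWeil_fixed (hf : IsFrobenius p f)
    (M : IntermediateField K (AlgebraicClosure K)) 
    (N : IntermediateField K (AlgebraicClosure K)) [FiniteDimensional K N] {x : AlgebraicClosure K}
    (h : ∀ γ k, IsWeil p f γ k → (∀ y ∈ M ⊓ N, γ y = y) → γ x = x) : x ∈ M := by
  have := charZero_of_padic p K
  have : IsGalois K (AlgebraicClosure K) := {}
  refine mem_of_fixed_fixingSubgroup M x fun σ hσ => ?_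
  have : FiniteDimensional K (IntermediateField.adjoin K {x}) :=
    IntermediateField.adjoin.finiteDimensional (Algebra.IsIntegral.isIntegral x)
  have : FiniteDimensional K (N ⊔ IntermediateField.adjoin K {x} :
    IntermediateField K (AlgebraicClosure K)) := IntermediateField.finiteDimensional_sup _ _
  obtain ⟨γ, k, hγ, hγσ⟩ := hf.exists_isWeil_eqOn σ (N ⊔ IntermediateField.adjoin K {x})
  rw [← hγσ x ((le_sup_right : _ ≤ N ⊔ IntermediateField.adjoin K {x})
    (IntermediateField.mem_adjoin_simple_self K x))]
  exact h γ k hγ fun y hy => by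
    rw [hγσ y ((le_sup_left : N ≤ N ⊔ IntermediateField.adjoin K {x}) hy.2), hσ y hy.1]

theorem IsFrobenius.mem_range_of_isWeil_fixed (hf : IsFrobenius p f) {x : AlgebraicClosure K}
    (h : ∀ γ k, IsWeil p f γ k → γ x = x) : x ∈ (⊥ : IntermediateField K (AlgebraicClosure K)) :=
  hf.mem_of_isWeil_fixed ⊥ ⊥ fun γ k hγ _ => h γ k hγ

/-- Two Frobenius elements differ by an element of inertia. -/
theorem IsFrobenius.isWeil (hf : IsFrobenius p f) {f' : AlgebraicClosure K ≃ₐ[K] AlgebraicClosure K}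
    (hf' : IsFrobenius p f') : IsWeil p f f' 1 := by
  have := charZero_of_padic p K
  have : IsGalois K (AlgebraicClosure K) := {}
  rw [isFrobenius_iff] at hf hf'
  refine ⟨f⁻¹ * f', fun x => ?_, by simp⟩
  have h1 := gal_smul_mem (GeomInt p K) f⁻¹ (sub_mem (hf' x) (hf x))
  rwa [sub_sub_sub_cancel_right, smul_sub, inv_smul_smul, smul_smul] at h1

/-! ### Unramified extensions of given degree -/

/-- The field is K(ζ) for a primitive root of unity ζ of order q^s - 1. The last clause lets the
degree of a Weil element modulo s be read off from its action on this field. -/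
theorem exists_isUnramified_finrank {s : ℕ} (hs : s ≠ 0) :
    ∃ M : IntermediateField K (AlgebraicClosure K), IsUnramified p M ∧ Module.finrank K M = s ∧
      FiniteDimensional K M ∧ ∀ f, IsFrobenius p f → ∀ k : ℤ, (∀ x ∈ M, (f ^ k) x = x) →
        (s : ℤ) ∣ k := by
  have := charZero_of_padic p K
  have : IsGalois K (AlgebraicClosure K) := {}
  let q := Nat.card (ringOfIntegers p K ⧸
    (IsLocalRing.maximalIdeal (GeomInt p K)).under (ringOfIntegers p K))
  have hq : 1 < q := one_lt_card_residue (B := GeomInt p K)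
  have : NeZero (q ^ s - 1) := ⟨(Nat.sub_pos_of_lt (Nat.one_lt_pow hs hq)).ne'⟩
  have : CharZero (AlgebraicClosure K) :=
    charZero_of_injective_algebraMap (algebraMap K (AlgebraicClosure K)).injective
  obtain ⟨ζ, hζ⟩ := HasEnoughRootsOfUnity.exists_primitiveRoot (AlgebraicClosure K) (q ^ s - 1)
  obtain ⟨hgal, hrank, hin⟩ := finrank_adjoin_primitiveRoot (K := K) (Ω := AlgebraicClosure K)
    (GeomInt p K) (ringOfIntegers p K) hs hζ
  have hfin : FiniteDimensional K (IntermediateField.adjoin K {ζ}) :=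
    IntermediateField.adjoin.finiteDimensional (Algebra.IsIntegral.isIntegral ζ)
  refine ⟨IntermediateField.adjoin K {ζ}, ⟨hfin, ?_⟩, hrank, hfin, fun f hf k hk => ?_⟩
  · exact formallyUnramified_of_inertia_apply (GeomInt p K) (ringOfIntegers p K) _ hin
  · have h1 : (f ^ k.natAbs) ζ = ζ := by
      have h2 := hk ζ (IntermediateField.mem_adjoin_simple_self K ζ)
      rcases Int.natAbs_eq k with h | h
      · rw [h, zpow_natCast] at h2
        exact h2
      · rw [h, zpow_neg, zpow_natCast] at h2
        nth_rewrite 1 [← h2]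
        exact (f ^ k.natAbs).apply_symm_apply ζ
    rw [Int.natCast_dvd]
    exact (((isFrobenius_iff p f).1 hf).pow_apply_eq_self_iff hs hζ _).1 h1

theorem IsFrobenius.isWeil_apply_of_mem_unramifiedExt (hf : IsFrobenius p f) {s : ℕ}
    (h : IsWeil p f γ k) (hk : (s : ℤ) ∣ k) {x : AlgebraicClosure K}
    (hx : x ∈ unramifiedExt p K s) : γ x = x := by
  have := charZero_of_padic p K
  have : IsGalois K (AlgebraicClosure K) := {}
  have hle : unramifiedExt p K s ≤ fixedBy γ := by
    refine sSup_le fun M hM y hy => mem_fixedBy.2 ?_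
    obtain ⟨hM, rfl⟩ := hM
    obtain ⟨c, rfl⟩ := hk
    obtain ⟨ι, hι, rfl⟩ := h
    have := hM.1
    have h1 : (f ^ Module.finrank K M) y = y :=
      ((isFrobenius_iff p f).1 hf).pow_finrank_apply M
        (fun ι hι x hx => inertia_apply_of_isUnramified hM hι hx) hy
    rw [AlgEquiv.mul_apply, inertia_apply_of_isUnramified hM hι hy, zpow_mul, zpow_natCast]
    have h2 : y ∈ fixedBy (f ^ Module.finrank K M) := mem_fixedBy.2 h1
    exact (IntermediateField.mem_fixedField_iff _ _).1 h2 _ ⟨c, rfl⟩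
  exact mem_fixedBy.1 (hle hx)

/-- Every unramified field of degree s is fixed by inertia and by f^s, hence so is the compositum.
Conversely the compositum contains K(ζ), and a Weil element that fixes K(ζ) has degree divisible by
s. Uniqueness of the unramified extension is not needed. -/
theorem IsFrobenius.mem_unramifiedExt_iff (hf : IsFrobenius p f) {s : ℕ} (hs : s ≠ 0)
    {x : AlgebraicClosure K} : x ∈ unramifiedExt p K s ↔
      ∀ γ k, IsWeil p f γ k → (s : ℤ) ∣ k → γ x = x := by
  refine ⟨fun hx γ k h hk => hf.isWeil_apply_of_mem_unramifiedExt h hk hx, fun h => ?_⟩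
  obtain ⟨M, hM, hMs, hfin, hMf⟩ := exists_isUnramified_finrank (p := p) (K := K) hs
  have hle : M ≤ unramifiedExt p K s := le_sSup ⟨hM, hMs⟩
  refine hle (hf.mem_of_isWeil_fixed M M fun γ k hγ hy => h γ k hγ ?_)
  refine hMf f hf k fun x hx => ?_
  obtain ⟨ι, hι, rfl⟩ := hγ
  have := hy x ⟨hx, hx⟩
  rwa [AlgEquiv.mul_apply, inertia_apply_of_isUnramified hM hι hx] at this

end Padic

/-! ### Ramified quadratic extensions -/

section Ramified

variable {p : ℕ} [Fact p.Prime] {K : Type u} [Field K] [Algebra ℚ_[p] K]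
  [FiniteDimensional ℚ_[p] K] {E : IntermediateField K (AlgebraicClosure K)}
  {f γ δ : AlgebraicClosure K ≃ₐ[K] AlgebraicClosure K} {k l : ℤ}

/-- `γ` fixes `E` pointwise. -/
def Fixes (E : IntermediateField K (AlgebraicClosure K))
    (γ : AlgebraicClosure K ≃ₐ[K] AlgebraicClosure K) : Prop := ∀ x ∈ E, γ x = x

omit [Algebra ℚ_[p] K] [FiniteDimensional ℚ_[p] K] in
theorem fixes_iff_mem : Fixes E γ ↔ γ ∈ E.fixingSubgroup :=
  (IntermediateField.mem_fixingSubgroup_iff _ _).symm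

omit [Algebra ℚ_[p] K] [FiniteDimensional ℚ_[p] K] in
theorem fixes_or_eq [CharZero K] (hE : Module.finrank K E = 2) {τ : E ≃ₐ[K] E} (hτ : τ ≠ 1)
    (γ : AlgebraicClosure K ≃ₐ[K] AlgebraicClosure K) :
    Fixes E γ ∨ ∀ x : E, γ x = τ x := by
  have := isGalois_of_finrank_eq_two hE
  have h : ∀ x : E, ((γ.restrictNormal E x : E) : AlgebraicClosure K) = γ x := fun x =>
    γ.restrictNormal_commutes E x
  rcases eq_one_or_eq_of_finrank_eq_two hE hτ (γ.restrictNormal E) with h1 | h1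
  · left
    intro x hx
    rw [← h ⟨x, hx⟩, h1]
    rfl
  · right
    intro x
    rw [← h, h1]

omit [Algebra ℚ_[p] K] [FiniteDimensional ℚ_[p] K] in
theorem apply_of_not_fixes [CharZero K] (hE : Module.finrank K E = 2) {τ : E ≃ₐ[K] E} (hτ : τ ≠ 1)
    (h : ¬ Fixes E γ) (x : E) : γ x = τ x :=
  (fixes_or_eq hE hτ γ).resolve_left h x

omit [Algebra ℚ_[p] K] [FiniteDimensional ℚ_[p] K] in
theorem fixes_mul_of_not_fixes [CharZero K] (hE : Module.finrank K E = 2) (h : ¬ Fixes E γ)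
    (h' : ¬ Fixes E δ) : Fixes E (γ * δ) := by
  by_cases hτ : ∃ τ : E ≃ₐ[K] E, τ ≠ 1
  · obtain ⟨τ, hτ⟩ := hτ
    intro x hx
    rw [AlgEquiv.mul_apply, apply_of_not_fixes hE hτ h' ⟨x, hx⟩, apply_of_not_fixes hE hτ h,
      apply_apply_of_finrank_eq_two hE hτ]
  · push Not at hτ
    have := isGalois_of_finrank_eq_two hE
    refine absurd (fun x hx => ?_) h
    have h1 := γ.restrictNormal_commutes E ⟨x, hx⟩
    rw [hτ (γ.restrictNormal E)] at h1
    exact h1.symm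

omit [Algebra ℚ_[p] K] [FiniteDimensional ℚ_[p] K] in
theorem fixes_mul_iff (h : Fixes E γ) : Fixes E (γ * δ) ↔ Fixes E δ := by
  simp only [fixes_iff_mem] at *
  exact Subgroup.mul_mem_cancel_left _ h

omit [Algebra ℚ_[p] K] [FiniteDimensional ℚ_[p] K] in
theorem fixes_mul_iff_right (h : Fixes E γ) : Fixes E (δ * γ) ↔ Fixes E δ := by
  simp only [fixes_iff_mem] at *
  exact Subgroup.mul_mem_cancel_right _ h

omit [Algebra ℚ_[p] K] [FiniteDimensional ℚ_[p] K] in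
theorem fixes_inv_iff : Fixes E γ⁻¹ ↔ Fixes E γ := by
  simp only [fixes_iff_mem]
  exact inv_mem_iff

omit [Algebra ℚ_[p] K] [FiniteDimensional ℚ_[p] K] in
theorem Fixes.zpow (h : Fixes E f) (k : ℤ) : Fixes E (f ^ k) := by
  rw [fixes_iff_mem] at *
  exact zpow_mem h k

/-- E is Galois over K, so if inertia fixed it, it would be unramified. All uses of the ramification
of E go through this element. -/
theorem exists_inertia_not_fixes (hE : Module.finrank K E = 2) (hram : ¬ IsUnramified p E) :
    ∃ ι ∈ absInertia p K, ¬ Fixes E ι := by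
  have := charZero_of_padic p K
  have : IsGalois K (AlgebraicClosure K) := {}
  have := isGalois_of_finrank_eq_two hE
  have hfin : FiniteDimensional K E := Module.finite_of_finrank_eq_succ hE
  by_contra! h
  exact hram ⟨hfin, formallyUnramified_of_inertia_apply (GeomInt p K) (ringOfIntegers p K) E h⟩

/-- A Frobenius element that moves E is corrected by an inertia element that also moves E; the
product is again Frobenius and fixes E since Gal(E/K) has order two. -/
theorem exists_isFrobenius_fixes (hE : Module.finrank K E = 2) (hram : ¬ IsUnramified p E) :
    ∃ f, IsFrobenius p f ∧ Fixes E f := by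
  have := charZero_of_padic p K
  have : IsGalois K (AlgebraicClosure K) := {}
  obtain ⟨f, hf⟩ := exists_isFrob (K := K) (Ω := AlgebraicClosure K) (GeomInt p K)
    (ringOfIntegers p K)
  by_cases hfE : Fixes E f
  · exact ⟨f, (isFrobenius_iff p f).2 hf, hfE⟩
  · obtain ⟨ι, hι, hιE⟩ := exists_inertia_not_fixes hE hram
    exact ⟨f * ι, (isFrobenius_iff p _).2 (hf.mul_inertia hι), fixes_mul_of_not_fixes hE hfE hιE⟩

theorem exists_isWeil_not_fixes (hE : Module.finrank K E = 2) (hram : ¬ IsUnramified p E)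
    (hfE : Fixes E f) (k : ℤ) : ∃ γ, IsWeil p f γ k ∧ ¬ Fixes E γ := by
  obtain ⟨ι, hι, hιE⟩ := exists_inertia_not_fixes hE hram
  exact ⟨f ^ k * ι, ⟨ι, hι, rfl⟩, by rwa [fixes_mul_iff (hfE.zpow k)]⟩

/-- E_s contains E and the field K(ζ) of degree s; a Weil element fixing both fixes E and has degree
divisible by s. -/
theorem IsFrobenius.mem_extE_iff (hf : IsFrobenius p f) [FiniteDimensional K E] {s : ℕ}
    (hs : s ≠ 0) {x : AlgebraicClosure K} : x ∈ extE p E s ↔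
      ∀ γ k, IsWeil p f γ k → Fixes E γ → (s : ℤ) ∣ k → γ x = x := by
  constructor
  · intro hx γ k h hγ hk
    have hle : extE p E s ≤ fixedBy γ := sup_le (fun y hy => mem_fixedBy.2 (hγ y hy))
      fun y hy => mem_fixedBy.2 (hf.isWeil_apply_of_mem_unramifiedExt h hk hy)
    exact mem_fixedBy.1 (hle hx)
  · intro h
    obtain ⟨M, hM, hMs, hfin, hMf⟩ := exists_isUnramified_finrank (p := p) (K := K) hs
    have hMle : M ≤ unramifiedExt p K s := le_sSup ⟨hM, hMs⟩
    have hle : E ⊔ M ≤ extE p E s := sup_le_sup_left hMle E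
    have hfin : FiniteDimensional K (E ⊔ M : IntermediateField K (AlgebraicClosure K)) :=
      IntermediateField.finiteDimensional_sup _ _
    refine hle (hf.mem_of_isWeil_fixed (E ⊔ M) (E ⊔ M) fun γ k hγ hy => h γ k hγ ?_ ?_)
    · exact fun y hyE => hy y ⟨(le_sup_left : E ≤ E ⊔ M) hyE, (le_sup_left : E ≤ E ⊔ M) hyE⟩
    · refine hMf f hf k fun x hx => ?_
      obtain ⟨ι, hι, rfl⟩ := hγ
      have := hy x ⟨(le_sup_right : M ≤ E ⊔ M) hx, (le_sup_right : M ≤ E ⊔ M) hx⟩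
      rwa [AlgEquiv.mul_apply, inertia_apply_of_isUnramified hM hι hx] at this

/-- Conjugation by γ preserves degrees, so the Weil elements that define K_s are permuted. -/
theorem IsFrobenius.isWeil_apply_mem_unramifiedExt (hf : IsFrobenius p f) {s : ℕ} (hs : s ≠ 0)
    (h : IsWeil p f γ k) {x : AlgebraicClosure K} (hx : x ∈ unramifiedExt p K s) :
    γ x ∈ unramifiedExt p K s := by
  rw [hf.mem_unramifiedExt_iff hs] at hx ⊢
  intro δ l hδ hl
  have h1 := hx (γ⁻¹ * δ * γ) (-k + l + k) ((h.inv.mul hδ).mul h) (by simpa using hl)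
  have h2 := congrArg γ h1
  rwa [AlgEquiv.mul_apply, AlgEquiv.mul_apply,
    show γ (γ⁻¹ (δ (γ x))) = δ (γ x) from γ.apply_symm_apply _] at h2

/-- `L_r` is the subfield of `E_{2 r}` fixed by any Weil element that is nontrivial on `E` and
acts on `K_{2 r}` as the `r`-th power of Frobenius. -/
theorem IsFrobenius.mem_fieldL_iff (hf : IsFrobenius p f) (hfE : Fixes E f)
    (hE : Module.finrank K E = 2) (hram : ¬ IsUnramified p E) {r : ℕ} (hr : r ≠ 0)
    (hγ : IsWeil p f γ k) (hγE : ¬ Fixes E γ) (hk : ((2 * r : ℕ) : ℤ) ∣ k - r)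
    {x : AlgebraicClosure K} :
    x ∈ fieldL p E r ↔ x ∈ extE p E (2 * r) ∧ γ x = x := by
  have := charZero_of_padic p K
  have hfin : FiniteDimensional K E := Module.finite_of_finrank_eq_succ hE
  have hs : 2 * r ≠ 0 := by omega
  -- Every generator tf'^r of the group defining L agrees with γ on E_s: both are nontrivial on E,
  -- and both act on K_s as the r-th power of Frobenius, because k ≡ r mod 2r.
  have key : ∀ t f' : AlgebraicClosure K ≃ₐ[K] AlgebraicClosure K,
      (∀ x ∈ unramifiedExt p K (2 * r), t x = x) → ¬ Fixes E t → IsFrobenius p f' → Fixes E f' →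
      ∀ y ∈ extE p E (2 * r), (t * f' ^ r) y = γ y := by
    intro t f' ht htE hf' hf'E y hy
    have hle : extE p E (2 * r) ≤ fixedBy (γ⁻¹ * (t * f' ^ r)) := by
      refine sup_le (fun z hz => mem_fixedBy.2 ?_) (fun z hz => mem_fixedBy.2 ?_)
      · have h1 : Fixes E (γ⁻¹ * (t * f' ^ r)) :=
          fixes_mul_of_not_fixes hE (by rwa [fixes_inv_iff])
            (by rwa [fixes_mul_iff_right (by simpa using hf'E.zpow r)])
        exact h1 z hz
      · have h1 : IsWeil p f (f' ^ r) (r : ℤ) := by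
          rw [isWeil_iff, QuotientGroup.mk_pow, isWeil_iff.1 (hf.isWeil hf'), zpow_one,
            zpow_natCast]
        rw [AlgEquiv.mul_apply, AlgEquiv.mul_apply,
          ht _ (hf.isWeil_apply_mem_unramifiedExt hs h1 hz), ← AlgEquiv.mul_apply]
        refine hf.isWeil_apply_of_mem_unramifiedExt (hγ.inv.mul h1) ?_ hz
        have h2 : -k + (r : ℤ) = -(k - r) := by ring
        rwa [h2, dvd_neg]
    have h2 := congrArg γ (mem_fixedBy.1 (hle hy))
    rwa [AlgEquiv.mul_apply, show γ (γ⁻¹ ((t * f' ^ r) y)) = (t * f' ^ r) y from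
      γ.apply_symm_apply _] at h2
  -- An element that fixes K_s but not E_s = EK_s must move E.
  have hnot : ∀ t : AlgebraicClosure K ≃ₐ[K] AlgebraicClosure K,
      (∀ x ∈ unramifiedExt p K (2 * r), t x = x) → (∃ x ∈ extE p E (2 * r), t x ≠ x) →
      ¬ Fixes E t := by
    rintro t ht ⟨x, hx, hne⟩ htE
    have hle : extE p E (2 * r) ≤ fixedBy t := sup_le (fun z hz => mem_fixedBy.2 (htE z hz))
      fun z hz => mem_fixedBy.2 (ht z hz)
    exact hne (mem_fixedBy.1 (hle hx))
  rw [fieldL, IntermediateField.mem_inf]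
  refine and_congr_right fun hx => ?_
  rw [IntermediateField.mem_fixedField_iff]
  constructor
  · intro h
    -- An inertia element that moves E serves as a lift of τ_s, which shows that the set of
    -- generators is nonempty.
    obtain ⟨ι, hι, hιE⟩ := exists_inertia_not_fixes hE hram
    have hιK : ∀ x ∈ unramifiedExt p K (2 * r), ι x = x := fun x hx =>
      hf.isWeil_apply_of_mem_unramifiedExt (isWeil_of_mem hι) (dvd_zero _) hx
    rw [← key ι f hιK hιE hf hfE x hx]
    refine h _ (Subgroup.subset_closure ⟨ι, f, hιK, ?_, hf, hfE, rfl⟩)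
    by_contra! hcon
    exact hιE fun z hz => hcon z ((le_sup_left : E ≤ extE p E (2 * r)) hz)
  · intro h g hg
    have hle : Subgroup.closure {η | ∃ t f : AlgebraicClosure K ≃ₐ[K] AlgebraicClosure K,
        (∀ x ∈ unramifiedExt p K (2 * r), t x = x) ∧ (∃ x ∈ extE p E (2 * r), t x ≠ x) ∧
        IsFrobenius p f ∧ (∀ x ∈ E, f x = x) ∧ η = t * f ^ r} ≤
          MulAction.stabilizer (AlgebraicClosure K ≃ₐ[K] AlgebraicClosure K) x := by
      rw [Subgroup.closure_le]
      rintro _ ⟨t, f', ht, htE, hf', hf'E, rfl⟩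
      exact (key t f' ht (hnot t ht htE) hf' hf'E x hx).trans h
    exact hle hg

theorem IsFrobenius.isWeil_apply_mem_extE (hf : IsFrobenius p f) (hE : Module.finrank K E = 2)
    {s : ℕ} (hs : s ≠ 0) (hγ : IsWeil p f γ k) {x : AlgebraicClosure K} (hx : x ∈ extE p E s) :
    γ x ∈ extE p E s := by
  have := charZero_of_padic p K
  have hfin : FiniteDimensional K E := Module.finite_of_finrank_eq_succ hE
  have := isGalois_of_finrank_eq_two hE
  rw [hf.mem_extE_iff hs] at hx ⊢
  intro δ l hδ hδE hl
  have hconj : Fixes E (γ⁻¹ * δ * γ) := by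
    rw [fixes_iff_mem] at *
    have := (inferInstance : E.fixingSubgroup.Normal).conj_mem δ hδE γ⁻¹
    simpa using this
  have h1 := hx (γ⁻¹ * δ * γ) (-k + l + k) ((hγ.inv.mul hδ).mul hγ) hconj (by simpa using hl)
  have h2 := congrArg γ h1
  rwa [AlgEquiv.mul_apply, AlgEquiv.mul_apply,
    show γ (γ⁻¹ (δ (γ x))) = δ (γ x) from γ.apply_symm_apply _] at h2

end Ramified

/-! ### Descent -/

section Descent

theorem nonempty_iso_of_bijective {k : Type u} [CommRing k] {F G : GroupFunctor k} (η : F ⟶ G)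
    (h : ∀ R, Function.Bijective (η.app R).hom) : Nonempty (F ≅ G) :=
  ⟨NatIso.ofComponents (fun R => (MulEquiv.ofBijective (η.app R).hom (h R)).toGrpIso)
    fun f => η.naturality f⟩

variable {K : Type u} [Field K] (R : Type u) [CommRing R] [Algebra K R]
  (γ δ : AlgebraicClosure K ≃ₐ[K] AlgebraicClosure K)

/-- The action of the Galois group on `K̄ ⊗ R`. -/
def galTensor : AlgebraicClosure K ⊗[K] R →ₐ[K] AlgebraicClosure K ⊗[K] R :=
  Algebra.TensorProduct.map (γ : AlgebraicClosure K →ₐ[K] AlgebraicClosure K) (AlgHom.id K R)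

@[simp]
theorem galTensor_tmul (x : AlgebraicClosure K) (r : R) :
    galTensor R γ (x ⊗ₜ r) = γ x ⊗ₜ r := rfl

theorem galTensor_mul (z : AlgebraicClosure K ⊗[K] R) :
    galTensor R (γ * δ) z = galTensor R γ (galTensor R δ z) := by
  induction z with
  | zero => simp
  | add y z hy hz => simp only [map_add, hy, hz]
  | tmul x r => simp

@[simp]
theorem galTensor_one (z : AlgebraicClosure K ⊗[K] R) : galTensor R 1 z = z := by
  induction z with
  | zero => simp
  | add y z hy hz => simp only [map_add, hy, hz]
  | tmul x r => simp

theorem galTensor_comp_includeLeft :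
    (galTensor R γ).comp Algebra.TensorProduct.includeLeft =
      (Algebra.TensorProduct.includeLeft : AlgebraicClosure K →ₐ[K] _).comp
        (γ : AlgebraicClosure K →ₐ[K] AlgebraicClosure K) := by
  ext x
  simp

theorem galTensor_comp_includeRight :
    (galTensor R γ).comp Algebra.TensorProduct.includeRight =
      Algebra.TensorProduct.includeRight := by
  ext x
  simp

variable {R} {S : Type u} [CommRing S] [Algebra K S]

theorem galTensor_map (h : R →ₐ[K] S) (z : AlgebraicClosure K ⊗[K] R) :
    Algebra.TensorProduct.map (AlgHom.id K _) h (galTensor R γ z) =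
      galTensor S γ (Algebra.TensorProduct.map (AlgHom.id K _) h z) := by
  induction z with
  | zero => simp
  | add y z hy hz => simp only [map_add, hy, hz]
  | tmul x r => simp

theorem includeRight_injective_closure :
    Function.Injective (Algebra.TensorProduct.includeRight :
      R →ₐ[K] AlgebraicClosure K ⊗[K] R) :=
  Algebra.TensorProduct.includeRight_injective (algebraMap K (AlgebraicClosure K)).injective

theorem basis_repr_galTensor {ι : Type*} (b : Module.Basis ι K R)
    (z : AlgebraicClosure K ⊗[K] R) (i : ι) :
    (Algebra.TensorProduct.basis (AlgebraicClosure K) b).repr (galTensor R γ z) i =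
      γ ((Algebra.TensorProduct.basis (AlgebraicClosure K) b).repr z i) := by
  induction z with
  | zero => simp
  | add y z hy hz => simp [hy, hz]
  | tmul x r => simp [Algebra.TensorProduct.basis_repr_tmul]

/-- The elements of `K̄ ⊗ R` fixed by a set of automorphisms with fixed field `F` come from
`F ⊗ R`. -/
theorem mem_range_of_galTensor_fixed (s : Set (AlgebraicClosure K ≃ₐ[K] AlgebraicClosure K))
    {F : Type*} [Field F] [Algebra K F] (j : F →ₐ[K] AlgebraicClosure K)
    (hF : ∀ x, (∀ γ ∈ s, γ x = x) → x ∈ j.range)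
    {z : AlgebraicClosure K ⊗[K] R} (hz : ∀ γ ∈ s, galTensor R γ z = z) :
    z ∈ (Algebra.TensorProduct.map j (AlgHom.id K R)).range := by
  -- In a K-basis of R the Galois group acts on coordinates, so the coordinates of z are fixed and
  -- lie in the image of F.
  let b := Module.Free.chooseBasis K R
  let B := Algebra.TensorProduct.basis (AlgebraicClosure K) b
  rw [← B.linearCombination_repr z, Finsupp.linearCombination_apply]
  refine Subalgebra.sum_mem _ fun i _ => ?_
  obtain ⟨x, hx⟩ := hF (B.repr z i) fun γ hγ => by
    rw [← basis_repr_galTensor, hz γ hγ]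
  refine ⟨x ⊗ₜ b i, ?_⟩
  rw [← hx]
  simp [B, TensorProduct.smul_tmul']

theorem mem_range_includeRight_of_galTensor_fixed
    (s : Set (AlgebraicClosure K ≃ₐ[K] AlgebraicClosure K))
    (hs : ∀ x, (∀ γ ∈ s, γ x = x) → x ∈ (⊥ : IntermediateField K (AlgebraicClosure K)))
    {z : AlgebraicClosure K ⊗[K] R} (hz : ∀ γ ∈ s, galTensor R γ z = z) :
    z ∈ (Algebra.TensorProduct.includeRight : R →ₐ[K] AlgebraicClosure K ⊗[K] R).range := by
  obtain ⟨y, rfl⟩ := mem_range_of_galTensor_fixed s (Algebra.ofId K (AlgebraicClosure K))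
    (fun x hx => IntermediateField.mem_bot.1 (hs x hx)) hz
  clear hz
  induction y with
  | zero => exact ⟨0, by simp⟩
  | add y z hy hz => rw [map_add]; exact add_mem hy hz
  | tmul x r =>
    refine ⟨x • r, ?_⟩
    simp [Algebra.ofId_apply, Algebra.algebraMap_eq_smul_one, TensorProduct.smul_tmul]

/-- Points of a corepresentable functor over `K̄ ⊗ R` that are fixed by a set of automorphisms with
fixed field `K` come from points over `R`. -/
theorem exists_map_includeRight_eq {F : GroupFunctor K}
    (hF : (F ⋙ forget GrpCat.{u}).IsCorepresentable)
    (s : Set (AlgebraicClosure K ≃ₐ[K] AlgebraicClosure K))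
    (hs : ∀ x, (∀ γ ∈ s, γ x = x) → x ∈ (⊥ : IntermediateField K (AlgebraicClosure K)))
    (R : CommAlgCat.{u} K) (y : F.obj (CommAlgCat.of K (AlgebraicClosure K ⊗[K] R)))
    (hy : ∀ γ ∈ s, (F.map (CommAlgCat.ofHom (galTensor R γ))).hom y = y) :
    ∃ x : F.obj R, (F.map (CommAlgCat.ofHom Algebra.TensorProduct.includeRight)).hom x = y := by
  obtain ⟨A, ⟨hA⟩⟩ := hF
  -- As a homomorphism A → K̄ ⊗ R, the point y is fixed exactly if its values are fixed. Then the
  -- values lie in R, and the homomorphism factors through R.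
  let a := hA.homEquiv.symm y
  have hay : hA.homEquiv a = y := hA.homEquiv.apply_symm_apply y
  have ha : ∀ γ ∈ s, ∀ x, galTensor R γ (a.hom x) = a.hom x := by
    intro γ hγ x
    have h1 : a ≫ CommAlgCat.ofHom (galTensor R γ) = a := by
      apply hA.homEquiv.injective
      rw [hA.homEquiv_comp, hay]
      exact hy γ hγ
    exact congrArg (fun f => f.hom x) h1
  have hr : ∀ x, a.hom x ∈ (Algebra.TensorProduct.includeRight :
      R →ₐ[K] AlgebraicClosure K ⊗[K] R).range := fun x =>
    mem_range_includeRight_of_galTensor_fixed s hs fun γ hγ => ha γ hγ x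
  let e := AlgEquiv.ofInjective (Algebra.TensorProduct.includeRight :
      R →ₐ[K] AlgebraicClosure K ⊗[K] R) includeRight_injective_closure
  let a' : A →ₐ[K] R := (e.symm : _ →ₐ[K] R).comp (a.hom.codRestrict _ hr)
  refine ⟨hA.homEquiv (CommAlgCat.ofHom a'), ?_⟩
  have h2 : CommAlgCat.ofHom a' ≫ CommAlgCat.ofHom Algebra.TensorProduct.includeRight = a := by
    ext x
    have := congrArg Subtype.val (e.apply_symm_apply ⟨a.hom x, hr x⟩)
    exact this
  rw [← hay]
  refine Eq.trans ?_ (congrArg hA.homEquiv h2)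
  rw [hA.homEquiv_comp]
  rfl

/-- Points are homomorphisms from the representing algebra, and R → K̄ ⊗ R is injective. -/
theorem map_includeRight_injective {F : GroupFunctor K}
    (hF : (F ⋙ forget GrpCat.{u}).IsCorepresentable) (R : CommAlgCat.{u} K) :
    Function.Injective (F.map (CommAlgCat.ofHom (Algebra.TensorProduct.includeRight :
      R →ₐ[K] AlgebraicClosure K ⊗[K] R))).hom := by
  obtain ⟨A, ⟨hA⟩⟩ := hF
  intro x y hxy
  obtain ⟨a, rfl⟩ := hA.homEquiv.surjective x
  obtain ⟨b, rfl⟩ := hA.homEquiv.surjective y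
  have h1 : a ≫ CommAlgCat.ofHom (Algebra.TensorProduct.includeRight :
      R →ₐ[K] AlgebraicClosure K ⊗[K] R) = b ≫ CommAlgCat.ofHom
        Algebra.TensorProduct.includeRight := by
    apply hA.homEquiv.injective
    rw [hA.homEquiv_comp, hA.homEquiv_comp]
    exact hxy
  congr 1
  ext x
  exact includeRight_injective_closure (congrArg (fun f => f.hom x) h1)

end Descent

/-! ### Splitting the unitary group -/

section Split

variable {K : Type u} [Field K] [CharZero K] {E : Type u} [Field E] [Algebra K E]
  {τ : E ≃ₐ[K] E} {R S : Type u} [CommRing R] [Algebra K R] [CommRing S] [Algebra K S]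
  (j : E →ₐ[K] AlgebraicClosure K) (φ : AlgebraicClosure K →ₐ[K] R)

/-- The homomorphism `E ⊗ R → R` given by a homomorphism `K̄ → R`. -/
def splitMap (j : E →ₐ[K] AlgebraicClosure K) (φ : AlgebraicClosure K →ₐ[K] R) :
    E ⊗[K] R →ₐ[K] R :=
  Algebra.TensorProduct.productMap (φ.comp j) (AlgHom.id K R)

@[simp]
theorem splitMap_tmul (x : E) (r : R) : splitMap j φ (x ⊗ₜ r) = φ (j x) * r := by
  simp [splitMap]

theorem splitMap_coeffMap (h : R →ₐ[K] S) (x : E ⊗[K] R) :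
    splitMap j (h.comp φ) (coeffMap K E h x) = h (splitMap j φ x) := by
  induction x with
  | zero => simp
  | add y z hy hz => simp only [map_add, hy, hz]
  | tmul x r => simp [coeffMap]

@[simp]
theorem conj_tmul (x : E) (r : R) : conj K τ R (x ⊗ₜ r) = τ x ⊗ₜ r := rfl

theorem conj_conj (hE : Module.finrank K E = 2) (hτ : τ ≠ 1) (x : E ⊗[K] R) :
    conj K τ R (conj K τ R x) = x := by
  induction x with
  | zero => simp
  | add y z hy hz => simp only [map_add, hy, hz]
  | tmul x r => simp [apply_apply_of_finrank_eq_two hE hτ]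

theorem splitMap_comp_of_fixes {γ : AlgebraicClosure K ≃ₐ[K] AlgebraicClosure K}
    (h : ∀ x, γ (j x) = j x) (x : E ⊗[K] R) :
    splitMap j (φ.comp (γ : AlgebraicClosure K →ₐ[K] AlgebraicClosure K)) x = splitMap j φ x := by
  induction x with
  | zero => simp
  | add y z hy hz => simp only [map_add, hy, hz]
  | tmul x r => simp [h]

theorem splitMap_comp_of_not_fixes {γ : AlgebraicClosure K ≃ₐ[K] AlgebraicClosure K}
    (h : ∀ x, γ (j x) = j (τ x)) (x : E ⊗[K] R) :
    splitMap j (φ.comp (γ : AlgebraicClosure K →ₐ[K] AlgebraicClosure K)) x =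
      splitMap j φ (conj K τ R x) := by
  induction x with
  | zero => simp
  | add y z hy hz => simp only [map_add, hy, hz]
  | tmul x r => simp [h]

/-- An element of `K̄` that is not in `K` and has its square in `K` gives a basis of a quadratic
extension. -/
theorem exists_eq_add_mul_of_apply_eq_neg (hE : Module.finrank K E = 2) (hτ : τ ≠ 1) {e : E}
    (he0 : e ≠ 0) (he : τ e = -e) (x : E) :
    ∃ a b : K, x = algebraMap K E a + algebraMap K E b * e := by
  have := charZero_of_injective_algebraMap (algebraMap K E).injective
  have hG := isGalois_of_finrank_eq_two hE
  have hfin : FiniteDimensional K E := Module.finite_of_finrank_eq_succ hE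
  have hmem : ∀ y : E, τ y = y → ∃ a : K, algebraMap K E a = y := by
    intro y hy
    refine (IsGalois.mem_range_algebraMap_iff_fixed y).2 fun σ => ?_
    rcases eq_one_or_eq_of_finrank_eq_two hE hτ σ with rfl | rfl
    · rfl
    · exact hy
  have h2 : (2 : E) ≠ 0 := two_ne_zero
  -- The coefficients (x + τx)/2 and (x - τx)/(2e) are fixed by τ, hence lie in K.
  obtain ⟨a, ha⟩ := hmem ((x + τ x) / 2) (by
    simp only [map_div₀, map_add, map_ofNat, apply_apply_of_finrank_eq_two hE hτ, add_comm])
  obtain ⟨b, hb⟩ := hmem ((x - τ x) / (2 * e)) (by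
    simp only [map_div₀, map_sub, map_mul, map_ofNat, apply_apply_of_finrank_eq_two hE hτ, he]
    field_simp
    ring)
  refine ⟨a, b, ?_⟩
  rw [ha, hb]
  field_simp
  ring

theorem exists_eq_tmul_add_tmul (hE : Module.finrank K E = 2) (hτ : τ ≠ 1) {e : E}
    (he0 : e ≠ 0) (he : τ e = -e) (x : E ⊗[K] R) :
    ∃ a b : R, x = 1 ⊗ₜ a + e ⊗ₜ b := by
  induction x with
  | zero => exact ⟨0, 0, by simp⟩
  | add y z hy hz =>
    obtain ⟨a, b, rfl⟩ := hy
    obtain ⟨a', b', rfl⟩ := hz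
    exact ⟨a + a', b + b', by simp only [TensorProduct.tmul_add]; abel⟩
  | tmul x r =>
    obtain ⟨a, b, rfl⟩ := exists_eq_add_mul_of_apply_eq_neg hE hτ he0 he x
    refine ⟨a • r, b • r, ?_⟩
    rw [TensorProduct.add_tmul, ← Algebra.smul_def, Algebra.algebraMap_eq_smul_one,
      TensorProduct.smul_tmul, TensorProduct.smul_tmul]

/-- Over a K̄-algebra R the maps `splitMap` and `splitMap` after `conj` identify E ⊗ R with R × R.
On a + be they take the values a ± b·e, and both 2 and e are invertible in R. -/
theorem eq_of_splitMap_eq (hE : Module.finrank K E = 2) (hτ : τ ≠ 1) {x y : E ⊗[K] R}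
    (h1 : splitMap j φ x = splitMap j φ y)
    (h2 : splitMap j φ (conj K τ R x) = splitMap j φ (conj K τ R y)) : x = y := by
  obtain ⟨e, he0, he⟩ := exists_apply_eq_neg hE hτ
  have hu : IsUnit (2 : R) := by
    rw [← map_ofNat (algebraMap K R) 2]
    exact (IsUnit.mk0 (2 : K) two_ne_zero).map (algebraMap K R)
  have hue : IsUnit (φ (j e)) := (IsUnit.mk0 (j e) (by simpa using he0)).map φ
  obtain ⟨a, b, rfl⟩ := exists_eq_tmul_add_tmul hE hτ he0 he x
  obtain ⟨a', b', rfl⟩ := exists_eq_tmul_add_tmul hE hτ he0 he y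
  simp only [map_add, splitMap_tmul, conj_tmul, he, map_one, one_mul, map_neg] at h1 h2
  have ha : a = a' := hu.mul_left_cancel (by linear_combination h1 + h2)
  subst ha
  have hb : b = b' := hue.mul_left_cancel (by linear_combination h1)
  rw [hb]

/-- The preimage of (u, v) is the half-sum plus e times the half-difference divided by e. -/
theorem exists_splitMap_eq (hE : Module.finrank K E = 2) (hτ : τ ≠ 1) (u v : R) :
    ∃ x : E ⊗[K] R, splitMap j φ x = u ∧ splitMap j φ (conj K τ R x) = v := by
  obtain ⟨e, he0, he⟩ := exists_apply_eq_neg hE hτ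
  have hu : algebraMap K R 2⁻¹ * 2 = 1 := by
    rw [← map_ofNat (algebraMap K R) 2, ← map_mul]
    simp
  have hue : φ (j e) * φ ((j e)⁻¹) = 1 := by
    rw [← map_mul, mul_inv_cancel₀ (by simpa using he0), map_one]
  refine ⟨1 ⊗ₜ (algebraMap K R 2⁻¹ * (u + v)) +
    e ⊗ₜ (φ ((j e)⁻¹) * (algebraMap K R 2⁻¹ * (u - v))), ?_, ?_⟩ <;>
  simp only [map_add, splitMap_tmul, conj_tmul, he, map_one, one_mul, map_neg]
  · linear_combination (algebraMap K R 2⁻¹ * (u - v)) * hue + u * hu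
  · linear_combination -(algebraMap K R 2⁻¹ * (u - v)) * hue + v * hu

end Split

/-! ### The unitary group and the diagonal torus over K̄-algebras -/

section Diagonal

variable {K : Type u} [Field K] [CharZero K] {E : Type u} [Field E] [Algebra K E]
  {τ : E ≃ₐ[K] E} {R S : Type u} [CommRing R] [Algebra K R] [CommRing S] [Algebra K S]
  (j : E →ₐ[K] AlgebraicClosure K) (φ : AlgebraicClosure K →ₐ[K] R) {m d : ℕ} {c : E}

/-- The functor of points of the group `U(V)`, as a group of matrices. -/
abbrev UPoints (τ : E ≃ₐ[K] E) (m d : ℕ) (c : E) (R : Type u) [CommRing R] [Algebra K R] :=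
  unitaryPoints K τ (gram m d c) R

/-- Over `K̄`-algebras the unitary group embeds into (in fact equals) the general linear group. -/
def splitGL (τ : E ≃ₐ[K] E) (m d : ℕ) (c : E) (j : E →ₐ[K] AlgebraicClosure K)
    (φ : AlgebraicClosure K →ₐ[K] R) :
    UPoints τ m d c R →* GL (Idx m d) R :=
  (Matrix.GeneralLinearGroup.map (splitMap j φ : E ⊗[K] R →+* R)).comp (Subgroup.subtype _)

theorem splitGL_apply (g : UPoints τ m d c R) (a b : Idx m d) :
    (splitGL τ m d c j φ g : Matrix (Idx m d) (Idx m d) R) a b =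
      splitMap j φ ((g.1 : Matrix (Idx m d) (Idx m d) (E ⊗[K] R)) a b) := rfl

theorem gram_eq_zero {a b : Idx m d} (h : b ≠ negIdx m d a) : gram m d c a b = 0 := if_neg h

theorem gram_ne_zero (hc : c ≠ 0) (a : Idx m d) : gram m d c a (negIdx m d a) ≠ 0 := by
  rw [gram, if_pos rfl]
  rcases a with a | a
  · exact one_ne_zero
  · exact hc

@[simp]
theorem negIdx_negIdx (a : Idx m d) : negIdx m d (negIdx m d a) = a := by
  rcases a with a | a <;> simp [negIdx]

/-- The image of the Gram matrix. -/
theorem isUnit_splitMap_gram (hc : c ≠ 0) (a : Idx m d) :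
    IsUnit (φ (j (gram m d c a (negIdx m d a)))) :=
  (IsUnit.mk0 _ (by simpa using gram_ne_zero hc a)).map φ

/-- Each row of the Gram matrix has a single nonzero entry, at the opposite index, so the double sum
in the unitary relation collapses. -/
theorem mem_unitaryPoints_iff (g : GL (Idx m d) (E ⊗[K] R)) : g ∈ unitaryPoints K τ (gram m d c) R ↔
    ∀ a b, ∑ x, (g : Matrix (Idx m d) (Idx m d) (E ⊗[K] R)) x a * (gram m d c x (negIdx m d x) ⊗ₜ 1 *
      conj K τ R ((g : Matrix (Idx m d) (Idx m d) (E ⊗[K] R)) (negIdx m d x) b)) = gram m d c a b ⊗ₜ 1 := by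
  change _ = _ ↔ _
  rw [← Matrix.ext_iff]
  refine forall₂_congr fun a b => ?_
  have h : ∀ x, ((gram m d c).map (algebraMap E (E ⊗[K] R)) *
      (g : Matrix (Idx m d) (Idx m d) (E ⊗[K] R)).map (conj K τ R)) x b = gram m d c x (negIdx m d x) ⊗ₜ 1 *
      conj K τ R ((g : Matrix (Idx m d) (Idx m d) (E ⊗[K] R)) (negIdx m d x) b) := by
    intro x
    rw [Matrix.mul_apply, Finset.sum_eq_single (negIdx m d x)]
    · rfl
    · intro y _ hy
      simp [gram_eq_zero hy]
    · simp
  rw [Matrix.mul_assoc, Matrix.mul_apply]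
  simp only [h]
  rfl

theorem splitGL_relation (g : UPoints τ m d c R) (a b : Idx m d) :
    ∑ x, (splitGL τ m d c j φ g : Matrix (Idx m d) (Idx m d) R) x a * (φ (j (gram m d c x (negIdx m d x))) *
      splitMap j φ (conj K τ R ((g.1 : Matrix (Idx m d) (Idx m d) (E ⊗[K] R)) (negIdx m d x) b))) =
      φ (j (gram m d c a b)) := by
  have h := congrArg (splitMap j φ) ((mem_unitaryPoints_iff g.1).1 g.2 a b)
  simpa [splitGL_apply] using h

/-- Under E ⊗ R ≅ R × R the unitary relation expresses the second component of g by the inverse of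
the first, so a trivial first component forces a trivial second one. -/
theorem splitGL_injective (hE : Module.finrank K E = 2) (hτ : τ ≠ 1) (hc : c ≠ 0) :
    Function.Injective (splitGL τ m d c j φ) := by
  rw [injective_iff_map_eq_one]
  intro g hg
  have h1 : ∀ a b, (splitGL τ m d c j φ g : Matrix (Idx m d) (Idx m d) R) a b = (1 : Matrix (Idx m d) (Idx m d) R) a b := by
    intro a b
    rw [hg]
    rfl
  have h2 : ∀ a b, splitMap j φ (conj K τ R ((g.1 : Matrix (Idx m d) (Idx m d) (E ⊗[K] R)) a b)) =
      (1 : Matrix (Idx m d) (Idx m d) R) a b := by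
    intro a b
    have h := splitGL_relation j φ g (negIdx m d a) b
    rw [Finset.sum_eq_single (negIdx m d a)] at h
    · rw [h1, Matrix.one_apply_eq, one_mul] at h
      by_cases hab : b = a
      · subst hab
        have hu := isUnit_splitMap_gram j φ hc (negIdx m d b)
        rw [negIdx_negIdx] at h hu
        rw [Matrix.one_apply_eq]
        exact hu.mul_left_cancel (by rw [h, mul_one])
      · rw [gram_eq_zero (a := negIdx m d a) (b := b) (by simpa using hab), map_zero,
          map_zero] at h
        rw [Matrix.one_apply_ne (Ne.symm hab)]
        have hu := isUnit_splitMap_gram j φ hc (negIdx m d a)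
        rw [negIdx_negIdx] at h hu
        exact hu.mul_left_cancel (by rw [h, mul_zero])
    · intro x _ hx
      rw [h1, Matrix.one_apply_ne hx, zero_mul]
    · simp
  ext a b
  refine eq_of_splitMap_eq j φ hE hτ ?_ ?_
  · refine (h1 a b).trans ?_
    by_cases hab : a = b
    · subst hab
      simp
    · simp [Matrix.one_apply_ne hab]
  · refine (h2 a b).trans ?_
    by_cases hab : a = b
    · subst hab
      simp
    · simp [Matrix.one_apply_ne hab]

/-- The `R`-points of the diagonal torus. -/
abbrev DPoints (τ : E ≃ₐ[K] E) (m d : ℕ) (c : E) (R : Type u) [CommRing R] [Algebra K R] :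
    Subgroup (UPoints τ m d c R) :=
  (diagonalTorus K τ (gram m d c)).carrier (CommAlgCat.of K R)

theorem mem_diagonalTorus_iff_isDiag (g : UPoints τ m d c R) :
    g ∈ DPoints τ m d c R ↔ ∀ a b, a ≠ b → (g.1 : Matrix (Idx m d) (Idx m d) (E ⊗[K] R)) a b = 0 := by
  constructor
  · rintro ⟨t, ht⟩ a b hab
    have : (g.1 : Matrix (Idx m d) (Idx m d) (E ⊗[K] R)) a b = Matrix.diagonal (t : Idx m d → E ⊗[K] R) a b :=
      congrArg (fun M : GL (Idx m d) (E ⊗[K] R) => (M : Matrix (Idx m d) (Idx m d) (E ⊗[K] R)) a b) ht.symm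
    rw [this, Matrix.diagonal_apply_ne _ hab]
  · intro h
    have h' : ∀ M : GL (Idx m d) (E ⊗[K] R),
        (∀ a b, a ≠ b → (M : Matrix (Idx m d) (Idx m d) (E ⊗[K] R)) a b = 0) →
        M ∈ (Units.map (Matrix.diagonalRingHom (Idx m d) (E ⊗[K] R) : (Idx m d → E ⊗[K] R) →* _)).range
        := by
      intro M hM
      have hd : (M : Matrix (Idx m d) (Idx m d) (E ⊗[K] R)) = Matrix.diagonal (Matrix.diag M.1) := by
        ext a b
        by_cases hab : a = b
        · subst hab
          simp
        · rw [hM a b hab, Matrix.diagonal_apply_ne _ hab]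
      have hu : IsUnit (Matrix.diag M.1) := by
        have := M.isUnit
        rw [hd, Matrix.isUnit_diagonal] at this
        exact this
      obtain ⟨t, ht⟩ := hu
      refine ⟨t, Units.ext ?_⟩
      rw [hd, ← ht]
      rfl
    exact h' g.1 h

/-- The first component suffices: if it is diagonal, its entries are units and the unitary relation
makes the second component diagonal as well. -/
theorem mem_diagonalTorus_iff (hE : Module.finrank K E = 2) (hτ : τ ≠ 1) (hc : c ≠ 0)
    (g : UPoints τ m d c R) : g ∈ DPoints τ m d c R ↔
      ∀ a b, a ≠ b → (splitGL τ m d c j φ g : Matrix (Idx m d) (Idx m d) R) a b = 0 := by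
  rw [mem_diagonalTorus_iff_isDiag]
  constructor
  · intro h a b hab
    rw [splitGL_apply, h a b hab, map_zero]
  · intro h
    have hrel : ∀ a b, (splitGL τ m d c j φ g : Matrix (Idx m d) (Idx m d) R) a a *
        (φ (j (gram m d c a (negIdx m d a))) * splitMap j φ (conj K τ R
          ((g.1 : Matrix (Idx m d) (Idx m d) (E ⊗[K] R)) (negIdx m d a) b))) = φ (j (gram m d c a b)) := by
      intro a b
      rw [← splitGL_relation j φ g a b, Finset.sum_eq_single a]
      · intro x _ hx
        rw [h x a hx, zero_mul]
      · simp
    have h2 : ∀ a b, a ≠ b → splitMap j φ (conj K τ R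
        ((g.1 : Matrix (Idx m d) (Idx m d) (E ⊗[K] R)) a b)) = 0 := by
      intro a b hab
      have hu : IsUnit ((splitGL τ m d c j φ g : Matrix (Idx m d) (Idx m d) R) (negIdx m d a) (negIdx m d a)) := by
        have h3 := hrel (negIdx m d a) a
        have h4 := isUnit_splitMap_gram j φ hc (negIdx m d a)
        rw [negIdx_negIdx] at h3 h4
        rw [← h3] at h4
        exact isUnit_of_mul_isUnit_left h4
      have h3 := hrel (negIdx m d a) b
      have h4 := isUnit_splitMap_gram j φ hc (negIdx m d a)
      rw [gram_eq_zero (a := negIdx m d a) (b := b) (by simpa using hab.symm), map_zero,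
        map_zero] at h3
      rw [negIdx_negIdx] at h3 h4
      rw [hu.mul_right_eq_zero, h4.mul_right_eq_zero] at h3
      exact h3
    intro a b hab
    refine eq_of_splitMap_eq j φ hE hτ ?_ ?_
    · rw [map_zero]
      exact h a b hab
    · rw [map_zero, map_zero]
      exact h2 a b hab

/-- The unitary relation at (a, -a) has one term, and the Gram entry cancels. This is the source of
the rule χ_i ↦ -χ_{-i} for automorphisms nontrivial on E. -/
theorem splitGL_mul_conj {g : UPoints τ m d c R} (hc : c ≠ 0) (hg : g ∈ DPoints τ m d c R)
    (a : Idx m d) : (splitGL τ m d c j φ g : Matrix (Idx m d) (Idx m d) R) a a * splitMap j φ (conj K τ R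
      ((g.1 : Matrix (Idx m d) (Idx m d) (E ⊗[K] R)) (negIdx m d a) (negIdx m d a))) = 1 := by
  rw [mem_diagonalTorus_iff_isDiag] at hg
  have h := splitGL_relation j φ g a (negIdx m d a)
  rw [Finset.sum_eq_single a] at h
  · exact (isUnit_splitMap_gram j φ hc a).mul_left_cancel (by linear_combination h)
  · intro x _ hx
    rw [splitGL_apply, hg x a hx, map_zero, zero_mul]
  · simp

/-- The characters χ_a take arbitrary values independently: the a-th diagonal entry gets first
coordinate t_a and second coordinate the inverse of t_{-a}, which is what the unitary relation
demands. -/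
theorem exists_splitGL_eq_diagonal (hE : Module.finrank K E = 2) (hτ : τ ≠ 1)
    (t : Idx m d → Rˣ) : ∃ g ∈ DPoints τ m d c R,
      ∀ a, (splitGL τ m d c j φ g : Matrix (Idx m d) (Idx m d) R) a a = t a := by
  choose D hD1 hD2 using fun a : Idx m d =>
    exists_splitMap_eq j φ hE hτ (t a : R) ((t (negIdx m d a))⁻¹ : Rˣ)
  have hrel : ∀ a, D a * conj K τ R (D (negIdx m d a)) = 1 := by
    intro a
    refine eq_of_splitMap_eq j φ hE hτ ?_ ?_
    · rw [map_mul, hD1, hD2, negIdx_negIdx, map_one, Units.mul_inv]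
    · rw [map_mul, map_mul, conj_conj hE hτ, hD1, hD2, map_one, map_one, Units.inv_mul]
  let M : GL (Idx m d) (E ⊗[K] R) :=
    ⟨Matrix.diagonal D, Matrix.diagonal fun a => conj K τ R (D (negIdx m d a)), by
      simp only [Matrix.diagonal_mul_diagonal, hrel, Matrix.diagonal_one], by
      simp only [Matrix.diagonal_mul_diagonal, mul_comm (conj K τ R _), hrel,
        Matrix.diagonal_one]⟩
  have hM : M ∈ unitaryPoints K τ (gram m d c) R := by
    rw [mem_unitaryPoints_iff]
    intro a b
    change ∑ x, Matrix.diagonal D x a * (gram m d c x (negIdx m d x) ⊗ₜ 1 *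
      conj K τ R (Matrix.diagonal D (negIdx m d x) b)) = _
    rw [Finset.sum_eq_single a]
    · by_cases hb : b = negIdx m d a
      · subst hb
        rw [Matrix.diagonal_apply_eq, Matrix.diagonal_apply_eq, mul_left_comm, hrel, mul_one]
      · rw [Matrix.diagonal_apply_ne _ (Ne.symm hb), gram_eq_zero hb]
        simp
    · intro x _ hx
      rw [Matrix.diagonal_apply_ne _ hx, zero_mul]
    · simp
  refine ⟨⟨M, hM⟩, ?_, fun a => ?_⟩
  · rw [mem_diagonalTorus_iff_isDiag]
    intro a b hab
    exact Matrix.diagonal_apply_ne _ hab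
  · rw [splitGL_apply]
    change splitMap j φ (Matrix.diagonal D a a) = _
    rw [Matrix.diagonal_apply_eq, hD1]

end Diagonal

/-! ### Characters of split tori -/

section Monomial

/-- The monomial with exponents `v`. -/
def monomialHom {d : ℕ} (A : Type*) [CommMonoid A] (v : Fin d → ℤ) : (Fin d → Aˣ) →* Aˣ where
  toFun x := ∏ i, x i ^ v i
  map_one' := by simp
  map_mul' x y := by simp [mul_zpow, Finset.prod_mul_distrib]

theorem monomialHom_apply {d : ℕ} {A : Type*} [CommMonoid A] (v : Fin d → ℤ) (x : Fin d → Aˣ) :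
    monomialHom A v x = ∏ i, x i ^ v i := rfl

theorem monomialHom_add {d : ℕ} {A : Type*} [CommMonoid A] (v w : Fin d → ℤ) (x : Fin d → Aˣ) :
    monomialHom A (v + w) x = monomialHom A v x * monomialHom A w x := by
  simp [monomialHom_apply, zpow_add, Finset.prod_mul_distrib]

theorem monomialHom_zero {d : ℕ} {A : Type*} [CommMonoid A] (x : Fin d → Aˣ) :
    monomialHom A (0 : Fin d → ℤ) x = 1 := by
  simp [monomialHom_apply]

theorem prod_zpow_eq_zpow_sum {ι G : Type*} [CommGroup G] (s : Finset ι) (g : G) (n : ι → ℤ) :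
    ∏ i ∈ s, g ^ n i = g ^ ∑ i ∈ s, n i :=
  (map_sum (zmultiplesHom (Additive G) (Additive.ofMul g)) n s).symm

variable {k : Type u} [Field k] {d : ℕ}

/-- Setting one coordinate equal to 2 and the others to 1 recovers each exponent, since 2 has
infinite order in characteristic zero. -/
theorem monomialHom_val_injective [CharZero k] : Function.Injective fun v : Fin d → ℤ =>
    (Units.coeHom k).comp (monomialHom k v) := by
  intro v w h
  funext i
  have h1 := DFunLike.congr_fun h (Pi.mulSingle i (Units.mk0 (2 : k) two_ne_zero))
  have h2 : ∀ v : Fin d → ℤ, (Units.coeHom k).comp (monomialHom k v)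
      (Pi.mulSingle i (Units.mk0 (2 : k) two_ne_zero)) = 2 ^ v i := by
    intro v
    rw [MonoidHom.comp_apply, monomialHom_apply, Finset.prod_eq_single i]
    · simp
    · intro b _ hb
      rw [Pi.mulSingle_eq_of_ne hb, one_zpow]
    · simp
  simp only [h2] at h1
  have h3 : ((2 : ℚ) ^ v i : ℚ) = 2 ^ w i := by
    have : (((2 : ℚ) ^ v i : ℚ) : k) = ((2 : ℚ) ^ w i : ℚ) := by push_cast; exact h1
    exact_mod_cast this
  exact zpow_right_injective₀ (by norm_num) (by norm_num) h3

/-- A function on `A`-points of a split torus that is natural in `A` is a Laurent polynomial. -/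
theorem exists_laurent (q : ∀ A : CommAlgCat.{u} k, (Fin d → Aˣ) → A)
    (hq : ∀ {A A' : CommAlgCat.{u} k} (f : A ⟶ A') (x : Fin d → Aˣ),
      q A' (fun i => Units.map (f.hom : A →* A') (x i)) = f.hom (q A x)) :
    ∃ c : (Fin d → ℤ) →₀ k, ∀ (A : CommAlgCat.{u} k) (x : Fin d → Aˣ),
      q A x = c.sum fun v a => a • (monomialHom A v x : A) := by
  -- This is the Yoneda argument: B is the coordinate ring of the torus, X its universal point, and
  -- the value of q at X is the Laurent polynomial sought.
  let B : CommAlgCat.{u} k := CommAlgCat.of k (MonoidAlgebra k (Multiplicative (Fin d → ℤ)))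
  let X : Fin d → Bˣ := fun i => Units.map (MonoidAlgebra.of k (Multiplicative (Fin d → ℤ)))
    (toUnits (Multiplicative.ofAdd (Pi.single i (1 : ℤ))))
  let P : MonoidAlgebra k (Multiplicative (Fin d → ℤ)) := q B X
  refine ⟨P.coeff, fun A x => ?_⟩
  let F : Multiplicative (Fin d → ℤ) →* A :=
    { toFun := fun v => (monomialHom A v.toAdd x : A)
      map_one' := by
        rw [toAdd_one, monomialHom_zero, Units.val_one]
      map_mul' := fun v w => by
        rw [toAdd_mul, monomialHom_add, Units.val_mul] }
  let f : B ⟶ A := CommAlgCat.ofHom (MonoidAlgebra.lift k A _ F)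
  have hx : (fun i => Units.map (f.hom : B →* A) (X i)) = x := by
    funext i
    apply Units.ext
    change MonoidAlgebra.lift k A _ F (MonoidAlgebra.of k _ _) = _
    rw [MonoidAlgebra.lift_of]
    change ((∏ i', x i' ^ (Pi.single i (1 : ℤ) : Fin d → ℤ) i' : Aˣ) : A) = _
    rw [Finset.prod_eq_single i]
    · simp
    · intro b _ hb
      rw [Pi.single_eq_of_ne hb, zpow_zero]
    · simp
  have h := hq f X
  rw [hx] at h
  rw [h]
  exact MonoidAlgebra.lift_apply F P

/-- Distinct monomials are distinct characters, and distinct characters are linearly independent; so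
a Laurent polynomial that is multiplicative on points is a monomial. -/
theorem laurent_eq_single [CharZero k] (c : (Fin d → ℤ) →₀ k) (ψ : (Fin d → kˣ) →* k)
    (h : ∀ x, ψ x = c.sum fun v a => a • (monomialHom k v x : k)) :
    ∃ v, c = Finsupp.single v 1 := by
  classical
  have hli : LinearIndependent k fun f : (Fin d → kˣ) →* k => (f : (Fin d → kˣ) → k) :=
    linearIndependent_monoidHom _ _
  have hs : c.mapDomain (fun v : Fin d → ℤ => (Units.coeHom k).comp (monomialHom k v)) =
      Finsupp.single ψ 1 := by
    refine hli.finsuppLinearCombination_injective ?_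
    rw [Finsupp.linearCombination_mapDomain, Finsupp.linearCombination_single, one_smul]
    funext x
    rw [h x, Finsupp.linearCombination_apply, Finsupp.sum, Finset.sum_apply]
    rfl
  obtain ⟨v, hv⟩ : ∃ v : Fin d → ℤ, (Units.coeHom k).comp (monomialHom k v) = ψ := by
    by_contra! hcon
    have h0 : c.mapDomain (fun v : Fin d → ℤ => (Units.coeHom k).comp (monomialHom k v)) ψ = 0 :=
      Finsupp.mapDomain_of_notMem_range _ _ (by rintro ⟨v, hv⟩; exact hcon v hv)
    rw [hs, Finsupp.single_eq_same] at h0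
    exact one_ne_zero h0
  refine ⟨v, Finsupp.mapDomain_injective (monomialHom_val_injective (k := k) (d := d)) ?_⟩
  rw [hs, Finsupp.mapDomain_single, hv]

/-- Again linear independence of characters, now for a vanishing combination. -/
theorem laurent_eq_zero [CharZero k] (c : (Fin d → ℤ) →₀ k)
    (h : ∀ x : Fin d → kˣ, c.sum (fun v a => a • (monomialHom k v x : k)) = 0) : c = 0 := by
  have hli : LinearIndependent k fun f : (Fin d → kˣ) →* k => (f : (Fin d → kˣ) → k) :=
    linearIndependent_monoidHom _ _
  have hli' := hli.comp _ (monomialHom_val_injective (k := k) (d := d))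
  refine hli'.finsuppLinearCombination_injective ?_
  funext x
  rw [map_zero, Pi.zero_apply, ← h x, Finsupp.linearCombination_apply, Finsupp.sum,
    Finset.sum_apply]
  rfl

/-- A proper subgroup of `ℤ ^ d` is killed by a nontrivial character with values in an
algebraically closed field of characteristic zero. -/
theorem exists_character_of_ne_top [IsAlgClosed k] [CharZero k] (N : Submodule ℤ (Fin d → ℤ))
    (hN : N ≠ ⊤) : ∃ θ : Multiplicative (Fin d → ℤ) →* kˣ, θ ≠ 1 ∧
      ∀ v ∈ N, θ (Multiplicative.ofAdd v) = 1 := by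
  -- N is enlarged to a maximal proper submodule. The quotient is simple, hence ℤ/n with (n)
  -- maximal, and n ≠ 0 because ℤ is not a field.
  obtain ⟨N', hN', hle⟩ := (eq_top_or_exists_le_coatom N).resolve_left hN
  have : IsSimpleModule ℤ ((Fin d → ℤ) ⧸ N') := isSimpleModule_iff_isCoatom.2 hN'
  obtain ⟨I, hI, ⟨e⟩⟩ := isSimpleModule_iff_quot_maximal.1 this
  obtain ⟨n, rfl⟩ : ∃ n : ℤ, I = Ideal.span {n} := 
    ⟨_, (Ideal.span_singleton_generator I).symm⟩
  have hn : n ≠ 0 := by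
    rintro rfl
    rw [Ideal.span_singleton_zero] at hI
    exact Int.not_isField (Ring.isField_iff_maximal_bot.2 hI)
  have : NeZero n.natAbs := ⟨by simpa using hn⟩
  let e' : ((Fin d → ℤ) ⧸ N') ≃+ ZMod n.natAbs :=
    e.toAddEquiv.trans (Int.quotientSpanEquivZMod n).toAddEquiv
  have hnt : Nontrivial ((Fin d → ℤ) ⧸ N') := IsSimpleModule.nontrivial ℤ _
  obtain ⟨a, ha⟩ := exists_ne (0 : (Fin d → ℤ) ⧸ N')
  have : Finite (Multiplicative ((Fin d → ℤ) ⧸ N')) := Finite.of_equiv _ e'.symm.toEquiv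
  -- The field contains enough roots of unity for characters of the finite quotient to separate its
  -- elements.
  obtain ⟨χ, hχ⟩ := CommGroup.exists_apply_ne_one_of_hasEnoughRootsOfUnity
    (Multiplicative ((Fin d → ℤ) ⧸ N')) k (a := Multiplicative.ofAdd a) (by simpa using ha)
  obtain ⟨b, rfl⟩ := N'.mkQ_surjective a
  refine ⟨χ.comp N'.mkQ.toAddMonoidHom.toMultiplicative, fun h => hχ ?_, fun v hv => ?_⟩
  · exact DFunLike.congr_fun h (Multiplicative.ofAdd b)
  · have : N'.mkQ v = 0 := by simpa using hle hv
    change χ (Multiplicative.ofAdd (N'.mkQ v)) = 1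
    rw [this]
    exact map_one χ

/-- If finitely many characters of a split torus over an algebraically closed field identify its
points over this field with those of a power of the multiplicative group, then they do so for
points in arbitrary algebras. -/
theorem exists_monomialHom_eq [IsAlgClosed k] [CharZero k] {ι : Type*} [Finite ι]
    (a : ι → Fin d → ℤ)
    (hinj : ∀ x : Fin d → kˣ, (∀ i, monomialHom k (a i) x = 1) → x = 1)
    (hsurj : ∀ t : ι → kˣ, ∃ x, ∀ i, monomialHom k (a i) x = t i)
    {A : Type*} [CommMonoid A] (t : ι → Aˣ) : ∃ x, ∀ i, monomialHom A (a i) x = t i := by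
  classical
  have := Fintype.ofFinite ι
  -- A nontrivial character of ℤ^d killing all a_i is a nontrivial k-point of the torus at which
  -- every monomial is 1, against `hinj`.
  have htop : Submodule.span ℤ (Set.range a) = ⊤ := by
    by_contra hne
    obtain ⟨θ, hθ, hθN⟩ := exists_character_of_ne_top (k := k) _ hne
    have hθv : ∀ v, θ (Multiplicative.ofAdd v) =
        monomialHom k v fun i => θ (Multiplicative.ofAdd (Pi.single i 1)) := by
      intro v
      have hv : v = ∑ i, v i • Pi.single i (1 : ℤ) := by
        conv_lhs => rw [← Finset.univ_sum_single v]
        refine Finset.sum_congr rfl fun i _ => ?_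
        rw [← Pi.single_smul, smul_eq_mul, mul_one]
      conv_lhs => rw [hv]
      rw [ofAdd_sum, map_prod, monomialHom_apply]
      refine Finset.prod_congr rfl fun i _ => ?_
      rw [ofAdd_zsmul, map_zpow]
    have h1 := hinj (fun i => θ (Multiplicative.ofAdd (Pi.single i 1))) fun i => by
      rw [← hθv]
      exact hθN _ (Submodule.subset_span ⟨i, rfl⟩)
    refine hθ (MonoidHom.ext fun v => ?_)
    refine (hθv v.toAdd).trans ?_
    rw [h1, map_one]
    rfl
  -- A relation among the a_i would impose a multiplicative relation on all tuples t, against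
  -- `hsurj`; it is tested with one coordinate equal to 2.
  have hli : LinearIndependent ℤ a := by
    rw [Fintype.linearIndependent_iff]
    intro c hc
    have hm : ∀ t : ι → kˣ, ∏ i, t i ^ c i = 1 := by
      intro t
      obtain ⟨x, hx⟩ := hsurj t
      have h2 : ∏ i, t i ^ c i = monomialHom k (∑ i, c i • a i) x := by
        rw [monomialHom_apply]
        simp only [← hx, monomialHom_apply, ← Finset.prod_zpow, ← zpow_mul]
        rw [Finset.prod_comm]
        refine Finset.prod_congr rfl fun j _ => ?_
        rw [prod_zpow_eq_zpow_sum]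
        congr 1
        simp [Finset.sum_apply, mul_comm]
      rw [h2, hc, monomialHom_zero]
    intro i
    have h3 := hm (Pi.mulSingle i (Units.mk0 (2 : k) two_ne_zero))
    rw [Finset.prod_eq_single i (fun b _ hb => by rw [Pi.mulSingle_eq_of_ne hb, one_zpow])
      (by simp), Pi.mulSingle_eq_same] at h3
    have h4 : ((2 : ℚ) ^ c i : ℚ) = 2 ^ (0 : ℤ) := by
      have h5 := congrArg Units.val h3
      have : (((2 : ℚ) ^ c i : ℚ) : k) = ((2 : ℚ) ^ (0 : ℤ) : ℚ) := by
        push_cast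
        simpa using h5
      exact_mod_cast this
    exact zpow_right_injective₀ (by norm_num) (by norm_num) h4
  let b : Module.Basis ι ℤ (Fin d → ℤ) := Module.Basis.mk hli htop.ge
  -- The a_i form a basis of ℤ^d, so the inverse of the exponent matrix is integral and solves the
  -- equations over any A.
  refine ⟨fun l => ∏ i, t i ^ b.repr (Pi.single l 1) i, fun i => ?_⟩
  have h6 : ∀ i', ∑ l, a i l * b.repr (Pi.single l 1) i' = if i' = i then 1 else 0 := by
    intro i'
    have h7 : b.repr (b i) i' = ∑ l, a i l * b.repr (Pi.single l 1) i' := by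
      have h8 : b i = ∑ l, a i l • Pi.single l (1 : ℤ) := by
        rw [Module.Basis.mk_apply]
        conv_lhs => rw [← Finset.univ_sum_single (a i)]
        refine Finset.sum_congr rfl fun l _ => ?_
        rw [← Pi.single_smul, smul_eq_mul, mul_one]
      rw [h8, map_sum, Finsupp.finsetSum_apply]
      refine Finset.sum_congr rfl fun l _ => ?_
      rw [map_zsmul, Finsupp.smul_apply, smul_eq_mul]
    rw [← h7, Module.Basis.repr_self, Finsupp.single_apply]
    simp only [eq_comm]
  rw [monomialHom_apply]
  simp only [← Finset.prod_zpow, ← zpow_mul]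
  rw [Finset.prod_comm]
  have h9 : ∀ i', ∏ l, t i' ^ (b.repr (Pi.single l 1) i' * a i l) =
      t i' ^ (if i' = i then (1 : ℤ) else 0) := by
    intro i'
    rw [prod_zpow_eq_zpow_sum, ← h6]
    simp only [mul_comm]
  rw [Finset.prod_congr rfl fun i' _ => h9 i', Finset.prod_eq_single i]
  · simp
  · intro i' _ hne
    rw [if_neg hne, zpow_zero]
  · simp

/-- A homomorphism from a split torus to the general linear group that maps the points over an
algebraically closed field isomorphically to the diagonal matrices does so for points in arbitrary
algebras. -/
theorem isDiag_of_natural [IsAlgClosed k] [CharZero k] {ι : Type} [Fintype ι] [DecidableEq ι]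
    (h : ∀ A : CommAlgCat.{u} k, (Fin d → Aˣ) →* Matrix ι ι A)
    (hnat : ∀ {A A' : CommAlgCat.{u} k} (f : A ⟶ A') (x : Fin d → Aˣ) (i i' : ι),
      h A' (fun l => Units.map (f.hom : A →* A') (x l)) i i' = f.hom (h A x i i'))
    (hdiag : ∀ x, (h (CommAlgCat.of k k) x).IsDiag)
    (hinj : Function.Injective (h (CommAlgCat.of k k)))
    (hsurj : ∀ t : ι → kˣ, ∃ x, ∀ i, h (CommAlgCat.of k k) x i i = t i) (A : CommAlgCat.{u} k) :
    (∀ x, (h A x).IsDiag) ∧ ∀ t : ι → Aˣ, ∃ x, ∀ i, h A x i i = t i := by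
  -- An off-diagonal entry is a Laurent polynomial that vanishes at all k-points, hence is zero.
  have hoff : ∀ (A : CommAlgCat.{u} k) (x : Fin d → Aˣ), (h A x).IsDiag := by
    intro A x i i' hii
    obtain ⟨c, hc⟩ := exists_laurent (fun A x => h A x i i') (fun f x => hnat f x i i')
    have hc0 := laurent_eq_zero c fun x => by
      rw [← hdiag x hii]
      exact (hc (CommAlgCat.of k k) x).symm
    rw [hc A x, hc0, Finsupp.sum_zero_index]
  -- On k-points the matrices are diagonal, so each diagonal entry is multiplicative there and is
  -- therefore a monomial.
  have hon : ∀ i, ∃ v : Fin d → ℤ, ∀ (A : CommAlgCat.{u} k) (x : Fin d → Aˣ),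
      h A x i i = monomialHom A v x := by
    intro i
    obtain ⟨c, hc⟩ := exists_laurent (fun A x => h A x i i) (fun f x => hnat f x i i)
    let ψ : (Fin d → kˣ) →* k :=
      { toFun := fun x => h (CommAlgCat.of k k) x i i
        map_one' := by
          rw [map_one, Matrix.one_apply_eq]
        map_mul' := fun x y => by
          rw [map_mul, Matrix.mul_apply, Finset.sum_eq_single i]
          · intro b _ hb
            rw [hdiag x hb.symm, zero_mul]
          · simp }
    obtain ⟨v, hv⟩ := laurent_eq_single c ψ fun x => hc (CommAlgCat.of k k) x
    refine ⟨v, fun A x => ?_⟩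
    rw [hc A x, hv, Finsupp.sum_single_index (by simp), one_smul]
  choose a ha using hon
  refine ⟨hoff A, fun t => ?_⟩
  have hinj' : ∀ x : Fin d → kˣ, (∀ i, monomialHom k (a i) x = 1) → x = 1 := by
    intro x hx
    refine hinj ?_
    rw [map_one]
    ext i i'
    by_cases hii : i = i'
    · subst hii
      rw [ha, Matrix.one_apply_eq]
      exact congrArg Units.val (hx i)
    · rw [hdiag x hii, Matrix.one_apply_ne hii]
  have hsurj' : ∀ t : ι → kˣ, ∃ x, ∀ i, monomialHom k (a i) x = t i := by
    intro t
    obtain ⟨x, hx⟩ := hsurj t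
    refine ⟨x, fun i => Units.ext ?_⟩
    rw [← hx i, ha]
  obtain ⟨x, hx⟩ := exists_monomialHom_eq (k := k) a hinj' hsurj' t
  exact ⟨x, fun i => by rw [ha, hx]⟩

end Monomial

/-! ### Points of maximal tori over algebras over the algebraic closure -/

section Conjugate

variable {K : Type u} [Field K] [CharZero K] {E : Type u} [Field E] [Algebra K E]
  {τ : E ≃ₐ[K] E} {m d : ℕ} {c : E}

theorem SubgroupFunctor.mem_iff_of_iso {k : Type u} [CommRing k] {G : GroupFunctor k}
    (T : SubgroupFunctor G) {R S : CommAlgCat.{u} k} (e : R ≅ S) (x : G.obj R) :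
    (G.map e.hom).hom x ∈ T.carrier S ↔ x ∈ T.carrier R := by
  refine ⟨fun h => ?_, T.map_mem e.hom⟩
  have h1 := T.map_mem e.inv h
  have h2 : (G.map e.inv).hom ((G.map e.hom).hom x) = x := by
    have := ConcreteCategory.congr_hom (G.mapIso e).hom_inv_id x
    exact this
  rwa [h2] at h1

/-- A point of the unitary group, considered over a `K̄`-algebra. -/
def pushPoint (g : (unitaryGroup K τ (gram m d c)).obj (algClosure K)) (R : CommAlgCat.{u} K)
    (φ : AlgebraicClosure K →ₐ[K] R) : (unitaryGroup K τ (gram m d c)).obj R :=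
  ((unitaryGroup K τ (gram m d c)).map (CommAlgCat.ofHom φ)).hom g

theorem map_pushPoint (g : (unitaryGroup K τ (gram m d c)).obj (algClosure K))
    {R S : CommAlgCat.{u} K} (φ : AlgebraicClosure K →ₐ[K] R) (f : R ⟶ S) :
    ((unitaryGroup K τ (gram m d c)).map f).hom (pushPoint g R φ) =
      pushPoint g S (f.hom.comp φ) :=
  (ConcreteCategory.congr_hom ((unitaryGroup K τ (gram m d c)).map_comp (CommAlgCat.ofHom φ) f)
    g).symm

/-- Over the `K̄`-algebra `R` the subgroup functor `T` is conjugate under `g` to the diagonal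
torus. -/
def IsConjugateBy (T : SubgroupFunctor (unitaryGroup K τ (gram m d c)))
    (g : (unitaryGroup K τ (gram m d c)).obj (algClosure K)) (R : CommAlgCat.{u} K)
    (φ : AlgebraicClosure K →ₐ[K] R) : Prop :=
  ∀ x, x ∈ T.carrier R ↔ (pushPoint g R φ)⁻¹ * x * pushPoint g R φ ∈
    (diagonalTorus K τ (gram m d c)).carrier R

theorem IsConjugateBy.of_iso {T : SubgroupFunctor (unitaryGroup K τ (gram m d c))}
    {g : (unitaryGroup K τ (gram m d c)).obj (algClosure K)} {R S : CommAlgCat.{u} K}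
    {φ : AlgebraicClosure K →ₐ[K] R} (h : IsConjugateBy T g R φ) (e : R ≅ S) :
    IsConjugateBy T g S (e.hom.hom.comp φ) := by
  intro y
  obtain ⟨x, rfl⟩ : ∃ x, ((unitaryGroup K τ (gram m d c)).map e.hom).hom x = y :=
    ⟨((unitaryGroup K τ (gram m d c)).map e.inv).hom y,
      ConcreteCategory.congr_hom ((unitaryGroup K τ (gram m d c)).mapIso e).inv_hom_id y⟩
  rw [T.mem_iff_of_iso, h x, ← (diagonalTorus K τ (gram m d c)).mem_iff_of_iso e, map_mul,
    map_mul, map_inv, map_pushPoint]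

variable (j : E →ₐ[K] AlgebraicClosure K)

/-- Over `K̄`-algebras the unitary group embeds into the general linear group. -/
def glHom (R : CommAlgCat.{u} K) (φ : AlgebraicClosure K →ₐ[K] R) :
    (unitaryGroup K τ (gram m d c)).obj R →* GL (Idx m d) R :=
  splitGL τ m d c j φ

/-- The matrix of a point of the unitary group over a `K̄`-algebra. -/
def glMatrix (R : CommAlgCat.{u} K) (φ : AlgebraicClosure K →ₐ[K] R) :
    (unitaryGroup K τ (gram m d c)).obj R →* Matrix (Idx m d) (Idx m d) R :=
  (Units.coeHom _).comp (glHom j R φ)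

theorem glMatrix_injective {R : CommAlgCat.{u} K} (φ : AlgebraicClosure K →ₐ[K] R)
    (hE : Module.finrank K E = 2) (hτ : τ ≠ 1) (hc : c ≠ 0) :
    Function.Injective (glMatrix (τ := τ) (m := m) (d := d) (c := c) j R φ) :=
  Units.val_injective.comp (splitGL_injective j φ hE hτ hc)

theorem glMatrix_map {R S : CommAlgCat.{u} K} (φ : AlgebraicClosure K →ₐ[K] R) (f : R ⟶ S)
    (x : (unitaryGroup K τ (gram m d c)).obj R) (a b : Idx m d) :
    glMatrix j S (f.hom.comp φ) (((unitaryGroup K τ (gram m d c)).map f).hom x) a b =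
      f.hom (glMatrix j R φ x a b) :=
  splitMap_coeffMap j φ f.hom _

theorem mem_diagonalTorus_iff_glMatrix {R : CommAlgCat.{u} K} (φ : AlgebraicClosure K →ₐ[K] R)
    (hE : Module.finrank K E = 2) (hτ : τ ≠ 1) (hc : c ≠ 0)
    (x : (unitaryGroup K τ (gram m d c)).obj R) :
    x ∈ (diagonalTorus K τ (gram m d c)).carrier R ↔ (glMatrix j R φ x).IsDiag :=
  (mem_diagonalTorus_iff j φ hE hτ hc x).trans ⟨fun h a b => h a b, fun h a b => @h a b⟩

theorem exists_glMatrix_eq {R : CommAlgCat.{u} K} (φ : AlgebraicClosure K →ₐ[K] R)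
    (hE : Module.finrank K E = 2) (hτ : τ ≠ 1) (t : Idx m d → Rˣ) :
    ∃ x ∈ (diagonalTorus K τ (gram m d c)).carrier R,
      ∀ a, glMatrix (τ := τ) (m := m) (d := d) (c := c) j R φ x a a = t a :=
  exists_splitGL_eq_diagonal j φ hE hτ t

/-- The structure map of a `K̄`-algebra. -/
def structureHom (A : CommAlgCat.{u} (AlgebraicClosure K)) :
    AlgebraicClosure K →ₐ[K] (restrictAlg K (AlgebraicClosure K)).obj A :=
  letI := Algebra.restrictScalars K (AlgebraicClosure K) A
  { toRingHom := (algebraMap (AlgebraicClosure K) A)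
    commutes' := fun _ => rfl }

theorem restrictAlg_map_comp_structureHom {A A' : CommAlgCat.{u} (AlgebraicClosure K)}
    (f : A ⟶ A') : ((restrictAlg K (AlgebraicClosure K)).map f).hom.comp (structureHom A) =
      structureHom A' :=
  AlgHom.ext fun x => f.hom.commutes x

/-- A homomorphism `K̄ → R` gives a `K̄`-algebra. -/
def algOfHom (R : CommAlgCat.{u} K) (φ : AlgebraicClosure K →ₐ[K] R) :
    CommAlgCat.{u} (AlgebraicClosure K) :=
  @CommAlgCat.of (AlgebraicClosure K) _ R _ φ.toRingHom.toAlgebra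

/-- The `K`-algebra underlying the `K̄`-algebra given by `K̄ → R` is `R`. -/
def algOfHomIso (R : CommAlgCat.{u} K) (φ : AlgebraicClosure K →ₐ[K] R) :
    (restrictAlg K (AlgebraicClosure K)).obj (algOfHom R φ) ≅ R :=
  letI := Algebra.restrictScalars K (AlgebraicClosure K) (algOfHom R φ)
  { hom := CommAlgCat.ofHom
      { toRingHom := (RingHom.id R : algOfHom R φ →+* R)
        commutes' := fun r => φ.commutes r }
    inv := CommAlgCat.ofHom
      { toRingHom := (RingHom.id R : R →+* algOfHom R φ)
        commutes' := fun r => (φ.commutes r).symm }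
    hom_inv_id := rfl
    inv_hom_id := rfl }

theorem algOfHomIso_comp_structureHom (R : CommAlgCat.{u} K) (φ : AlgebraicClosure K →ₐ[K] R) :
    (algOfHomIso R φ).hom.hom.comp (structureHom (algOfHom R φ)) = φ := rfl

variable {j}

/-- Over K̄ the torus is a power of the multiplicative group; conjugation by g⁻¹ followed by the
embedding into the general linear group makes it a natural homomorphism from a split torus to
matrices. On K̄-points this is an isomorphism onto the diagonal matrices, so `isDiag_of_natural`
applies. -/
theorem IsTorus.isConjugateBy_restrictAlg (hE : Module.finrank K E = 2) (hτ : τ ≠ 1) (hc : c ≠ 0)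
    (j : E →ₐ[K] AlgebraicClosure K)
    {T : SubgroupFunctor (unitaryGroup K τ (gram m d c))} (hT : IsTorus T.toFunctor)
    {g : (unitaryGroup K τ (gram m d c)).obj (algClosure K)}
    (hg : IsConjugateBy T g _ (structureHom (CommAlgCat.of _ (AlgebraicClosure K))))
    (A : CommAlgCat.{u} (AlgebraicClosure K)) :
    IsConjugateBy T g _ (structureHom A) := by
  obtain ⟨-, n, ⟨e⟩⟩ := hT
  obtain ⟨I, J, hIJ, hJI, hI⟩ : ∃ (I : ∀ A : CommAlgCat.{u} (AlgebraicClosure K),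
        (Fin n → Aˣ) →* T.carrier ((restrictAlg K (AlgebraicClosure K)).obj A))
      (J : ∀ A : CommAlgCat.{u} (AlgebraicClosure K),
        T.carrier ((restrictAlg K (AlgebraicClosure K)).obj A) →* (Fin n → Aˣ)),
      (∀ A x, I A (J A x) = x) ∧ (∀ A x, J A (I A x) = x) ∧
      ∀ {A A' : CommAlgCat.{u} (AlgebraicClosure K)} (f : A ⟶ A') (x : Fin n → Aˣ),
        (I A' (fun l => Units.map (f.hom : A →* A') (x l))).1 =
          ((unitaryGroup K τ (gram m d c)).map
            ((restrictAlg K (AlgebraicClosure K)).map f)).hom (I A x).1 :=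
    ⟨fun A => (e.inv.app A).hom, fun A => (e.hom.app A).hom,
      fun A x => ConcreteCategory.congr_hom (e.hom_inv_id_app A) x,
      fun A x => ConcreteCategory.congr_hom (e.inv_hom_id_app A) x,
      fun f x => congrArg Subtype.val (ConcreteCategory.congr_hom (e.inv.naturality f) x)⟩
  let U : ∀ A : CommAlgCat.{u} (AlgebraicClosure K), (Fin n → Aˣ) →*
      (unitaryGroup K τ (gram m d c)).obj ((restrictAlg K (AlgebraicClosure K)).obj A) := fun A =>
    (MulAut.conj (pushPoint g _ (structureHom A))⁻¹).toMonoidHom.comp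
      ((T.carrier ((restrictAlg K (AlgebraicClosure K)).obj A)).subtype.comp (I A))
  have hU : ∀ A x, U A x = (pushPoint g _ (structureHom A))⁻¹ * (I A x).1 *
      pushPoint g _ (structureHom A) := by
    intro A x
    change (pushPoint g _ (structureHom A))⁻¹ * _ * (pushPoint g _ (structureHom A))⁻¹⁻¹ = _
    rw [inv_inv]
    rfl
  let h : ∀ A : CommAlgCat.{u} (AlgebraicClosure K),
      (Fin n → Aˣ) →* Matrix (Idx m d) (Idx m d) A := fun A =>
    (glMatrix j _ (structureHom A)).comp (U A)
  have hUnat : ∀ {A A' : CommAlgCat.{u} (AlgebraicClosure K)} (f : A ⟶ A') (x : Fin n → Aˣ),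
      U A' (fun l => Units.map (f.hom : A →* A') (x l)) =
        ((unitaryGroup K τ (gram m d c)).map
          ((restrictAlg K (AlgebraicClosure K)).map f)).hom (U A x) := by
    intro A A' f x
    rw [hU, hU, map_mul, map_mul, map_inv, map_pushPoint, restrictAlg_map_comp_structureHom, hI]
  have hUe : ∀ A x (hx : x ∈ T.carrier ((restrictAlg K (AlgebraicClosure K)).obj A)),
      U A (J A ⟨x, hx⟩) = (pushPoint g _ (structureHom A))⁻¹ * x *
        pushPoint g _ (structureHom A) := by
    intro A x hx
    rw [hU, hIJ]
  have hUinj : ∀ A, Function.Injective (U A) := by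
    intro A x y hxy
    have h1 : I A x = I A y :=
      Subtype.ext ((MulAut.conj (pushPoint g _ (structureHom A))⁻¹).injective hxy)
    rw [← hJI A x, h1, hJI]
  have hnat : ∀ {A A' : CommAlgCat.{u} (AlgebraicClosure K)} (f : A ⟶ A') (x : Fin n → Aˣ)
      (i i' : Idx m d), h A' (fun l => Units.map (f.hom : A →* A') (x l)) i i' =
        f.hom (h A x i i') := by
    intro A A' f x i i'
    refine Eq.trans ?_ (glMatrix_map j (structureHom A)
      ((restrictAlg K (AlgebraicClosure K)).map f) (U A x) i i')
    rw [restrictAlg_map_comp_structureHom]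
    exact congrFun₂ (congrArg (glMatrix j _ (structureHom A')) (hUnat f x)) i i'
  have hdiag : ∀ x, (h (CommAlgCat.of _ (AlgebraicClosure K)) x).IsDiag := by
    intro x
    refine (mem_diagonalTorus_iff_glMatrix j _ hE hτ hc _).1 ?_
    rw [hU]
    exact (hg _).1 (I _ x).2
  have hinj : Function.Injective (h (CommAlgCat.of _ (AlgebraicClosure K))) :=
    (glMatrix_injective j _ hE hτ hc).comp (hUinj _)
  have hsurj : ∀ t : Idx m d → (AlgebraicClosure K)ˣ,
      ∃ x, ∀ i, h (CommAlgCat.of _ (AlgebraicClosure K)) x i i = t i := by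
    intro t
    obtain ⟨y, hy, hyt⟩ := exists_glMatrix_eq (τ := τ) (c := c) j
      (structureHom (CommAlgCat.of _ (AlgebraicClosure K))) hE hτ t
    let g' := pushPoint g _ (structureHom (CommAlgCat.of _ (AlgebraicClosure K)))
    have hx : g' * y * g'⁻¹ ∈ T.carrier _ := by
      rw [hg]
      convert hy using 1
      change g'⁻¹ * (g' * y * g'⁻¹) * g' = y
      group
    refine ⟨J _ ⟨_, hx⟩, fun i => ?_⟩
    rw [← hyt]
    change glMatrix j _ _ (U _ _) i i = _
    rw [hUe]
    have : g'⁻¹ * (g' * y * g'⁻¹) * g' = y := by group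
    rw [this]
  have key := isDiag_of_natural h hnat hdiag hinj hsurj A
  intro x
  constructor
  · intro hx
    rw [mem_diagonalTorus_iff_glMatrix j (structureHom A) hE hτ hc, ← hUe A x hx]
    exact key.1 _
  · intro hx
    have hdx := (mem_diagonalTorus_iff_glMatrix j (structureHom A) hE hτ hc _).1 hx
    set y := (pushPoint g _ (structureHom A))⁻¹ * x * pushPoint g _ (structureHom A) with hy
    have hu : ∀ a, IsUnit (glMatrix j _ (structureHom A) y a a) := by
      have h1 : IsUnit (glMatrix j _ (structureHom A) y) := (glHom j _ (structureHom A) y).isUnit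
      rw [← hdx.diagonal_diag, Matrix.isUnit_diagonal, Pi.isUnit_iff] at h1
      exact h1
    -- The diagonal of g⁻¹xg comes from a point z of the split torus; the embedding into matrices is
    -- injective, so x is the corresponding point of T.
    choose t ht using hu
    obtain ⟨z, hz⟩ := key.2 t
    have h1 : U A z = y := by
      refine glMatrix_injective j (structureHom A) hE hτ hc ?_
      ext a b
      by_cases hab : a = b
      · subst hab
        exact (hz a).trans (ht a)
      · exact (key.1 z hab).trans (hdx hab).symm
    rw [hU] at h1
    have h2 : x = (I A z).1 := by
      rw [hy] at h1
      exact (mul_left_cancel (mul_right_cancel h1)).symm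
    rw [h2]
    exact (I A z).2

/-- If a torus is conjugate to the diagonal torus on geometric points, then it is so over all
`K̄`-algebras. -/
theorem IsTorus.isConjugateBy (hE : Module.finrank K E = 2) (hτ : τ ≠ 1) (hc : c ≠ 0)
    (j : E →ₐ[K] AlgebraicClosure K)
    {T : SubgroupFunctor (unitaryGroup K τ (gram m d c))} (hT : IsTorus T.toFunctor)
    {g : (unitaryGroup K τ (gram m d c)).obj (algClosure K)}
    (hg : ∀ x, x ∈ T.carrier (algClosure K) ↔
      g⁻¹ * x * g ∈ (diagonalTorus K τ (gram m d c)).carrier (algClosure K))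
    (R : CommAlgCat.{u} K) (φ : AlgebraicClosure K →ₐ[K] R) : IsConjugateBy T g R φ := by
  have h0 : IsConjugateBy T g (algClosure K) (AlgHom.id K _) := by
    intro x
    have : pushPoint g (algClosure K) (AlgHom.id K _) = g :=
      ConcreteCategory.congr_hom ((unitaryGroup K τ (gram m d c)).map_id (algClosure K)) g
    rw [this]
    exact hg x
  have h1 : IsConjugateBy T g _ (structureHom (CommAlgCat.of _ (AlgebraicClosure K))) := by
    exact h0.of_iso (algOfHomIso (algClosure K) (AlgHom.id K _)).symm
  -- Any K-algebra R with a map from K̄ is the restriction of a K̄-algebra, so the statement is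
  -- transported from there.
  have h2 := (hT.isConjugateBy_restrictAlg hE hτ hc j h1 (algOfHom R φ)).of_iso (algOfHomIso R φ)
  rwa [algOfHomIso_comp_structureHom] at h2

end Conjugate

/-! ### The action of the Weyl group on characters -/

section Weyl

variable {K : Type u} [Field K] [CharZero K] {E : Type u} [Field E] [Algebra K E]
  {τ : E ≃ₐ[K] E} {m d : ℕ} {c : E} (j : E →ₐ[K] AlgebraicClosure K)
  {R : CommAlgCat.{u} K} (φ : AlgebraicClosure K →ₐ[K] R)

theorem glMatrix_comp_of_fixes {γ : AlgebraicClosure K ≃ₐ[K] AlgebraicClosure K}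
    (h : ∀ x, γ (j x) = j x) (x : (unitaryGroup K τ (gram m d c)).obj R) (a b : Idx m d) :
    glMatrix j R (φ.comp (γ : AlgebraicClosure K →ₐ[K] AlgebraicClosure K)) x a b =
      glMatrix j R φ x a b :=
  splitMap_comp_of_fixes j φ h _

/-- Twisting the structure map by γ replaces the first coordinate of E ⊗ R ≅ R × R by the second,
which the unitary relation ties to the inverse of χ_{-a}. -/
theorem glMatrix_mul_comp_of_not_fixes (hc : c ≠ 0)
    {γ : AlgebraicClosure K ≃ₐ[K] AlgebraicClosure K}
    (h : ∀ x, γ (j x) = j (τ x)) {x : (unitaryGroup K τ (gram m d c)).obj R}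
    (hx : x ∈ (diagonalTorus K τ (gram m d c)).carrier R) (a : Idx m d) :
    glMatrix j R φ x (negIdx m d a) (negIdx m d a) *
      glMatrix j R (φ.comp (γ : AlgebraicClosure K →ₐ[K] AlgebraicClosure K)) x a a = 1 := by
  have h1 := splitGL_mul_conj j φ hc hx (negIdx m d a)
  rw [negIdx_negIdx] at h1
  rw [← h1]
  congr 1
  exact splitMap_comp_of_not_fixes j φ h _

/-- The homomorphism from the diagonal torus given by all its standard characters. -/
def diagHom (hE : Module.finrank K E = 2) (hτ : τ ≠ 1) (hc : c ≠ 0) (R : CommAlgCat.{u} K)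
    (φ : AlgebraicClosure K →ₐ[K] R) :
    (diagonalTorus K τ (gram m d c)).carrier R →* (Idx m d → Rˣ) :=
  MonoidHom.pi fun a => MonoidHom.toHomUnits
    { toFun := fun y => glMatrix j R φ y.1 a a
      map_one' := by
        rw [OneMemClass.coe_one, map_one, Matrix.one_apply_eq]
      map_mul' := fun x y => by
        rw [Subgroup.coe_mul, map_mul, Matrix.mul_apply, Finset.sum_eq_single a]
        · intro b _ hb
          rw [(mem_diagonalTorus_iff_glMatrix j φ hE hτ hc _).1 x.2 hb.symm, zero_mul]
        · simp }

theorem diagHom_apply (hE : Module.finrank K E = 2) (hτ : τ ≠ 1) (hc : c ≠ 0)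
    (y : (diagonalTorus K τ (gram m d c)).carrier R) (a : Idx m d) :
    (diagHom j hE hτ hc R φ y a : R) = glMatrix j R φ y.1 a a := rfl

theorem eq_of_glMatrix_diag_eq (hE : Module.finrank K E = 2) (hτ : τ ≠ 1) (hc : c ≠ 0)
    {x y : (unitaryGroup K τ (gram m d c)).obj R}
    (hx : x ∈ (diagonalTorus K τ (gram m d c)).carrier R)
    (hy : y ∈ (diagonalTorus K τ (gram m d c)).carrier R)
    (h : ∀ a, glMatrix j R φ x a a = glMatrix j R φ y a a) : x = y := by
  refine glMatrix_injective j φ hE hτ hc ?_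
  ext a b
  by_cases hab : a = b
  · subst hab
    exact h a
  · rw [(mem_diagonalTorus_iff_glMatrix j φ hE hτ hc _).1 hx hab,
      (mem_diagonalTorus_iff_glMatrix j φ hE hτ hc _).1 hy hab]

end Weyl

section WeylIntermediate

variable {K : Type u} [Field K] [CharZero K] {E : IntermediateField K (AlgebraicClosure K)}
  {τ : E ≃ₐ[K] E} {m d : ℕ} {c : E}
  {n g : (unitaryGroup K τ (gram m d c)).obj (algClosure K)} {w : Equiv.Perm (Idx m d)}

theorem chi_eq_glMatrix (i : Idx m d) :
    chi i g = glMatrix E.val (algClosure K) (AlgHom.id K _) g i i := rfl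

/-- An element of the normalizer of the diagonal torus is a monomial matrix. -/
theorem RepresentsWeyl.glMatrix_eq_zero (hE : Module.finrank K E = 2) (hτ : τ ≠ 1) (hc : c ≠ 0)
    (h : RepresentsWeyl n w) {a i : Idx m d} (hai : a ≠ w i) :
    glMatrix E.val (algClosure K) (AlgHom.id K _) n a i = 0 := by
  -- Here s is diagonal with entry 2 at a and 1 elsewhere. In the (a, i) entry of sn = n(n⁻¹sn) the
  -- left side is twice n_{ai}, while the right side is n_{ai}, because χ_{w i}(s) = 1.
  obtain ⟨s, hs, hst⟩ := exists_glMatrix_eq (τ := τ) (c := c) (m := m) (d := d) E.val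
    (R := algClosure K) (AlgHom.id K _) hE hτ
    (Pi.mulSingle a (Units.mk0 (2 : AlgebraicClosure K) two_ne_zero))
  have hmem : n⁻¹ * s * n ∈ (diagonalTorus K τ (gram m d c)).carrier (algClosure K) := by
    refine (Subgroup.mem_normalizer_iff.1 h.1 (n⁻¹ * s * n)).2 ?_
    have : n * (n⁻¹ * s * n) * n⁻¹ = s := by group
    rwa [this]
  have h1 := h.2 s hs i
  rw [chi_eq_glMatrix, chi_eq_glMatrix, hst, Pi.mulSingle_eq_of_ne hai.symm] at h1
  have hd1 := (mem_diagonalTorus_iff_glMatrix E.val (AlgHom.id K _) hE hτ hc _).1 hs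
  have hd2 := (mem_diagonalTorus_iff_glMatrix E.val (AlgHom.id K _) hE hτ hc _).1 hmem
  have h2 : s * n = n * (n⁻¹ * s * n) := by group
  have h3 := congrFun₂ (congrArg (glMatrix E.val (algClosure K) (AlgHom.id K _)) h2) a i
  rw [map_mul, map_mul, Matrix.mul_apply, Matrix.mul_apply, Finset.sum_eq_single a,
    Finset.sum_eq_single i, h1, hst, Pi.mulSingle_eq_same] at h3
  · simp only [Units.val_mk0, Units.val_one] at h3
    linear_combination h3
  · intro b _ hb
    rw [hd2 hb, mul_zero]
  · simp
  · intro b _ hb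
    rw [hd1 hb.symm, zero_mul]
  · simp

/-- The action of a representative of a Weyl group element on the diagonal torus over any
`K̄`-algebra. -/
theorem RepresentsWeyl.conj_pushPoint (hE : Module.finrank K E = 2) (hτ : τ ≠ 1) (hc : c ≠ 0)
    (h : RepresentsWeyl n w) (R : CommAlgCat.{u} K) (φ : AlgebraicClosure K →ₐ[K] R)
    {y : (unitaryGroup K τ (gram m d c)).obj R}
    (hy : y ∈ (diagonalTorus K τ (gram m d c)).carrier R) :
    (pushPoint n R φ)⁻¹ * y * pushPoint n R φ ∈ (diagonalTorus K τ (gram m d c)).carrier R ∧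
    ∀ i, glMatrix E.val R φ ((pushPoint n R φ)⁻¹ * y * pushPoint n R φ) i i =
      glMatrix E.val R φ y (w i) (w i) := by
  have hN : ∀ a i, a ≠ w i → glMatrix E.val R φ (pushPoint n R φ) a i = 0 := by
    intro a i hai
    have h1 := glMatrix_map E.val (AlgHom.id K _) (CommAlgCat.ofHom φ : algClosure K ⟶ R) n a i
    rw [h.glMatrix_eq_zero hE hτ hc hai, map_zero] at h1
    exact h1
  have hd := (mem_diagonalTorus_iff_glMatrix E.val φ hE hτ hc _).1 hy
  -- As n is monomial with column i supported in row w i, moving y past n permutes its diagonal by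
  -- w.
  have hD : glMatrix E.val R φ y * glMatrix E.val R φ (pushPoint n R φ) =
      glMatrix E.val R φ (pushPoint n R φ) *
        Matrix.diagonal (fun i => glMatrix E.val R φ y (w i) (w i)) := by
    ext a i
    rw [Matrix.mul_diagonal, Matrix.mul_apply, Finset.sum_eq_single a]
    · by_cases hai : a = w i
      · rw [hai, mul_comm]
      · rw [hN a i hai, mul_zero, zero_mul]
    · intro b _ hb
      rw [hd hb.symm, zero_mul]
    · simp
  have key : glMatrix E.val R φ ((pushPoint n R φ)⁻¹ * y * pushPoint n R φ) =
      Matrix.diagonal (fun i => glMatrix E.val R φ y (w i) (w i)) := by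
    rw [map_mul, map_mul, mul_assoc, hD, ← mul_assoc, ← map_mul, inv_mul_cancel, map_one, one_mul]
  rw [mem_diagonalTorus_iff_glMatrix E.val φ hE hτ hc, key]
  exact ⟨Matrix.isDiag_diagonal _, fun i => Matrix.diagonal_apply_eq _ i⟩

end WeylIntermediate

/-! ### The Galois descent description of maximal tori -/

section WeilTorus

variable (K : Type u) [Field K]

/-- The functor `R ↦ ((K̄ ⊗ R)ˣ) ^ ι`. -/
def geomUnits (ι : Type) : GroupFunctor K where
  obj R := GrpCat.of (ι → (AlgebraicClosure K ⊗[K] R)ˣ)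
  map f := GrpCat.ofHom (MonoidHom.pi fun i => (Units.map
    (Algebra.TensorProduct.map (AlgHom.id K (AlgebraicClosure K)) f.hom :
      AlgebraicClosure K ⊗[K] _ →* AlgebraicClosure K ⊗[K] _)).comp (Pi.evalMonoidHom _ i))
  map_id R := by
    ext x i
    change Algebra.TensorProduct.map (AlgHom.id K (AlgebraicClosure K)) (AlgHom.id K R) _ = _
    rw [Algebra.TensorProduct.map_id]
    rfl
  map_comp f g := by
    ext x i
    change Algebra.TensorProduct.map (AlgHom.id K (AlgebraicClosure K)) (g.hom.comp f.hom) _ = _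
    rw [← AlgHom.comp_id (AlgHom.id K (AlgebraicClosure K)), Algebra.TensorProduct.map_comp]
    rfl

variable {K}

/-- The action of the Galois group on the units of `K̄ ⊗ R`. -/
def galUnits (R : Type u) [CommRing R] [Algebra K R]
    (γ : AlgebraicClosure K ≃ₐ[K] AlgebraicClosure K) :
    (AlgebraicClosure K ⊗[K] R)ˣ →* (AlgebraicClosure K ⊗[K] R)ˣ :=
  Units.map (galTensor R γ : _ →* _)

@[simp]
theorem coe_galUnits (R : Type u) [CommRing R] [Algebra K R]
    (γ : AlgebraicClosure K ≃ₐ[K] AlgebraicClosure K) (z : (AlgebraicClosure K ⊗[K] R)ˣ) :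
    (galUnits R γ z : AlgebraicClosure K ⊗[K] R) = galTensor R γ z := rfl

theorem galUnits_mul (R : Type u) [CommRing R] [Algebra K R]
    (γ δ : AlgebraicClosure K ≃ₐ[K] AlgebraicClosure K) (z : (AlgebraicClosure K ⊗[K] R)ˣ) :
    galUnits R (γ * δ) z = galUnits R γ (galUnits R δ z) :=
  Units.ext (galTensor_mul R γ δ z)

theorem galUnits_one (R : Type u) [CommRing R] [Algebra K R] (z : (AlgebraicClosure K ⊗[K] R)ˣ) :
    galUnits R 1 z = z :=
  Units.ext (galTensor_one R (z : AlgebraicClosure K ⊗[K] R))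

theorem galUnits_map {R S : Type u} [CommRing R] [Algebra K R] [CommRing S] [Algebra K S]
    (h : R →ₐ[K] S) (γ : AlgebraicClosure K ≃ₐ[K] AlgebraicClosure K)
    (z : (AlgebraicClosure K ⊗[K] R)ˣ) :
    Units.map (Algebra.TensorProduct.map (AlgHom.id K (AlgebraicClosure K)) h :
      AlgebraicClosure K ⊗[K] R →* AlgebraicClosure K ⊗[K] S) (galUnits R γ z) =
    galUnits S γ (Units.map (Algebra.TensorProduct.map (AlgHom.id K (AlgebraicClosure K)) h :
      AlgebraicClosure K ⊗[K] R →* AlgebraicClosure K ⊗[K] S) z) :=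
  Units.ext (galTensor_map γ h (z : AlgebraicClosure K ⊗[K] R))

variable (p : ℕ) [Fact p.Prime] [Algebra ℚ_[p] K] [FiniteDimensional ℚ_[p] K]
  (E : IntermediateField K (AlgebraicClosure K))
  (f : AlgebraicClosure K ≃ₐ[K] AlgebraicClosure K) {m d : ℕ}

/-- The torus with character lattice `ℤ ^ (Idx m d)` on which Weil group elements act through
powers of `w` and, if they are nontrivial on `E`, through `χ_i ↦ -χ_{-i}`. -/
def weilTorus (w : Equiv.Perm (Idx m d)) : SubgroupFunctor (geomUnits K (Idx m d)) where
  carrier R :=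
    { carrier := {z : Idx m d → (AlgebraicClosure K ⊗[K] R)ˣ | ∀ γ k, IsWeil p f γ k → ∀ i,
        (Fixes E γ → galUnits R γ (z i) = z ((w ^ k) i)) ∧
        (¬ Fixes E γ → galUnits R γ (z i) = (z (negIdx m d ((w ^ k) i)))⁻¹)}
      one_mem' := fun γ k _ i => ⟨fun _ => map_one _, fun _ => (map_one _).trans inv_one.symm⟩
      mul_mem' := fun {x y} hx hy γ k h i =>
        ⟨fun hγ => (map_mul _ _ _).trans
          (congrArg₂ (· * ·) ((hx γ k h i).1 hγ) ((hy γ k h i).1 hγ)),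
        fun hγ => (map_mul _ _ _).trans <|
          (congrArg₂ (· * ·) ((hx γ k h i).2 hγ) ((hy γ k h i).2 hγ)).trans (mul_inv _ _).symm⟩
      inv_mem' := fun {x} hx γ k h i =>
        ⟨fun hγ => (map_inv _ _).trans (congrArg (·⁻¹) ((hx γ k h i).1 hγ)),
        fun hγ => (map_inv _ _).trans (congrArg (·⁻¹) ((hx γ k h i).2 hγ))⟩ }
  map_mem {R S} h z hz γ k hγ i :=
    ⟨fun hE => (galUnits_map h.hom γ _).symm.trans (congrArg _ ((hz γ k hγ i).1 hE)),
      fun hE => (galUnits_map h.hom γ _).symm.trans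
        ((congrArg _ ((hz γ k hγ i).2 hE)).trans (map_inv _ _))⟩

variable {p E f}

theorem mem_weilTorus {w : Equiv.Perm (Idx m d)} {R : CommAlgCat.{u} K}
    {z : Idx m d → (AlgebraicClosure K ⊗[K] R)ˣ} :
    z ∈ (weilTorus p E f w).carrier R ↔ ∀ γ k, IsWeil p f γ k → ∀ i,
        (Fixes E γ → galUnits R γ (z i) = z ((w ^ k) i)) ∧
        (¬ Fixes E γ → galUnits R γ (z i) = (z (negIdx m d ((w ^ k) i)))⁻¹) := Iff.rfl

end WeilTorus

/-! ### Maximal tori and their character lattices -/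

section TorusIso

variable {p : ℕ} [Fact p.Prime] {K : Type u} [Field K] [Algebra ℚ_[p] K]
  [FiniteDimensional ℚ_[p] K] [CharZero K] {E : IntermediateField K (AlgebraicClosure K)}
  {τ : E ≃ₐ[K] E} {m d : ℕ} {c : E}
  {g : (unitaryGroup K τ (gram m d c)).obj (algClosure K)}
  {T : SubgroupFunctor (unitaryGroup K τ (gram m d c))}
  {f : AlgebraicClosure K ≃ₐ[K] AlgebraicClosure K} {w : Equiv.Perm (Idx m d)}

/-- The algebra `K̄ ⊗ R`. -/
abbrev geomAlg (R : CommAlgCat.{u} K) : CommAlgCat.{u} K :=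
  CommAlgCat.of K (AlgebraicClosure K ⊗[K] R)

/-- The structure map of `K̄ ⊗ R`. -/
abbrev geomHom (R : CommAlgCat.{u} K) : AlgebraicClosure K →ₐ[K] geomAlg R :=
  Algebra.TensorProduct.includeLeft

/-- The inclusion `R → K̄ ⊗ R`. -/
abbrev geomIncl (R : CommAlgCat.{u} K) : R ⟶ geomAlg R :=
  CommAlgCat.ofHom Algebra.TensorProduct.includeRight

/-- The action of the Galois group on `K̄ ⊗ R`. -/
abbrev geomGal (R : CommAlgCat.{u} K) (γ : AlgebraicClosure K ≃ₐ[K] AlgebraicClosure K) :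
    geomAlg R ⟶ geomAlg R := CommAlgCat.ofHom (galTensor R γ)

/-- The map `K̄ ⊗ R → K̄ ⊗ S` induced by `R → S`. -/
abbrev geomMap {R S : CommAlgCat.{u} K} (h : R ⟶ S) : geomAlg R ⟶ geomAlg S :=
  CommAlgCat.ofHom (Algebra.TensorProduct.map (AlgHom.id K (AlgebraicClosure K)) h.hom)

theorem geomIncl_comp_geomGal (R : CommAlgCat.{u} K)
    (γ : AlgebraicClosure K ≃ₐ[K] AlgebraicClosure K) :
    geomIncl R ≫ geomGal R γ = geomIncl R :=
  CommAlgCat.hom_ext (galTensor_comp_includeRight R γ)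

theorem geomIncl_comp_geomMap {R S : CommAlgCat.{u} K} (h : R ⟶ S) :
    geomIncl R ≫ geomMap h = h ≫ geomIncl S := by
  ext x
  simp

theorem geomMap_comp_geomHom {R S : CommAlgCat.{u} K} (h : R ⟶ S) :
    (geomMap h).hom.comp (geomHom R) = geomHom S := by
  ext x
  simp

theorem map_geomGal_pushPoint (R : CommAlgCat.{u} K)
    (γ : AlgebraicClosure K ≃ₐ[K] AlgebraicClosure K) :
    ((unitaryGroup K τ (gram m d c)).map (geomGal R γ)).hom (pushPoint g _ (geomHom R)) =
      pushPoint g _ (geomHom R) * pushPoint (g⁻¹ * galAct γ g) _ (geomHom R) := by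
  have h1 : pushPoint (galAct γ g) (geomAlg R) (geomHom R) =
      pushPoint g _ ((geomHom R).comp (γ : AlgebraicClosure K →ₐ[K] AlgebraicClosure K)) :=
    map_pushPoint g (R := algClosure K) (γ : AlgebraicClosure K →ₐ[K] AlgebraicClosure K)
      (CommAlgCat.ofHom (geomHom R))
  have h2 : pushPoint (g⁻¹ * galAct γ g) (geomAlg R) (geomHom R) =
      (pushPoint g _ (geomHom R))⁻¹ * pushPoint (galAct γ g) _ (geomHom R) := by
    simp only [pushPoint, map_mul, map_inv]
  rw [h2, mul_inv_cancel_left, h1, map_pushPoint]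
  congr 1

/-- The Galois action on the standard characters of the diagonal torus. -/
theorem galTensor_glMatrix_of_fixes {γ : AlgebraicClosure K ≃ₐ[K] AlgebraicClosure K}
    (hγ : Fixes E γ) {R : CommAlgCat.{u} K}
    (y : (unitaryGroup K τ (gram m d c)).obj (geomAlg R)) (i : Idx m d) :
    galTensor R γ (glMatrix E.val _ (geomHom R) y i i) = glMatrix E.val _ (geomHom R)
      (((unitaryGroup K τ (gram m d c)).map (geomGal R γ)).hom y) i i := by
  have h1 := glMatrix_map E.val (geomHom R) (geomGal R γ) y i i
  have h2 : (geomGal R γ).hom.comp (geomHom R) =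
      (geomHom R).comp (γ : AlgebraicClosure K →ₐ[K] AlgebraicClosure K) :=
    galTensor_comp_includeLeft R γ
  rw [h2, glMatrix_comp_of_fixes E.val (geomHom R) (fun x => hγ x x.2)] at h1
  exact h1.symm

theorem galTensor_glMatrix_of_not_fixes (hE : Module.finrank K E = 2) (hτ : τ ≠ 1) (hc : c ≠ 0)
    {γ : AlgebraicClosure K ≃ₐ[K] AlgebraicClosure K}
    (hγ : ¬ Fixes E γ) {R : CommAlgCat.{u} K}
    {y : (unitaryGroup K τ (gram m d c)).obj (geomAlg R)}
    (hy : y ∈ (diagonalTorus K τ (gram m d c)).carrier (geomAlg R)) (i : Idx m d) :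
    glMatrix E.val _ (geomHom R) (((unitaryGroup K τ (gram m d c)).map (geomGal R γ)).hom y)
      (negIdx m d i) (negIdx m d i) * galTensor R γ (glMatrix E.val _ (geomHom R) y i i) = 1 := by
  have h1 := glMatrix_map E.val (geomHom R) (geomGal R γ) y i i
  have h2 : (geomGal R γ).hom.comp (geomHom R) =
      (geomHom R).comp (γ : AlgebraicClosure K →ₐ[K] AlgebraicClosure K) :=
    galTensor_comp_includeLeft R γ
  rw [h2] at h1
  have h3 := glMatrix_mul_comp_of_not_fixes E.val (geomHom R) hc
    (apply_of_not_fixes hE hτ hγ) ((diagonalTorus K τ (gram m d c)).map_mem (geomGal R γ) hy) i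
  rw [h1] at h3
  exact h3

variable (hE : Module.finrank K E = 2) (hτ : τ ≠ 1) (hc : c ≠ 0)
  (hT : IsTorus T.toFunctor)
  (hg : ∀ x, x ∈ T.carrier (algClosure K) ↔
      g⁻¹ * x * g ∈ (diagonalTorus K τ (gram m d c)).carrier (algClosure K))

/-- The embedding of a torus into the diagonal torus over `K̄`. -/
def toDiag (R : CommAlgCat.{u} K) :
    T.carrier R →* (diagonalTorus K τ (gram m d c)).carrier (geomAlg R) :=
  ((MulAut.conj (pushPoint g _ (geomHom R))⁻¹).toMonoidHom.comp
    ((((unitaryGroup K τ (gram m d c)).map (geomIncl R)).hom).comp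
      (T.carrier R).subtype)).codRestrict _ fun x => by
    have h1 := (hT.isConjugateBy hE hτ hc E.val hg (geomAlg R) (geomHom R) _).1
      (T.map_mem (geomIncl R) x.2)
    change (pushPoint g _ (geomHom R))⁻¹ * _ * (pushPoint g _ (geomHom R))⁻¹⁻¹ ∈ _
    rw [inv_inv]
    exact h1

theorem coe_toDiag (R : CommAlgCat.{u} K) (x : T.carrier R) :
    (toDiag hE hτ hc hT hg R x).1 = (pushPoint g _ (geomHom R))⁻¹ *
      ((unitaryGroup K τ (gram m d c)).map (geomIncl R)).hom x.1 *
        pushPoint g _ (geomHom R) := by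
  change (pushPoint g _ (geomHom R))⁻¹ * _ * (pushPoint g _ (geomHom R))⁻¹⁻¹ = _
  rw [inv_inv]
  rfl

/-- A point x over R is fixed by γ while γ(g) = gn with n = g⁻¹γ(g), so γ turns g⁻¹xg into its
conjugate by n. This is the twist by the cocycle. -/
theorem map_geomGal_toDiag (R : CommAlgCat.{u} K)
    (γ : AlgebraicClosure K ≃ₐ[K] AlgebraicClosure K) (x : T.carrier R) :
    ((unitaryGroup K τ (gram m d c)).map (geomGal R γ)).hom (toDiag hE hτ hc hT hg R x).1 =
      (pushPoint (g⁻¹ * galAct γ g) _ (geomHom R))⁻¹ * (toDiag hE hτ hc hT hg R x).1 *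
        pushPoint (g⁻¹ * galAct γ g) _ (geomHom R) := by
  have h1 : ((unitaryGroup K τ (gram m d c)).map (geomGal R γ)).hom
      (((unitaryGroup K τ (gram m d c)).map (geomIncl R)).hom x.1) =
      ((unitaryGroup K τ (gram m d c)).map (geomIncl R)).hom x.1 := by
    have h2 := ConcreteCategory.congr_hom
      ((unitaryGroup K τ (gram m d c)).map_comp (geomIncl R) (geomGal R γ)) x.1
    rw [geomIncl_comp_geomGal] at h2
    exact h2.symm
  rw [coe_toDiag, map_mul, map_mul, map_inv, h1, map_geomGal_pushPoint]
  group

variable (hwn : ∀ (k : ℤ) i, (w ^ k) (negIdx m d i) = negIdx m d ((w ^ k) i))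
  (hw : ∀ γ k, IsWeil p f γ k → RepresentsWeyl (g⁻¹ * galAct γ g) (w ^ k))

include hwn hw in
-- Conjugation by the cocycle value permutes the characters by w^k, and the Galois action on S
-- contributes χ_i ↦ -χ_{-i} when γ moves E.
theorem diagHom_toDiag_mem_weilTorus (R : CommAlgCat.{u} K) (x : T.carrier R) :
    diagHom E.val hE hτ hc _ (geomHom R) (toDiag hE hτ hc hT hg R x) ∈
      (weilTorus p E f w).carrier R := by
  rw [mem_weilTorus]
  intro γ k hγ i
  have h1 := (hw γ k hγ).conj_pushPoint hE hτ hc _ (geomHom R) (toDiag hE hτ hc hT hg R x).2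
  rw [← map_geomGal_toDiag] at h1
  refine ⟨fun hγE => Units.ext ?_, fun hγE => ?_⟩
  · rw [coe_galUnits, diagHom_apply, diagHom_apply, galTensor_glMatrix_of_fixes hγE, h1.2]
  · rw [eq_inv_iff_mul_eq_one, mul_comm]
    refine Units.ext ?_
    rw [Units.val_mul, coe_galUnits, diagHom_apply, diagHom_apply, Units.val_one]
    have h2 := galTensor_glMatrix_of_not_fixes hE hτ hc hγE (toDiag hE hτ hc hT hg R x).2 i
    rwa [h1.2, hwn] at h2

theorem toDiag_map {R S : CommAlgCat.{u} K} (h : R ⟶ S) (x : T.carrier R) :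
    (toDiag hE hτ hc hT hg S ⟨_, T.map_mem h x.2⟩).1 =
      ((unitaryGroup K τ (gram m d c)).map (geomMap h)).hom (toDiag hE hτ hc hT hg R x).1 := by
  have h1 : ((unitaryGroup K τ (gram m d c)).map (geomIncl S)).hom
      (((unitaryGroup K τ (gram m d c)).map h).hom x.1) =
      ((unitaryGroup K τ (gram m d c)).map (geomMap h)).hom
        (((unitaryGroup K τ (gram m d c)).map (geomIncl R)).hom x.1) := by
    have h2 := ConcreteCategory.congr_hom
      ((unitaryGroup K τ (gram m d c)).map_comp (geomIncl R) (geomMap h)) x.1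
    rw [geomIncl_comp_geomMap] at h2
    have h3 := ConcreteCategory.congr_hom
      ((unitaryGroup K τ (gram m d c)).map_comp h (geomIncl S)) x.1
    exact h3.symm.trans h2
  rw [coe_toDiag, coe_toDiag, map_mul, map_mul, map_inv, map_pushPoint, geomMap_comp_geomHom,
    ← h1]

/-- The morphism from a torus to the torus described by Galois descent. -/
def toWeilTorus : T.toFunctor ⟶ (weilTorus p E f w).toFunctor where
  app R := GrpCat.ofHom (((diagHom E.val hE hτ hc _ (geomHom R)).comp
    (toDiag hE hτ hc hT hg R)).codRestrict ((weilTorus p E f w).carrier R)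
      (diagHom_toDiag_mem_weilTorus hE hτ hc hT hg hwn hw R))
  naturality {R S} h := by
    refine GrpCat.hom_ext (MonoidHom.ext fun x => Subtype.ext (funext fun i => Units.ext ?_))
    change glMatrix E.val _ (geomHom S) (toDiag hE hτ hc hT hg S ((T.toFunctor.map h).hom x)).1 i i
      = (geomMap h).hom (glMatrix E.val _ (geomHom R) (toDiag hE hτ hc hT hg R x).1 i i)
    have h1 := glMatrix_map E.val (geomHom R) (geomMap h) (toDiag hE hτ hc hT hg R x).1 i i
    rw [geomMap_comp_geomHom] at h1
    exact (congrFun₂ (congrArg (glMatrix E.val _ (geomHom S))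
      (toDiag_map hE hτ hc hT hg h x)) i i).trans h1

theorem toWeilTorus_apply (R : CommAlgCat.{u} K) (x : T.carrier R) (i : Idx m d) :
    (((toWeilTorus hE hτ hc hT hg hwn hw).app R).hom x).1 i =
      diagHom E.val hE hτ hc _ (geomHom R) (toDiag hE hτ hc hT hg R x) i := rfl

theorem toDiag_injective (R : CommAlgCat.{u} K) :
    Function.Injective (toDiag hE hτ hc hT hg R) := by
  intro x y hxy
  have h1 := congrArg Subtype.val hxy
  rw [coe_toDiag, coe_toDiag] at h1
  refine map_includeRight_injective hT.1 R ?_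
  exact Subtype.ext (mul_left_cancel (mul_right_cancel h1))

include hE hτ hc hg hwn hw in
-- The defining conditions of `weilTorus` say exactly that gyg⁻¹ is fixed by all Weil elements;
-- since these have fixed field K, the point descends to T(R).
theorem exists_toDiag_eq (hf : IsFrobenius p f) (R : CommAlgCat.{u} K)
    {y : (unitaryGroup K τ (gram m d c)).obj (geomAlg R)}
    (hy : y ∈ (diagonalTorus K τ (gram m d c)).carrier (geomAlg R))
    (hyw : diagHom E.val hE hτ hc _ (geomHom R) ⟨y, hy⟩ ∈ (weilTorus p E f w).carrier R) :
    ∃ x, (toDiag hE hτ hc hT hg R x).1 = y := by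
  have hX : pushPoint g _ (geomHom R) * y * (pushPoint g _ (geomHom R))⁻¹ ∈
      T.carrier (geomAlg R) := by
    rw [hT.isConjugateBy hE hτ hc E.val hg (geomAlg R) (geomHom R)]
    convert hy using 1
    group
  have hfix : ∀ γ k, IsWeil p f γ k → ((unitaryGroup K τ (gram m d c)).map (geomGal R γ)).hom
      (pushPoint g _ (geomHom R) * y * (pushPoint g _ (geomHom R))⁻¹) =
      pushPoint g _ (geomHom R) * y * (pushPoint g _ (geomHom R))⁻¹ := by
    intro γ k hγ
    have h1 := (hw γ k hγ).conj_pushPoint hE hτ hc _ (geomHom R) hy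
    have h2 : ((unitaryGroup K τ (gram m d c)).map (geomGal R γ)).hom y =
        (pushPoint (g⁻¹ * galAct γ g) _ (geomHom R))⁻¹ * y *
          pushPoint (g⁻¹ * galAct γ g) _ (geomHom R) := by
      -- Both sides are diagonal, so it suffices to compare their characters; if γ moves E, the
      -- condition is used at the index -i.
      refine eq_of_glMatrix_diag_eq E.val (geomHom R) hE hτ hc
        ((diagonalTorus K τ (gram m d c)).map_mem (geomGal R γ) hy) h1.1 fun i => ?_
      by_cases hγE : Fixes E γ
      · rw [h1.2, ← galTensor_glMatrix_of_fixes hγE]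
        exact congrArg Units.val ((mem_weilTorus.1 hyw γ k hγ i).1 hγE)
      · have h3 := galTensor_glMatrix_of_not_fixes hE hτ hc hγE hy (negIdx m d i)
        have h4 := congrArg Units.val ((mem_weilTorus.1 hyw γ k hγ (negIdx m d i)).2 hγE)
        rw [hwn, negIdx_negIdx] at h4
        have h5 : glMatrix E.val _ (geomHom R) y ((w ^ k) i) ((w ^ k) i) *
            ((diagHom E.val hE hτ hc _ (geomHom R) ⟨y, hy⟩ ((w ^ k) i))⁻¹ :
              (AlgebraicClosure K ⊗[K] R)ˣ) = 1 :=
          Units.mul_inv (diagHom E.val hE hτ hc _ (geomHom R) ⟨y, hy⟩ ((w ^ k) i))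
        rw [negIdx_negIdx] at h3
        rw [h1.2]
        refine left_inv_eq_right_inv h3 ((mul_comm _ _).trans ?_)
        rw [← h5]
        congr 1
    rw [map_mul, map_mul, map_inv, h2, map_geomGal_pushPoint]
    group
  obtain ⟨x, hx⟩ : ∃ x : T.carrier R, ((unitaryGroup K τ (gram m d c)).map (geomIncl R)).hom x.1 =
      pushPoint g _ (geomHom R) * y * (pushPoint g _ (geomHom R))⁻¹ := by
    obtain ⟨x, hx⟩ := exists_map_includeRight_eq hT.1 {γ | ∃ k, IsWeil p f γ k}
      (fun x hx => hf.mem_range_of_isWeil_fixed fun γ k h => hx γ ⟨k, h⟩) R ⟨_, hX⟩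
      (fun γ ⟨k, h⟩ => Subtype.ext (hfix γ k h))
    exact ⟨x, congrArg Subtype.val hx⟩
  refine ⟨x, ?_⟩
  rw [coe_toDiag, hx]
  group

/-- A torus is isomorphic to the torus described by Galois descent. -/
theorem toWeilTorus_bijective (hf : IsFrobenius p f) (R : CommAlgCat.{u} K) :
    Function.Bijective ((toWeilTorus hE hτ hc hT hg hwn hw).app R).hom := by
  constructor
  · intro x y hxy
    refine toDiag_injective hE hτ hc hT hg R (Subtype.ext ?_)
    refine eq_of_glMatrix_diag_eq E.val (geomHom R) hE hτ hc (toDiag hE hτ hc hT hg R x).2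
      (toDiag hE hτ hc hT hg R y).2 fun i => ?_
    exact congrArg (fun z => ((z.1 i : (AlgebraicClosure K ⊗[K] R)ˣ) :
      AlgebraicClosure K ⊗[K] R)) hxy
  · rintro ⟨z, hz⟩
    obtain ⟨y, hy, hyz⟩ := exists_glMatrix_eq (τ := τ) (c := c) E.val (geomHom R) hE hτ z
    have h1 : diagHom E.val hE hτ hc _ (geomHom R) ⟨y, hy⟩ = z :=
      funext fun i => Units.ext (hyz i)
    obtain ⟨x, hx⟩ := exists_toDiag_eq hE hτ hc hT hg hwn hw hf R hy (by rwa [h1])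
    refine ⟨x, Subtype.ext (funext fun i => Units.ext ?_)⟩
    rw [toWeilTorus_apply, diagHom_apply, hx]
    exact hyz i

end TorusIso

/-! ### Characters over the base field -/

section OrbitProducts

open Classical in
/-- The product over an orbit of a permutation. -/
def orbitProd {ι M : Type*} [Fintype ι] [CommMonoid M] (w : Equiv.Perm ι) (a : ι) (z : ι → M) : M :=
  ∏ b with w.SameCycle a b, z b

variable {ι M : Type*} [Fintype ι] [CommMonoid M] {w : Equiv.Perm ι}

theorem orbitProd_mul (a : ι) (z z' : ι → M) :
    orbitProd w a (z * z') = orbitProd w a z * orbitProd w a z' :=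
  Finset.prod_mul_distrib

theorem orbitProd_one (a : ι) : orbitProd w a (1 : ι → M) = 1 :=
  Finset.prod_const_one

theorem map_orbitProd {N F : Type*} [CommMonoid N] [FunLike F M N] [MonoidHomClass F M N]
    (h : F) (a : ι) (z : ι → M) : h (orbitProd w a z) = orbitProd w a fun b => h (z b) :=
  map_prod h _ _

theorem orbitProd_zpow (a : ι) (z : ι → M) (k : ℤ) :
    orbitProd w a (fun b => z ((w ^ k) b)) = orbitProd w a z := by
  classical
  refine Finset.prod_equiv (w ^ k) (fun b => ?_) fun b _ => rfl
  simp [Equiv.Perm.sameCycle_zpow_right]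

theorem orbitProd_comp (n : Equiv.Perm ι) (hn : ∀ (k : ℤ) b, (w ^ k) (n b) = n ((w ^ k) b)) (a : ι)
    (z : ι → M) : orbitProd w a (fun b => z (n b)) = orbitProd w (n a) z := by
  classical
  refine Finset.prod_equiv n (fun b => ?_) fun b _ => rfl
  rw [Finset.mem_filter, Finset.mem_filter]
  simp only [Finset.mem_univ, true_and, Equiv.Perm.SameCycle, hn, EmbeddingLike.apply_eq_iff_eq]

theorem orbitProd_mulSingle [DecidableEq ι] (a b : ι) (u : M) (h : w.SameCycle a b) :
    orbitProd w a (Pi.mulSingle b u) = u := by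
  classical
  rw [orbitProd, Finset.prod_eq_single b, Pi.mulSingle_eq_same]
  · intro i _ hi
    rw [Pi.mulSingle_eq_of_ne hi]
  · intro hb
    exact absurd (by simpa using h) hb

theorem orbitProd_mulSingle_of_not [DecidableEq ι] (a b : ι) (u : M) (h : ¬ w.SameCycle a b) :
    orbitProd w a (Pi.mulSingle b u) = 1 := by
  classical
  refine Finset.prod_eq_one fun i hi => Pi.mulSingle_eq_of_ne ?_ _
  rintro rfl
  exact h (by simpa using hi)

end OrbitProducts

/-! ### Anisotropy and orbits stable under negation -/

section Characters

variable {p : ℕ} [Fact p.Prime] {K : Type u} [Field K] [Algebra ℚ_[p] K]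
  [FiniteDimensional ℚ_[p] K] [CharZero K] {E : IntermediateField K (AlgebraicClosure K)}
  {m d : ℕ} {f : AlgebraicClosure K ≃ₐ[K] AlgebraicClosure K} {w : Equiv.Perm (Idx m d)}

/-- The inclusion of the units of `R` into those of `K̄ ⊗ R`. -/
def unitsIncl (R : Type u) [CommRing R] [Algebra K R] : Rˣ →* (AlgebraicClosure K ⊗[K] R)ˣ :=
  Units.map ((Algebra.TensorProduct.includeRight : R →ₐ[K] AlgebraicClosure K ⊗[K] R) : _ →* _)

theorem unitsIncl_injective (R : Type u) [CommRing R] [Algebra K R] :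
    Function.Injective (unitsIncl (K := K) R) :=
  Units.map_injective includeRight_injective_closure

theorem mem_range_unitsIncl (hf : IsFrobenius p f) {R : Type u} [CommRing R] [Algebra K R]
    {u : (AlgebraicClosure K ⊗[K] R)ˣ} (hu : ∀ γ k, IsWeil p f γ k → galUnits R γ u = u) :
    u ∈ (unitsIncl (K := K) R).range := by
  have h : ∀ v : (AlgebraicClosure K ⊗[K] R)ˣ, (∀ γ k, IsWeil p f γ k → galUnits R γ v = v) →
      ∃ r : R, (1 : AlgebraicClosure K) ⊗ₜ[K] r = (v : AlgebraicClosure K ⊗[K] R) := fun v hv =>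
    mem_range_includeRight_of_galTensor_fixed {γ | ∃ k, IsWeil p f γ k}
      (fun x hx => hf.mem_range_of_isWeil_fixed fun γ k h => hx γ ⟨k, h⟩)
      (fun γ ⟨k, h⟩ => congrArg Units.val (hv γ k h))
  obtain ⟨r, hr⟩ := h u hu
  obtain ⟨s, hs⟩ := h u⁻¹ fun γ k hγ => by rw [map_inv, hu γ k hγ]
  have hrs : r * s = 1 := by
    apply includeRight_injective_closure (K := K)
    rw [map_mul, map_one, Algebra.TensorProduct.includeRight_apply,
      Algebra.TensorProduct.includeRight_apply, hr, hs, Units.mul_inv]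
  exact ⟨⟨r, s, hrs, (mul_comm _ _).trans hrs⟩, Units.ext hr⟩

/-- The product of the characters in an orbit, divided by the product of those in the opposite
orbit. -/
def orbitUnit (w : Equiv.Perm (Idx m d)) (a : Idx m d) (M : Type*) [CommGroup M] :
    (Idx m d → M) →* M where
  toFun z := orbitProd w a z / orbitProd w (negIdx m d a) z
  map_one' := by rw [orbitProd_one, orbitProd_one, div_one]
  map_mul' x y := by rw [orbitProd_mul, orbitProd_mul, mul_div_mul_comm]

theorem orbitUnit_apply (a : Idx m d) {M : Type*} [CommGroup M] (z : Idx m d → M) :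
    orbitUnit w a M z = orbitProd w a z / orbitProd w (negIdx m d a) z := rfl

/-- A Weil element that fixes E permutes each orbit. One that moves E exchanges the two orbit
products and inverts both, which leaves their quotient unchanged. -/
theorem galUnits_orbitUnit (hwn : ∀ (k : ℤ) i, (w ^ k) (negIdx m d i) = negIdx m d ((w ^ k) i))
    (a : Idx m d) {R : CommAlgCat.{u} K} {z : Idx m d → (AlgebraicClosure K ⊗[K] R)ˣ}
    (hz : z ∈ (weilTorus p E f w).carrier R) {γ : AlgebraicClosure K ≃ₐ[K] AlgebraicClosure K}
    {k : ℤ} (hγ : IsWeil p f γ k) :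
    galUnits R γ (orbitUnit w a _ z) = orbitUnit w a _ z := by
  rw [orbitUnit_apply, map_div, map_orbitProd, map_orbitProd]
  by_cases hγE : Fixes E γ
  · simp only [((mem_weilTorus.1 hz) γ k hγ _).1 hγE, orbitProd_zpow]
  · have h : ∀ b, orbitProd w b (fun i => galUnits R γ (z i)) =
        (orbitProd w (negIdx m d b) z)⁻¹ := by
      intro b
      simp only [((mem_weilTorus.1 hz) γ k hγ _).2 hγE]
      rw [orbitProd_zpow (w := w) b (fun i => (z (negIdx m d i))⁻¹) k,
        orbitProd_comp (negIdx m d) hwn b fun i => (z i)⁻¹]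
      exact Finset.prod_inv_distrib _
    rw [h, h, negIdx_negIdx, inv_div_inv]

/-- The character of the torus over the base field given by an orbit. -/
def orbitChar (hf : IsFrobenius p f)
    (hwn : ∀ (k : ℤ) i, (w ^ k) (negIdx m d i) = negIdx m d ((w ^ k) i)) (a : Idx m d) :
    (weilTorus p E f w).toFunctor ⟶ Gm K where
  app R := GrpCat.ofHom <| (MonoidHom.ofInjective (unitsIncl_injective (K := K) R)).symm.toMonoidHom.comp
    (((orbitUnit w a (AlgebraicClosure K ⊗[K] R)ˣ).comp
      ((weilTorus p E f w).carrier R).subtype).codRestrict _ fun z =>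
        mem_range_unitsIncl hf fun γ k hγ => galUnits_orbitUnit hwn a z.2 hγ)
  naturality {R S} h := by
    refine GrpCat.hom_ext (MonoidHom.ext fun z => ?_)
    have hR : ∀ (R : CommAlgCat.{u} K) (y : (unitsIncl (K := K) R).range), unitsIncl (K := K) R
        ((MonoidHom.ofInjective (unitsIncl_injective (K := K) R)).symm y) = y := by
      intro R y
      exact congrArg Subtype.val
        ((MonoidHom.ofInjective (unitsIncl_injective (K := K) R)).apply_symm_apply y)
    apply unitsIncl_injective (K := K)
    refine (hR S _).trans ?_
    have h1 : ∀ r : Rˣ, unitsIncl (K := K) S (Units.map (h.hom : R →* S) r) =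
        Units.map (Algebra.TensorProduct.map (AlgHom.id K (AlgebraicClosure K)) h.hom :
          AlgebraicClosure K ⊗[K] R →* AlgebraicClosure K ⊗[K] S) (unitsIncl (K := K) R r) :=
      fun r => Units.ext (by
        change (1 : AlgebraicClosure K) ⊗ₜ[K] h.hom r = Algebra.TensorProduct.map
          (AlgHom.id K (AlgebraicClosure K)) h.hom (1 ⊗ₜ[K] (r : R))
        rw [Algebra.TensorProduct.map_tmul, map_one])
    refine Eq.trans ?_ (h1 _).symm
    refine Eq.trans ?_ (congrArg _ (hR R _)).symm
    refine Eq.trans ?_ (map_div _ _ _).symm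
    rw [map_orbitProd, map_orbitProd]
    rfl

theorem unitsIncl_orbitChar (hf : IsFrobenius p f)
    (hwn : ∀ (k : ℤ) i, (w ^ k) (negIdx m d i) = negIdx m d ((w ^ k) i)) (a : Idx m d)
    (R : CommAlgCat.{u} K) (z : (weilTorus p E f w).carrier R) :
    unitsIncl (K := K) R (((orbitChar hf hwn a).app R).hom z) = orbitUnit w a _ z.1 :=
  congrArg Subtype.val
    ((MonoidHom.ofInjective (unitsIncl_injective (K := K) R)).apply_symm_apply _)

variable {τ : E ≃ₐ[K] E} {c : E} {g : (unitaryGroup K τ (gram m d c)).obj (algClosure K)}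
  {T : SubgroupFunctor (unitaryGroup K τ (gram m d c))}
  (hE : Module.finrank K E = 2) (hτ : τ ≠ 1) (hc : c ≠ 0)
  (hT : IsTorus T.toFunctor)
  (hg : ∀ x, x ∈ T.carrier (algClosure K) ↔
      g⁻¹ * x * g ∈ (diagonalTorus K τ (gram m d c)).carrier (algClosure K))

variable (K) in
/-- The multiplication of `K̄` on units. -/
def unitsMul : (AlgebraicClosure K ⊗[K] AlgebraicClosure K)ˣ →* (AlgebraicClosure K)ˣ :=
  Units.map (Algebra.TensorProduct.lmul' K (S := AlgebraicClosure K) : _ →* _)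

/-- Composing with the multiplication K̄ ⊗ K̄ → K̄ turns `toDiag` back into x ↦ g⁻¹xg on K̄-points.
So x = gyg⁻¹ works, with y the diagonal point having coordinates t. -/
theorem exists_lmul_toDiag (t : Idx m d → (AlgebraicClosure K)ˣ) :
    ∃ x : T.carrier (algClosure K), ∀ i,
      unitsMul K (diagHom E.val hE hτ hc _ (geomHom _) (toDiag hE hτ hc hT hg (algClosure K) x) i) = t i := by
  obtain ⟨y, hy, hyt⟩ := exists_glMatrix_eq (τ := τ) (c := c) E.val (R := algClosure K)
    (AlgHom.id K _) hE hτ t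
  have hx : g * y * g⁻¹ ∈ T.carrier (algClosure K) := by
    rw [hg]
    convert hy using 1
    group
  refine ⟨⟨_, hx⟩, fun i => Units.ext ?_⟩
  let μ : geomAlg (algClosure K) ⟶ algClosure K :=
    CommAlgCat.ofHom (Algebra.TensorProduct.lmul' K (S := AlgebraicClosure K))
  have hμ1 : μ.hom.comp (geomHom (algClosure K)) = AlgHom.id K _ := by
    ext x
    simp [μ]
  have hμ2 : geomIncl (algClosure K) ≫ μ = 𝟙 _ := by
    ext x
    simp [μ]
  have h1 := glMatrix_map E.val (geomHom (algClosure K)) μ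
    (toDiag hE hτ hc hT hg (algClosure K) ⟨_, hx⟩).1 i i
  have h2 : ((unitaryGroup K τ (gram m d c)).map μ).hom (pushPoint g _ (geomHom _)) = g := by
    rw [map_pushPoint, hμ1]
    exact ConcreteCategory.congr_hom ((unitaryGroup K τ (gram m d c)).map_id (algClosure K)) g
  have h3 : ((unitaryGroup K τ (gram m d c)).map μ).hom
      (((unitaryGroup K τ (gram m d c)).map (geomIncl _)).hom (g * y * g⁻¹)) = g * y * g⁻¹ := by
    have h4 := ConcreteCategory.congr_hom
      ((unitaryGroup K τ (gram m d c)).map_comp (geomIncl (algClosure K)) μ) (g * y * g⁻¹)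
    rw [hμ2] at h4
    refine h4.symm.trans ?_
    exact ConcreteCategory.congr_hom ((unitaryGroup K τ (gram m d c)).map_id (algClosure K)) _
  have h6 : ((unitaryGroup K τ (gram m d c)).map μ).hom
      (toDiag hE hτ hc hT hg (algClosure K) ⟨_, hx⟩).1 = y := by
    rw [coe_toDiag, map_mul, map_mul, map_inv, h2, h3]
    group
  rw [h6, hμ1, hyt] at h1
  exact h1.symm

include hE hτ hc hT hg in
/-- If the torus is anisotropic, then all orbits of `w` are stable under `χ_i ↦ χ_{-i}`. -/
theorem exists_zpow_eq_neg (hf : IsFrobenius p f)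
    (hwn : ∀ (k : ℤ) i, (w ^ k) (negIdx m d i) = negIdx m d ((w ^ k) i))
    (hw : ∀ γ k, IsWeil p f γ k → RepresentsWeyl (g⁻¹ * galAct γ g) (w ^ k))
    (hani : IsAnisotropic T.toFunctor) (a : Idx m d) : ∃ k : ℤ, (w ^ k) a = negIdx m d a := by
  by_contra! hcon
  have hnot : ¬ w.SameCycle (negIdx m d a) a := fun ⟨k, hk⟩ => hcon (-k) (by
    rw [← hk, ← Equiv.Perm.mul_apply, ← zpow_add, neg_add_cancel, zpow_zero, hk]
    rfl)
  -- At this point χ_a is 2 and all other χ_i are 1. As a is not in the orbit of -a, the denominator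
  -- of the orbit character is 1 and its value is 2, so it is nontrivial.
  obtain ⟨x, hx⟩ := exists_lmul_toDiag hE hτ hc hT hg
    (Pi.mulSingle a (Units.mk0 (2 : AlgebraicClosure K) two_ne_zero))
  have h1 := hani (toWeilTorus hE hτ hc hT hg hwn hw ≫ orbitChar hf hwn a) (algClosure K) x
  have h2 := unitsIncl_orbitChar (E := E) hf hwn a (algClosure K)
    (((toWeilTorus hE hτ hc hT hg hwn hw).app (algClosure K)).hom x)
  have h3 : orbitUnit w a _
      (diagHom E.val hE hτ hc _ (geomHom _) (toDiag hE hτ hc hT hg (algClosure K) x)) = 1 :=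
    h2.symm.trans ((congrArg _ h1).trans (map_one _))
  have h4 := congrArg
    (unitsMul K) h3
  rw [orbitUnit_apply, map_div, map_orbitProd, map_orbitProd, map_one] at h4
  simp only [hx] at h4
  rw [orbitProd_mulSingle a a _ (Equiv.Perm.SameCycle.refl _ _),
    orbitProd_mulSingle_of_not _ _ _ hnot, div_one] at h4
  have h5 := congrArg Units.val h4
  simp only [Units.val_mk0, Units.val_one] at h5
  norm_num at h5

end Characters

/-! ### Signed cycles -/

section SignedCycles

variable {m d : ℕ} (w : weylInertia m d)

theorem zpow_negIdx (k : ℤ) (i : Idx m d) :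
    ((w : Equiv.Perm (Idx m d)) ^ k) (negIdx m d i) =
      negIdx m d (((w : Equiv.Perm (Idx m d)) ^ k) i) := by
  have h : Commute (negIdx m d) (w : Equiv.Perm (Idx m d)) :=
    Subgroup.mem_centralizer_iff.1 w.2 _ rfl
  exact (DFunLike.congr_fun (h.zpow_right k).eq i).symm

@[simp]
theorem negIdx_inl (i : Fin m) (ε : ℤˣ) :
    negIdx m d (Sum.inl (i, ε)) = Sum.inl (i, -ε) := rfl

variable {w} (hneg : ∀ i : Fin m, ∃ k : ℤ,
  ((w : Equiv.Perm (Idx m d)) ^ k) (Sum.inl (i, 1)) = Sum.inl (i, -1))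

include hneg in
-- Some power of w changes the sign of χ_i, so within a signed cycle either sign can be reached: the
-- cycle corresponds to a single orbit of w on the χ_{±i}.
theorem exists_zpow_eq_inl_iff {i i' : Fin m} (ε : ℤˣ) :
    (∃ k : ℤ, ((w : Equiv.Perm (Idx m d)) ^ k) (Sum.inl (i, 1)) = Sum.inl (i', ε)) ↔
      Quotient.mk (signedCycleSetoid w) i' = Quotient.mk (signedCycleSetoid w) i := by
  rw [eq_comm, Quotient.eq]
  constructor
  · rintro ⟨k, hk⟩
    exact ⟨k, ε, hk⟩
  · rintro ⟨k, δ, hk⟩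
    obtain ⟨l, hl⟩ := hneg i
    by_cases h : δ = ε
    · exact ⟨k, h ▸ hk⟩
    · refine ⟨k + l, ?_⟩
      have hδ : ε = -δ := by
        rcases Int.units_eq_one_or ε with rfl | rfl <;> rcases Int.units_eq_one_or δ with rfl | rfl
        · exact absurd rfl h
        · simp
        · simp
        · exact absurd rfl h
      rw [zpow_add, Equiv.Perm.mul_apply, hl, ← negIdx_inl i 1, zpow_negIdx, hk, negIdx_inl, hδ]

include hneg in
-- The orbit of χ_i consists of both signs of all indices in the signed cycle, so it has twice as
-- many elements as the cycle.
theorem zpow_eq_self_iff {i : Fin m} {C : SignedCycle w}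
    (hi : Quotient.mk (signedCycleSetoid w) i = C) (k : ℤ) :
    ((w : Equiv.Perm (Idx m d)) ^ k) (Sum.inl (i, 1)) = Sum.inl (i, 1) ↔
      ((2 * C.length : ℕ) : ℤ) ∣ k := by
  classical
  let σ : Equiv.Perm (Idx m d) := w.1
  let j : Idx m d := Sum.inl (i, 1)
  let F : {i' : Fin m // Quotient.mk (signedCycleSetoid w) i' = C} × ℤˣ →
      MulAction.orbit (Subgroup.zpowers σ) j := fun x => ⟨Sum.inl (x.1.1, x.2), by
    obtain ⟨k, hk⟩ := (exists_zpow_eq_inl_iff hneg x.2).2 (x.1.2.trans hi.symm)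
    exact ⟨⟨σ ^ k, k, rfl⟩, hk⟩⟩
  have hF : Function.Bijective F := by
    constructor
    · rintro ⟨⟨a, ha⟩, ε⟩ ⟨⟨b, hb⟩, δ⟩ h
      simpa [F] using h
    · rintro ⟨x, ⟨_, l, rfl⟩, hl⟩
      have hl' : (σ ^ l) j = x := hl
      rcases x with ⟨a, ε⟩ | a
      · exact ⟨(⟨a, ((exists_zpow_eq_inl_iff hneg ε).1 ⟨l, hl'⟩).trans hi⟩, ε), rfl⟩
      -- An index of the form `inr` is its own negative; w commutes with negation, so such an index
      -- is not in the orbit of χ_i.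
      · exfalso
        have h1 : negIdx m d ((σ ^ l) j) = (σ ^ l) j := by
          rw [hl']
          rfl
        have h2 := (σ ^ l).injective ((zpow_negIdx w l j).trans h1)
        simp [j] at h2
  have hcard : Function.minimalPeriod (σ • · : Idx m d → Idx m d) j = 2 * C.length := by
    rw [MulAction.minimalPeriod_eq_card, ← Nat.card_eq_fintype_card, ← Nat.card_eq_of_bijective F hF,
      Nat.card_prod, SignedCycle.length, mul_comm]
    congr 1
    rw [Nat.card_eq_fintype_card]
    rfl
  rw [← hcard, ← MulAction.zpow_smul_eq_iff_minimalPeriod_dvd]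
  rfl

include hneg in
-- If w^t sends χ_i to χ_{-i}, then 2t is a multiple of the orbit size 2r but t is not. Hence t ≡ r
-- mod 2r, and w^r has the same effect.
theorem zpow_length_eq {i : Fin m} {C : SignedCycle w}
    (hi : Quotient.mk (signedCycleSetoid w) i = C) :
    ((w : Equiv.Perm (Idx m d)) ^ (C.length : ℤ)) (Sum.inl (i, 1)) = Sum.inl (i, -1) := by
  obtain ⟨t, ht⟩ := hneg i
  have h2 : ((w : Equiv.Perm (Idx m d)) ^ (t + t)) (Sum.inl (i, 1)) = Sum.inl (i, 1) := by
    rw [zpow_add, Equiv.Perm.mul_apply, ht]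
    have := zpow_negIdx w t (Sum.inl (i, 1))
    rw [ht] at this
    simpa using this
  rw [zpow_eq_self_iff hneg hi] at h2
  have h3 : ¬ ((2 * C.length : ℕ) : ℤ) ∣ t := by
    rw [← zpow_eq_self_iff hneg hi, ht]
    simp
  have h4 : ((2 * C.length : ℕ) : ℤ) ∣ C.length - t := by
    push_cast at h2 h3 ⊢
    obtain ⟨q, hq⟩ := h2
    have hq' : t = C.length * q := by linarith
    rcases Int.even_or_odd' q with ⟨u, rfl | rfl⟩
    · exact absurd ⟨u, by rw [hq']; ring⟩ h3
    · exact ⟨-u, by rw [hq']; ring⟩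
  rw [← zpow_eq_self_iff hneg hi] at h4
  have h5 : (C.length : ℤ) = t + (C.length - t) := by ring
  rw [h5, zpow_add, Equiv.Perm.mul_apply, h4, ht]

include hneg in
theorem SignedCycle.isNegative (C : SignedCycle w) : C.IsNegative := fun i hi => by
  have := zpow_length_eq hneg hi
  rwa [zpow_natCast] at this

theorem SignedCycle.length_ne_zero (C : SignedCycle w) : C.length ≠ 0 := by
  obtain ⟨i, hi⟩ := Quotient.exists_rep C
  have : Nonempty {i : Fin m // Quotient.mk (signedCycleSetoid w) i = C} := ⟨⟨i, hi⟩⟩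
  exact Nat.card_pos.ne'

end SignedCycles

/-! ### Decomposition into norm tori -/

section NormTorus

variable {K : Type u} [Field K]
  (p : ℕ) [Fact p.Prime] [Algebra ℚ_[p] K] [FiniteDimensional ℚ_[p] K] [CharZero K]
  (E : IntermediateField K (AlgebraicClosure K))
  (f : AlgebraicClosure K ≃ₐ[K] AlgebraicClosure K) {m d : ℕ}

/-- The elements of `K̄ ⊗ R` fixed by the Weil elements of degree divisible by `s` that are trivial
on `E` and inverted by those of degree congruent to `r` that are nontrivial on `E`. -/
def normTorus (s r : ℕ) : SubgroupFunctor (weilRestriction K (Gm (AlgebraicClosure K))) where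
  carrier R :=
    { carrier := {z : (AlgebraicClosure K ⊗[K] R)ˣ | ∀ γ k, IsWeil p f γ k →
        (Fixes E γ → (s : ℤ) ∣ k → galUnits R γ z = z) ∧
        (¬ Fixes E γ → (s : ℤ) ∣ k - r → galUnits R γ z = z⁻¹)}
      one_mem' := fun γ k _ => ⟨fun _ _ => map_one _, fun _ _ => (map_one _).trans inv_one.symm⟩
      mul_mem' := fun {x y} hx hy γ k h =>
        ⟨fun hγ hk => (map_mul _ _ _).trans
          (congrArg₂ (· * ·) ((hx γ k h).1 hγ hk) ((hy γ k h).1 hγ hk)),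
        fun hγ hk => (map_mul _ _ _).trans <|
          (congrArg₂ (· * ·) ((hx γ k h).2 hγ hk) ((hy γ k h).2 hγ hk)).trans (mul_inv _ _).symm⟩
      inv_mem' := fun {x} hx γ k h =>
        ⟨fun hγ hk => (map_inv _ _).trans (congrArg (·⁻¹) ((hx γ k h).1 hγ hk)),
        fun hγ hk => (map_inv _ _).trans (congrArg (·⁻¹) ((hx γ k h).2 hγ hk))⟩ }
  map_mem {R S} h z hz γ k hγ :=
    ⟨fun hE hk => (galUnits_map h.hom γ _).symm.trans (congrArg _ ((hz γ k hγ).1 hE hk)),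
      fun hE hk => (galUnits_map h.hom γ _).symm.trans
        ((congrArg _ ((hz γ k hγ).2 hE hk)).trans (map_inv _ _))⟩

variable {p E f}

theorem mem_normTorus {s r : ℕ} {R : CommAlgCat.{u} K} {z : (AlgebraicClosure K ⊗[K] R)ˣ} :
    z ∈ (normTorus p E f s r).carrier R ↔ ∀ γ k, IsWeil p f γ k →
        (Fixes E γ → (s : ℤ) ∣ k → galUnits R γ z = z) ∧
        (¬ Fixes E γ → (s : ℤ) ∣ k - r → galUnits R γ z = z⁻¹) := Iff.rfl

variable {w : Equiv.Perm (Idx m d)} {P : Type} {b : P → Idx m d} {s r : P → ℕ}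

/-- The evaluation at a base point of an orbit. -/
def evalOrbit (hb : ∀ i (k : ℤ), (w ^ k) (b i) = b i ↔ (s i : ℤ) ∣ k)
    (hr : ∀ i, (w ^ (r i : ℤ)) (b i) = negIdx m d (b i)) :
    (weilTorus p E f w).toFunctor ⟶
      piFunctor fun i => (normTorus p E f (s i) (r i)).toFunctor where
  app R := GrpCat.ofHom <| MonoidHom.pi fun i =>
    (((Pi.evalMonoidHom (fun _ : Idx m d => (AlgebraicClosure K ⊗[K] R)ˣ) (b i)).comp
      ((weilTorus p E f w).carrier R).subtype).codRestrict
        ((normTorus p E f (s i) (r i)).carrier R) fun z => by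
      refine mem_normTorus.2 fun γ k hγ => ?_
      have h := mem_weilTorus.1 z.2 γ k hγ (b i)
      refine ⟨fun hγE hk => ?_, fun hγE hk => ?_⟩
      · rw [← hb] at hk
        have h1 := h.1 hγE
        rw [hk] at h1
        exact h1
      · have h1 := h.2 hγE
        have h2 : (w ^ k) (b i) = negIdx m d (b i) := by
          rw [← hb] at hk
          rw [← hr, ← sub_add_cancel k (r i : ℤ), add_comm, zpow_add, Equiv.Perm.mul_apply, hk]
        rw [h2, negIdx_negIdx] at h1
        exact h1)
  naturality {R S} h := rfl

/-- The powers of f fix E and give z(w^l b) = f^l z(b), so values at base points determine z.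
Conversely this formula defines z, and the conditions of the norm tori make it well defined and
compatible with all Weil elements. This is the torus counterpart of an induced lattice. -/
theorem evalOrbit_bijective (hfE : Fixes E f)
    (hwn : ∀ (k : ℤ) i, (w ^ k) (negIdx m d i) = negIdx m d ((w ^ k) i))
    (hE : Module.finrank K E = 2)
    (hb : ∀ i (k : ℤ), (w ^ k) (b i) = b i ↔ (s i : ℤ) ∣ k)
    (hr : ∀ i, (w ^ (r i : ℤ)) (b i) = negIdx m d (b i))
    (hcov : ∀ a, ∃ i, ∃ k : ℤ, (w ^ k) (b i) = a)
    (huniq : ∀ i i' (k : ℤ), (w ^ k) (b i) = b i' → i = i') (R : CommAlgCat.{u} K) :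
    Function.Bijective ((evalOrbit (p := p) (E := E) (f := f) hb hr).app R).hom := by
  have hfk : ∀ k : ℤ, Fixes E (f ^ k) := fun k => hfE.zpow k
  constructor
  · rintro ⟨z, hz⟩ ⟨z', hz'⟩ h
    refine Subtype.ext (funext fun a => ?_)
    obtain ⟨i, k, rfl⟩ := hcov a
    have h1 : z (b i) = z' (b i) := congrArg Subtype.val (congrFun h i)
    have h2 := (mem_weilTorus.1 hz _ k (isWeil_zpow f k) (b i)).1 (hfk k)
    have h3 := (mem_weilTorus.1 hz' _ k (isWeil_zpow f k) (b i)).1 (hfk k)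
    exact h2.symm.trans ((congrArg _ h1).trans h3)
  · intro u
    choose I k hk using hcov
    let v : P → (AlgebraicClosure K ⊗[K] R)ˣ := fun i => (u i).1
    have hv : ∀ i, v i ∈ (normTorus p E f (s i) (r i)).carrier R := fun i => (u i).2
    let z : Idx m d → (AlgebraicClosure K ⊗[K] R)ˣ := fun a => galUnits R (f ^ k a) (v (I a))
    -- The value does not depend on the chosen exponent, since two exponents differ by a multiple of
    -- s and f^s fixes v_i.
    have hzk : ∀ i (l : ℤ), z ((w ^ l) (b i)) = galUnits R (f ^ l) (v i) := by
      intro i l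
      have h1 : I ((w ^ l) (b i)) = i := by
        refine huniq _ _ (-l + k ((w ^ l) (b i))) ?_
        rw [zpow_add, Equiv.Perm.mul_apply, hk, ← Equiv.Perm.mul_apply, ← zpow_add,
          neg_add_cancel, zpow_zero]
        rfl
      have h2 := hk ((w ^ l) (b i))
      change galUnits R (f ^ k ((w ^ l) (b i))) (v (I ((w ^ l) (b i)))) = _
      rw [h1] at h2 ⊢
      have h3 : (w ^ (-l + k ((w ^ l) (b i)))) (b i) = b i := by
        rw [zpow_add, Equiv.Perm.mul_apply, h2, ← Equiv.Perm.mul_apply, ← zpow_add,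
          neg_add_cancel, zpow_zero]
        rfl
      have h4 := ((mem_normTorus.1 (hv i)) _ _ (isWeil_zpow f _)).1 (hfk _) ((hb i _).1 h3)
      conv_rhs => rw [← h4, ← galUnits_mul, ← zpow_add, add_neg_cancel_left]
    have hz : z ∈ (weilTorus p E f w).carrier R := by
      rw [mem_weilTorus]
      intro γ l hγ a
      obtain ⟨i, n, rfl⟩ : ∃ i, ∃ n : ℤ, (w ^ n) (b i) = a := ⟨I a, k a, hk a⟩
      rw [← Equiv.Perm.mul_apply, ← zpow_add, hzk]
      constructor
      · intro hγE
        -- This product has degree 0 and fixes E, so it fixes v_i; hence γ f^n and f^(l+n) agree on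
        -- v_i.
        have h1 : Fixes E (f ^ (-(l + n)) * γ * f ^ n) := by
          rw [fixes_mul_iff_right (hfk n), fixes_mul_iff (hfk _)]
          exact hγE
        have h2 := ((mem_normTorus.1 (hv i)) _ _ (((isWeil_zpow f (-(l + n))).mul hγ).mul
          (isWeil_zpow f n))).1 h1 (by simp)
        rw [hzk, ← galUnits_mul]
        conv_rhs => rw [← h2, ← galUnits_mul]
        congr 2
        rw [← mul_assoc, ← mul_assoc, ← zpow_add, add_neg_cancel, zpow_zero, one_mul]
      · intro hγE
        -- The exponent is shifted by r so that the product has degree exactly r and inverts v_i.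
        have h1 : ¬ Fixes E (f ^ (-(l + n) + r i) * γ * f ^ n) := by
          rw [fixes_mul_iff_right (hfk n), fixes_mul_iff (hfk _)]
          exact hγE
        have h2 := ((mem_normTorus.1 (hv i)) _ _ (((isWeil_zpow f (-(l + n) + r i)).mul hγ).mul
          (isWeil_zpow f n))).2 h1 (by
            have : -(l + n) + (r i : ℤ) + l + n - r i = 0 := by ring
            rw [this]
            exact dvd_zero _)
        -- Since w^r negates b_i, negation is traded for a shift of the exponent by r.
        have h3 : negIdx m d ((w ^ (l + n)) (b i)) = (w ^ (l + n - r i)) (b i) := by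
          have h4 : b i = (w ^ (r i : ℤ)) (negIdx m d (b i)) := by
            rw [hwn, hr, negIdx_negIdx]
          rw [← hwn]
          conv_rhs => rw [h4, ← Equiv.Perm.mul_apply, ← zpow_add, sub_add_cancel]
        rw [h3, hzk, ← galUnits_mul, ← map_inv, ← h2, ← galUnits_mul]
        congr 2
        rw [← mul_assoc, ← mul_assoc, ← zpow_add,
          show l + n - (r i : ℤ) + (-(l + n) + r i) = 0 by ring, zpow_zero, one_mul]
    refine ⟨⟨z, hz⟩, funext fun i => Subtype.ext ?_⟩
    change z (b i) = v i
    have h5 := hzk i 0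
    rw [zpow_zero, zpow_zero, galUnits_one] at h5
    exact h5

end NormTorus

/-! ### Norm-one groups of quadratic extensions -/

section QuadraticNorm

variable {F Q A : Type u} [Field F] [Field Q] [Algebra F Q] [CommRing A] [Algebra F A]
  {e : Q} {δ : F}

/-- The basis `1, e` of a quadratic extension. -/
def quadraticBasis (he : ∀ x : F, algebraMap F Q x ≠ e)
    (hspan : ∀ x : Q, ∃ a b : F, x = algebraMap F Q a + algebraMap F Q b * e) :
    Module.Basis (Fin 2) F Q :=
  Module.Basis.mk (v := ![1, e])
    (LinearIndependent.pair_iff.2 fun a b hab => by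
      have hb : b = 0 := by
        by_contra hb
        refine he (-a / b) ?_
        have hb' : algebraMap F Q b ≠ 0 := by simpa using hb
        rw [Algebra.smul_def, Algebra.smul_def] at hab
        rw [map_div₀, map_neg, div_eq_iff hb']
        linear_combination -hab
      subst hb
      simpa using hab)
    (fun x _ => by
      obtain ⟨a, b, rfl⟩ := hspan x
      rw [Submodule.mem_span_range_iff_exists_fun]
      exact ⟨![a, b], by simp [Fin.sum_univ_two, Algebra.smul_def]⟩)

theorem quadraticBasis_zero (he : ∀ x : F, algebraMap F Q x ≠ e)
    (hspan : ∀ x : Q, ∃ a b : F, x = algebraMap F Q a + algebraMap F Q b * e) :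
    quadraticBasis he hspan 0 = 1 := by
  simp [quadraticBasis]

theorem quadraticBasis_one (he : ∀ x : F, algebraMap F Q x ≠ e)
    (hspan : ∀ x : Q, ∃ a b : F, x = algebraMap F Q a + algebraMap F Q b * e) :
    quadraticBasis he hspan 1 = e := by
  simp [quadraticBasis]

theorem exists_eq_tmul_one_add_tmul
    (hspan : ∀ x : Q, ∃ a b : F, x = algebraMap F Q a + algebraMap F Q b * e) (x : A ⊗[F] Q) :
    ∃ a b : A, x = a ⊗ₜ 1 + b ⊗ₜ e := by
  induction x with
  | zero => exact ⟨0, 0, by simp⟩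
  | add y z hy hz =>
    obtain ⟨a, b, rfl⟩ := hy
    obtain ⟨a', b', rfl⟩ := hz
    exact ⟨a + a', b + b', by simp only [TensorProduct.add_tmul]; abel⟩
  | tmul r x =>
    obtain ⟨a, b, rfl⟩ := hspan x
    refine ⟨a • r, b • r, ?_⟩
    rw [TensorProduct.tmul_add, ← Algebra.smul_def, Algebra.algebraMap_eq_smul_one,
      TensorProduct.smul_tmul, TensorProduct.smul_tmul]

/-- In the basis 1, e multiplication by a + be has diagonal entries a and off-diagonal entries b and
δb. -/
theorem norm_tmul_one_add_tmul (he : ∀ x : F, algebraMap F Q x ≠ e)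
    (hspan : ∀ x : Q, ∃ a b : F, x = algebraMap F Q a + algebraMap F Q b * e)
    (hδ : e * e = algebraMap F Q δ) (a b : A) :
    Algebra.norm A (a ⊗ₜ[F] (1 : Q) + b ⊗ₜ e) = a * a - δ • (b * b) := by
  let B := Algebra.TensorProduct.basis A (quadraticBasis he hspan)
  have hB : ∀ (a : A) (q : Q) i, B.repr (a ⊗ₜ q) i = (quadraticBasis he hspan).repr q i • a := by
    intro a q i
    rw [Algebra.TensorProduct.basis_repr_tmul]
    simp [Algebra.smul_def, mul_comm]
  have h0 : (quadraticBasis he hspan).repr 1 = Finsupp.single 0 1 := by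
    rw [← quadraticBasis_zero he hspan, Module.Basis.repr_self]
  have h1 : (quadraticBasis he hspan).repr e = Finsupp.single 1 1 := by
    have := (quadraticBasis he hspan).repr_self 1
    rwa [quadraticBasis_one he hspan] at this
  have hB0 : B 0 = 1 ⊗ₜ 1 := by
    rw [Algebra.TensorProduct.basis_apply, quadraticBasis_zero]
  have hB1 : B 1 = 1 ⊗ₜ e := by
    rw [Algebra.TensorProduct.basis_apply, quadraticBasis_one]
  have hee : a ⊗ₜ[F] e + b ⊗ₜ (e * e) = (δ • b) ⊗ₜ[F] (1 : Q) + a ⊗ₜ e := by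
    rw [hδ, Algebra.algebraMap_eq_smul_one, ← TensorProduct.smul_tmul, add_comm]
  rw [Algebra.norm_eq_matrix_det B, Matrix.det_fin_two]
  simp only [Algebra.leftMulMatrix_eq_repr_mul, hB0, hB1, add_mul,
    Algebra.TensorProduct.tmul_mul_tmul, mul_one, one_mul, hee]
  simp [hB, h0, h1]

variable {B : Type*} [CommRing B] {Ψ : A ⊗[F] Q →+* B} {H : B →+* B}

/-- A homomorphism from `A ⊗ Q`, for a quadratic extension `Q`, that is compatible with a
conjugation is injective if it is injective on `A`. -/
theorem injective_of_conjugation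
    (hspan : ∀ x : Q, ∃ a b : F, x = algebraMap F Q a + algebraMap F Q b * e) (he0 : e ≠ 0)
    (h2 : IsUnit (2 : B))
    (hinj : Function.Injective fun a : A => Ψ (a ⊗ₜ 1))
    (hH : ∀ a : A, H (Ψ (a ⊗ₜ 1)) = Ψ (a ⊗ₜ 1)) (hHe : H (Ψ (1 ⊗ₜ e)) = - Ψ (1 ⊗ₜ e)) :
    Function.Injective Ψ := by
  rw [injective_iff_map_eq_zero]
  intro x hx
  obtain ⟨a, b, rfl⟩ := exists_eq_tmul_one_add_tmul hspan x
  have hb : b ⊗ₜ[F] e = b ⊗ₜ 1 * 1 ⊗ₜ e := by simp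
  have hu : IsUnit (Ψ (1 ⊗ₜ e)) := by
    refine IsUnit.map Ψ ?_
    exact IsUnit.map (Algebra.TensorProduct.includeRight : Q →ₐ[F] A ⊗[F] Q) (IsUnit.mk0 e he0)
  have h3 := congrArg H hx
  rw [hb, map_add, map_mul, map_add, map_mul, hH, hH, hHe, map_zero] at h3
  rw [hb, map_add, map_mul] at hx
  have ha : Ψ (a ⊗ₜ 1) = 0 := h2.mul_right_eq_zero.1 (by linear_combination hx + h3)
  rw [ha, zero_add, hu.mul_left_eq_zero] at hx
  have ha' : a = 0 := hinj (by simp [ha])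
  have hb' : b = 0 := hinj (by simp [hx])
  rw [ha', hb', TensorProduct.zero_tmul, TensorProduct.zero_tmul, add_zero]

/-- With conjugate a - be, the product is a² - δb², which is the norm. -/
theorem map_mul_conjugation (he : ∀ x : F, algebraMap F Q x ≠ e)
    (hspan : ∀ x : Q, ∃ a b : F, x = algebraMap F Q a + algebraMap F Q b * e)
    (hδ : e * e = algebraMap F Q δ)
    (hH : ∀ a : A, H (Ψ (a ⊗ₜ 1)) = Ψ (a ⊗ₜ 1)) (hHe : H (Ψ (1 ⊗ₜ e)) = - Ψ (1 ⊗ₜ e))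
    (x : A ⊗[F] Q) : Ψ x * H (Ψ x) = Ψ (Algebra.norm A x ⊗ₜ 1) := by
  obtain ⟨a, b, rfl⟩ := exists_eq_tmul_one_add_tmul hspan x
  rw [norm_tmul_one_add_tmul he hspan hδ]
  have hb : b ⊗ₜ[F] e = b ⊗ₜ 1 * 1 ⊗ₜ e := by simp
  have h1 : (a * a - δ • (b * b)) ⊗ₜ[F] (1 : Q) =
      a ⊗ₜ 1 * a ⊗ₜ 1 - (b ⊗ₜ 1 * 1 ⊗ₜ e) * (b ⊗ₜ 1 * 1 ⊗ₜ e) := by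
    simp only [Algebra.TensorProduct.tmul_mul_tmul, mul_one, one_mul, hδ,
      TensorProduct.sub_tmul, Algebra.algebraMap_eq_smul_one, TensorProduct.smul_tmul]
  rw [h1, hb]
  simp only [map_add, map_sub, map_mul, hH, hHe]
  ring

theorem conjugation_mem_range
    (hspan : ∀ x : Q, ∃ a b : F, x = algebraMap F Q a + algebraMap F Q b * e)
    (hH : ∀ a : A, H (Ψ (a ⊗ₜ 1)) = Ψ (a ⊗ₜ 1)) (hHe : H (Ψ (1 ⊗ₜ e)) = - Ψ (1 ⊗ₜ e))
    (x : A ⊗[F] Q) : H (Ψ x) ∈ Ψ.range := by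
  obtain ⟨a, b, rfl⟩ := exists_eq_tmul_one_add_tmul hspan x
  have hb : b ⊗ₜ[F] e = b ⊗ₜ 1 * 1 ⊗ₜ e := by simp
  refine ⟨a ⊗ₜ 1 - b ⊗ₜ 1 * 1 ⊗ₜ e, ?_⟩
  rw [hb]
  simp only [map_add, map_sub, map_mul, hH, hHe]
  ring

end QuadraticNorm

/-! ### Comparison of norm-one groups with norm tori -/

section NormTorusIso

variable {p : ℕ} [Fact p.Prime] {K : Type u} [Field K] [Algebra ℚ_[p] K]
  [FiniteDimensional ℚ_[p] K] [CharZero K] {E : IntermediateField K (AlgebraicClosure K)}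
  {f : AlgebraicClosure K ≃ₐ[K] AlgebraicClosure K} {s r : ℕ}
  {F Q : Type u} [Field F] [Field Q] [Algebra F Q] {e : Q} {δ : F}

/-- The norm torus over `K̄` as the norm-one group of a quadratic extension. -/
theorem nonempty_unitaryOne_iso_normTorus (𝒜 : CommAlgCat.{u} K ⥤ CommAlgCat.{u} F)
    (he : ∀ x : F, algebraMap F Q x ≠ e)
    (hspan : ∀ x : Q, ∃ a b : F, x = algebraMap F Q a + algebraMap F Q b * e)
    (hδ : e * e = algebraMap F Q δ)
    (Ψ : ∀ R : CommAlgCat.{u} K, (𝒜.obj R) ⊗[F] Q →+* AlgebraicClosure K ⊗[K] R)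
    (hnat : ∀ {R S : CommAlgCat.{u} K} (h : R ⟶ S) (x : (𝒜.obj R) ⊗[F] Q),
      Ψ S (Algebra.TensorProduct.map (𝒜.map h).hom (AlgHom.id F Q) x) =
        Algebra.TensorProduct.map (AlgHom.id K (AlgebraicClosure K)) h.hom (Ψ R x))
    (hrange : ∀ (R : CommAlgCat.{u} K) (z : AlgebraicClosure K ⊗[K] R),
      (∀ γ k, IsWeil p f γ k → Fixes E γ → (s : ℤ) ∣ k → galTensor R γ z = z) → z ∈ (Ψ R).range)
    (hfix : ∀ (R : CommAlgCat.{u} K) γ k, IsWeil p f γ k → Fixes E γ → (s : ℤ) ∣ k →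
      ∀ x, galTensor R γ (Ψ R x) = Ψ R x)
    (hinj : ∀ R : CommAlgCat.{u} K, Function.Injective fun a : 𝒜.obj R => Ψ R (a ⊗ₜ 1))
    (hH : ∀ (R : CommAlgCat.{u} K) γ k, IsWeil p f γ k → ¬ Fixes E γ → (s : ℤ) ∣ k - r →
      ∀ a : 𝒜.obj R, galTensor R γ (Ψ R (a ⊗ₜ 1)) = Ψ R (a ⊗ₜ 1))
    (hHe : ∀ (R : CommAlgCat.{u} K) γ k, IsWeil p f γ k → ¬ Fixes E γ → (s : ℤ) ∣ k - r →
      galTensor R γ (Ψ R (1 ⊗ₜ e)) = - Ψ R (1 ⊗ₜ e))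
    (hex : ∃ γ k, IsWeil p f γ k ∧ ¬ Fixes E γ ∧ (s : ℤ) ∣ k - r) :
    Nonempty (𝒜 ⋙ unitaryOne F Q ≅ (normTorus p E f s r).toFunctor) := by
  have he0 : e ≠ 0 := fun h => he 0 (by rw [map_zero, h])
  have h2 : ∀ R : CommAlgCat.{u} K, IsUnit (2 : AlgebraicClosure K ⊗[K] R) := by
    intro R
    rw [← map_ofNat (algebraMap K (AlgebraicClosure K ⊗[K] R)) 2]
    exact (IsUnit.mk0 (2 : K) two_ne_zero).map (algebraMap K (AlgebraicClosure K ⊗[K] R))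
  -- Every Weil element of the second kind acts on the image of Ψ as the conjugation of Q over F, so
  -- inverting an element means that its norm is 1.
  have hmul : ∀ (R : CommAlgCat.{u} K) γ k, IsWeil p f γ k → ¬ Fixes E γ → (s : ℤ) ∣ k - r →
      ∀ x, Ψ R x * galTensor R γ (Ψ R x) = Ψ R (Algebra.norm (𝒜.obj R) x ⊗ₜ 1) :=
    fun R γ k hγ hγE hk => map_mul_conjugation (A := 𝒜.obj R) (Ψ := Ψ R)
      (H := RingHomClass.toRingHom (galTensor R γ)) he hspan hδ
      (hH R γ k hγ hγE hk) (hHe R γ k hγ hγE hk)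
  have hmem : ∀ (R : CommAlgCat.{u} K) (x : ((𝒜.obj R) ⊗[F] Q)ˣ),
      Algebra.norm (𝒜.obj R) (x : (𝒜.obj R) ⊗[F] Q) = 1 →
        (Units.map (Ψ R : (𝒜.obj R) ⊗[F] Q →* AlgebraicClosure K ⊗[K] R) x :
          (AlgebraicClosure K ⊗[K] R)ˣ) ∈ (normTorus p E f s r).carrier R := by
    intro R x hx
    refine mem_normTorus.2 fun γ k hγ => ⟨fun hγE hk => Units.ext ?_, fun hγE hk => ?_⟩
    · exact hfix R γ k hγ hγE hk x
    · rw [eq_inv_iff_mul_eq_one, mul_comm]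
      refine Units.ext ((hmul R γ k hγ hγE hk x).trans ?_)
      rw [hx, ← Algebra.TensorProduct.one_def, map_one, Units.val_one]
  let η : 𝒜 ⋙ unitaryOne F Q ⟶ (normTorus p E f s r).toFunctor :=
    { app := fun R => GrpCat.ofHom (((Units.map (Ψ R : (𝒜.obj R) ⊗[F] Q →*
          AlgebraicClosure K ⊗[K] R)).comp
        (Subgroup.subtype _)).codRestrict ((normTorus p E f s r).carrier R)
          fun x => hmem R x.1 x.2)
      naturality := fun R S h => GrpCat.hom_ext (MonoidHom.ext fun x => Subtype.ext (Units.ext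
        (hnat h _))) }
  refine nonempty_iso_of_bijective η fun R => ?_
  obtain ⟨γ, k, hγ, hγE, hk⟩ := hex
  have hΨ : Function.Injective (Ψ R) :=
    injective_of_conjugation (A := 𝒜.obj R) (Ψ := Ψ R)
      (H := RingHomClass.toRingHom (galTensor R γ)) hspan he0 (h2 R) (hinj R)
      (hH R γ k hγ hγE hk) (hHe R γ k hγ hγE hk)
  constructor
  · rintro ⟨x, hx⟩ ⟨y, hy⟩ h
    refine Subtype.ext (Units.ext (hΨ ?_))
    exact congrArg (fun z => ((z.1 : (AlgebraicClosure K ⊗[K] R)ˣ) : AlgebraicClosure K ⊗[K] R)) h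
  · rintro ⟨u, hu⟩
    have hu' := mem_normTorus.1 hu
    -- The first condition places u in the image of Ψ. Its inverse is its conjugate, which is also
    -- in the image, so the preimage x is a unit; its norm is 1 because Ψ is injective on the
    -- coefficients.
    obtain ⟨x, hx⟩ := hrange R (Units.val (α := AlgebraicClosure K ⊗[K] R) u) fun γ k hγ hγE hk =>
      congrArg Units.val ((hu' γ k hγ).1 hγE hk)
    have h3 := congrArg Units.val ((hu' γ k hγ).2 hγE hk)
    obtain ⟨y, hy⟩ := conjugation_mem_range (A := 𝒜.obj R) (Ψ := Ψ R)
      (H := RingHomClass.toRingHom (galTensor R γ)) hspan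
      (hH R γ k hγ hγE hk) (hHe R γ k hγ hγE hk) x
    have hxu : Ψ R x * galTensor R γ (Ψ R x) = 1 := by
      rw [hx]
      refine (congrArg (_ * ·) h3).trans ?_
      exact Units.mul_inv (u : (AlgebraicClosure K ⊗[K] R)ˣ)
    have hy' : Ψ R y = galTensor R γ (Ψ R x) := hy
    have hxy : x * y = 1 := hΨ (by rw [map_mul, map_one, hy', hxu])
    have hn : Algebra.norm (𝒜.obj R) x = 1 := by
      refine hinj R ?_
      change Ψ R _ = Ψ R _
      rw [← hmul R γ k hγ hγE hk x, hxu, ← Algebra.TensorProduct.one_def, map_one]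
    exact ⟨⟨⟨x, y, hxy, (mul_comm _ _).trans hxy⟩, hn⟩, Subtype.ext (Units.ext hx)⟩

end NormTorusIso

/-! ### Norm tori as norm-one groups -/

/-- The homomorphism from a tensor product defined by a pair of compatible homomorphisms. -/
def tensorLift {F A Q B : Type*} [CommRing F] [CommRing A] [CommRing Q] [CommRing B] [Algebra F A]
    [Algebra F Q] (a : A →+* B) (q : Q →+* B)
    (h : ∀ x : F, a (algebraMap F A x) = q (algebraMap F Q x)) : A ⊗[F] Q →+* B :=
  letI : Algebra F B := (a.comp (algebraMap F A)).toAlgebra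
  (Algebra.TensorProduct.productMap (R := F) ({ a with commutes' := fun _ => rfl } : A →ₐ[F] B)
    ({ q with commutes' := fun x => (h x).symm } : Q →ₐ[F] B)).toRingHom

section Embedding

variable {p : ℕ} [Fact p.Prime] {K : Type u} [Field K] [Algebra ℚ_[p] K]
  [FiniteDimensional ℚ_[p] K] [CharZero K] {E : IntermediateField K (AlgebraicClosure K)}
  {f : AlgebraicClosure K ≃ₐ[K] AlgebraicClosure K} {s r : ℕ}
  {F Q : Type u} [Field F] [Field Q] [Algebra F Q] [Algebra K Q] {e : Q} {δ : F}

/-- The norm torus as the norm-one group of a quadratic extension `Q / F` with an embedding of `Q`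
in `K̄`. -/
theorem nonempty_unitaryOne_iso_normTorus_of_embedding
    (𝒜 : CommAlgCat.{u} K ⥤ CommAlgCat.{u} F)
    (he : ∀ x : F, algebraMap F Q x ≠ e)
    (hspan : ∀ x : Q, ∃ a b : F, x = algebraMap F Q a + algebraMap F Q b * e)
    (hδ : e * e = algebraMap F Q δ)
    (j : Q →ₐ[K] AlgebraicClosure K)
    (a : ∀ R : CommAlgCat.{u} K, 𝒜.obj R →+* AlgebraicClosure K ⊗[K] R)
    (ha : ∀ (R : CommAlgCat.{u} K) (x : F),
      a R (algebraMap F (𝒜.obj R) x) = j (algebraMap F Q x) ⊗ₜ 1)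
    (hnat : ∀ {R S : CommAlgCat.{u} K} (h : R ⟶ S) (x : 𝒜.obj R), a S ((𝒜.map h).hom x) =
      Algebra.TensorProduct.map (AlgHom.id K (AlgebraicClosure K)) h.hom (a R x))
    (hinj : ∀ R, Function.Injective (a R))
    (hsurj : ∀ (R : CommAlgCat.{u} K) (x : R), ∃ y, a R y = 1 ⊗ₜ x)
    (hgal : ∀ (R : CommAlgCat.{u} K) γ, (∀ x : F, γ (j (algebraMap F Q x)) =
      j (algebraMap F Q x)) → ∀ x, galTensor R γ (a R x) = a R x)
    (hmem : ∀ x, (∀ γ k, IsWeil p f γ k → Fixes E γ → (s : ℤ) ∣ k → γ x = x) → x ∈ j.range)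
    (hfix : ∀ γ k, IsWeil p f γ k → Fixes E γ → (s : ℤ) ∣ k → ∀ x, γ (j x) = j x)
    (hH : ∀ γ k, IsWeil p f γ k → ¬ Fixes E γ → (s : ℤ) ∣ k - r →
      ∀ x : F, γ (j (algebraMap F Q x)) = j (algebraMap F Q x))
    (hHe : ∀ γ k, IsWeil p f γ k → ¬ Fixes E γ → (s : ℤ) ∣ k - r → γ (j e) = - j e)
    (hex : ∃ γ k, IsWeil p f γ k ∧ ¬ Fixes E γ ∧ (s : ℤ) ∣ k - r) :
    Nonempty (𝒜 ⋙ unitaryOne F Q ≅ (normTorus p E f s r).toFunctor) := by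
  let q : ∀ R : CommAlgCat.{u} K, Q →+* AlgebraicClosure K ⊗[K] R := fun R =>
    (Algebra.TensorProduct.includeLeft : AlgebraicClosure K →ₐ[K] _).toRingHom.comp j.toRingHom
  have hq : ∀ R x, q R x = j x ⊗ₜ 1 := fun R x => rfl
  let Ψ : ∀ R : CommAlgCat.{u} K, (𝒜.obj R) ⊗[F] Q →+* AlgebraicClosure K ⊗[K] R :=
    fun R => tensorLift (a R) (q R) (ha R)
  have hΨ : ∀ R x y, Ψ R (x ⊗ₜ y) = a R x * j y ⊗ₜ 1 := fun R x y => rfl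
  have hΨ1 : ∀ R x, Ψ R (x ⊗ₜ 1) = a R x := fun R x => by
    rw [hΨ, map_one, ← Algebra.TensorProduct.one_def, mul_one]
  refine nonempty_unitaryOne_iso_normTorus 𝒜 he hspan hδ Ψ ?_ ?_ ?_ ?_ ?_ ?_ hex
  · intro R S h x
    induction x with
    | zero => simp only [map_zero]
    | add y z hy hz => simp only [map_add, hy, hz]
    | tmul x y =>
      rw [Algebra.TensorProduct.map_tmul, hΨ, hΨ, map_mul, ← hnat]
      simp
  · intro R z hz
    -- The fixed elements come from Q ⊗ R over K, and each x ⊗ r there is reached because r lies in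
    -- the image of the coefficient algebra.
    obtain ⟨y, rfl⟩ := mem_range_of_galTensor_fixed
      {γ | ∃ k, IsWeil p f γ k ∧ Fixes E γ ∧ (s : ℤ) ∣ k} j
      (fun x hx => hmem x fun γ k h1 h2 h3 => hx γ ⟨k, h1, h2, h3⟩)
      (fun γ ⟨k, h1, h2, h3⟩ => hz γ k h1 h2 h3)
    clear hz
    induction y with
    | zero => exact ⟨0, by simp⟩
    | add y z hy hz => rw [map_add]; exact add_mem hy hz
    | tmul x r =>
      obtain ⟨y, hy⟩ := hsurj R r
      exact ⟨y ⊗ₜ x, by rw [hΨ, hy]; simp⟩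
  · intro R γ k hγ hγE hk x
    induction x with
    | zero => simp only [map_zero]
    | add y z hy hz => simp only [map_add, hy, hz]
    | tmul x y =>
      rw [hΨ, map_mul, hgal R γ (fun x => hfix γ k hγ hγE hk _), galTensor_tmul,
        hfix γ k hγ hγE hk]
  · intro R
    exact fun x y hxy => hinj R (by simpa only [hΨ1] using hxy)
  · intro R γ k hγ hγE hk x
    rw [hΨ1, hgal R γ (hH γ k hγ hγE hk)]
  · intro R γ k hγ hγE hk
    rw [hΨ, map_one, one_mul, galTensor_tmul, hHe γ k hγ hγE hk, TensorProduct.neg_tmul]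

end Embedding

section Instances

variable {p : ℕ} [Fact p.Prime] {K : Type u} [Field K] [Algebra ℚ_[p] K]
  [FiniteDimensional ℚ_[p] K] [CharZero K] {E : IntermediateField K (AlgebraicClosure K)}
  {f : AlgebraicClosure K ≃ₐ[K] AlgebraicClosure K} {s r : ℕ}
  {F Q : Type u} [Field F] [Field Q] [Algebra F Q] [Algebra K Q] {e : Q} {δ : F}

theorem nonempty_unitaryOne_iso_normTorus_one {e : Q} {δ : K}
    (he : ∀ x : K, algebraMap K Q x ≠ e)
    (hspan : ∀ x : Q, ∃ a b : K, x = algebraMap K Q a + algebraMap K Q b * e)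
    (hδ : e * e = algebraMap K Q δ)
    (j : Q →ₐ[K] AlgebraicClosure K)
    (hmem : ∀ x, (∀ γ k, IsWeil p f γ k → Fixes E γ → (s : ℤ) ∣ k → γ x = x) → x ∈ j.range)
    (hfix : ∀ γ k, IsWeil p f γ k → Fixes E γ → (s : ℤ) ∣ k → ∀ x, γ (j x) = j x)
    (hHe : ∀ γ k, IsWeil p f γ k → ¬ Fixes E γ → (s : ℤ) ∣ k - r → γ (j e) = - j e)
    (hex : ∃ γ k, IsWeil p f γ k ∧ ¬ Fixes E γ ∧ (s : ℤ) ∣ k - r) :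
    Nonempty (unitaryOne K Q ≅ (normTorus p E f s r).toFunctor) := by
  refine nonempty_unitaryOne_iso_normTorus_of_embedding (𝟭 _) he hspan hδ j
    (fun R => (Algebra.TensorProduct.includeRight : R →ₐ[K] _).toRingHom)
    ?_ ?_ ?_ ?_ ?_ hmem hfix ?_ hHe hex
  · intro R x
    change (1 : AlgebraicClosure K) ⊗ₜ[K] (algebraMap K R x) = _
    rw [AlgHom.commutes, Algebra.algebraMap_eq_smul_one, Algebra.algebraMap_eq_smul_one,
      TensorProduct.smul_tmul]
  · intro R S h x
    simp
  · intro R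
    exact includeRight_injective_closure
  · exact fun R x => ⟨x, rfl⟩
  · exact fun R γ _ x => congrArg (· ⊗ₜ x) (map_one γ)
  · intro γ k _ _ _ x
    rw [AlgHom.commutes, AlgEquiv.commutes]

theorem nonempty_weilRestriction_unitaryOne_iso_normTorus [Algebra K F] [IsScalarTower K F Q]
    (he : ∀ x : F, algebraMap F Q x ≠ e)
    (hspan : ∀ x : Q, ∃ a b : F, x = algebraMap F Q a + algebraMap F Q b * e)
    (hδ : e * e = algebraMap F Q δ)
    (j : Q →ₐ[K] AlgebraicClosure K)
    (hmem : ∀ x, (∀ γ k, IsWeil p f γ k → Fixes E γ → (s : ℤ) ∣ k → γ x = x) → x ∈ j.range)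
    (hfix : ∀ γ k, IsWeil p f γ k → Fixes E γ → (s : ℤ) ∣ k → ∀ x, γ (j x) = j x)
    (hH : ∀ γ k, IsWeil p f γ k → ¬ Fixes E γ → (s : ℤ) ∣ k - r →
      ∀ x : F, γ (j (algebraMap F Q x)) = j (algebraMap F Q x))
    (hHe : ∀ γ k, IsWeil p f γ k → ¬ Fixes E γ → (s : ℤ) ∣ k - r → γ (j e) = - j e)
    (hex : ∃ γ k, IsWeil p f γ k ∧ ¬ Fixes E γ ∧ (s : ℤ) ∣ k - r) :
    Nonempty (weilRestriction K (unitaryOne F Q) ≅ (normTorus p E f s r).toFunctor) := by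
  let i : F →ₐ[K] AlgebraicClosure K := j.comp (IsScalarTower.toAlgHom K F Q)
  refine nonempty_unitaryOne_iso_normTorus_of_embedding (extendAlg K F) he hspan hδ j
    (fun R => (Algebra.TensorProduct.map i (AlgHom.id K R)).toRingHom)
    ?_ ?_ ?_ ?_ ?_ hmem hfix hH hHe hex
  · intro R x
    rfl
  · intro R S h x
    change Algebra.TensorProduct.map i (AlgHom.id K S)
      (Algebra.TensorProduct.map (AlgHom.id F F) h.hom x) = Algebra.TensorProduct.map _ _
        (Algebra.TensorProduct.map i (AlgHom.id K R) x)
    induction x using TensorProduct.induction_on with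
    | zero => simp only [map_zero]
    | add y z hy hz => simp only [map_add, hy, hz]
    | tmul x y => simp
  · intro R
    exact Module.Flat.rTensor_preserves_injective_linearMap i.toLinearMap i.injective
  · exact fun R x => ⟨1 ⊗ₜ x, congrArg (· ⊗ₜ x) (map_one i)⟩
  · intro R γ hγ x
    change galTensor R γ (Algebra.TensorProduct.map i (AlgHom.id K R) x) =
      Algebra.TensorProduct.map i (AlgHom.id K R) x
    induction x using TensorProduct.induction_on with
    | zero => simp only [map_zero]
    | add y z hy hz => simp only [map_add, hy, hz]
    | tmul x y => exact congrArg (· ⊗ₜ y) (hγ x)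

end Instances

/-! ### The tori U₁ and T_s as norm tori -/

section Elemental

variable {p : ℕ} [Fact p.Prime] {K : Type u} [Field K] [Algebra ℚ_[p] K]
  [FiniteDimensional ℚ_[p] K] [CharZero K] {E : IntermediateField K (AlgebraicClosure K)}
  {f : AlgebraicClosure K ≃ₐ[K] AlgebraicClosure K} {τ : E ≃ₐ[K] E}

theorem exists_eq_one_of_apply_eq (hE : Module.finrank K E = 2) (hτ : τ ≠ 1) {x : E}
    (hx : τ x = x) : ∃ a : K, algebraMap K E a = x := by
  obtain ⟨e, he0, he⟩ := exists_apply_eq_neg hE hτ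
  obtain ⟨a, b, rfl⟩ := exists_eq_add_mul_of_apply_eq_neg hE hτ he0 he x
  refine ⟨a, ?_⟩
  rw [map_add, map_mul, AlgEquiv.commutes, AlgEquiv.commutes, he] at hx
  have h2 : algebraMap K E b * e = 0 := by
    refine (mul_eq_zero.1 (show (2 : E) * _ = 0 from ?_)).resolve_left two_ne_zero
    linear_combination -hx
  rw [h2, add_zero]

/-- For s = 1 and r = 0 the degree conditions are void: elements fixed by the Weil elements that fix
E lie in E ⊗ R, and those that move E conjugate it over K. -/
theorem unitaryOne_iso_normTorus (hf : IsFrobenius p f) (hfE : Fixes E f)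
    (hE : Module.finrank K E = 2) (hram : ¬ IsUnramified p E) (hτ : τ ≠ 1) :
    Nonempty (unitaryOne K E ≅ (normTorus p E f 1 0).toFunctor) := by
  have hfin : FiniteDimensional K E := Module.finite_of_finrank_eq_succ hE
  obtain ⟨e, he0, he⟩ := exists_apply_eq_neg hE hτ
  obtain ⟨δ, hδ⟩ := exists_eq_one_of_apply_eq hE hτ (x := e * e) (by rw [map_mul, he]; ring)
  refine nonempty_unitaryOne_iso_normTorus_one (e := e) (δ := δ) ?_
    (exists_eq_add_mul_of_apply_eq_neg hE hτ he0 he) hδ.symm E.val ?_ ?_ ?_ ?_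
  · rintro x rfl
    rw [AlgEquiv.commutes, self_eq_neg] at he
    exact he0 he
  · intro x hx
    exact ⟨⟨x, hf.mem_of_isWeil_fixed E E fun γ k hγ hy => hx γ k hγ
      (fun y hyE => hy y ⟨hyE, hyE⟩) (one_dvd _)⟩, rfl⟩
  · exact fun γ k _ hγE _ x => hγE x x.2
  · intro γ k _ hγE _
    have := apply_of_not_fixes hE hτ hγE e
    rw [he] at this
    exact this
  · obtain ⟨γ, hγ, hγE⟩ := exists_isWeil_not_fixes (f := f) hE hram hfE 0
    exact ⟨γ, 0, hγ, hγE, by simp⟩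

/-- If e in E satisfies τe = -e, then E_s = L(e): the field L is the fixed field in E_s of any Weil
element η of degree r that moves E, and η is an involution on E_s with η(e) = -e. -/
theorem elementalTorus_iso_normTorus (hf : IsFrobenius p f) (hfE : Fixes E f)
    (hE : Module.finrank K E = 2) (hram : ¬ IsUnramified p E) (hτ : τ ≠ 1) {r : ℕ} (hr : r ≠ 0) :
    Nonempty (elementalTorus p E r ≅ (normTorus p E f (2 * r) r).toFunctor) := by
  have hfin : FiniteDimensional K E := Module.finite_of_finrank_eq_succ hE
  have hs : 2 * r ≠ 0 := by omega
  obtain ⟨e, he0, he⟩ := exists_apply_eq_neg hE hτ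
  obtain ⟨δ, hδ⟩ := exists_eq_one_of_apply_eq hE hτ (x := e * e) (by rw [map_mul, he]; ring)
  have hEs : (e : AlgebraicClosure K) ∈ extE p E (2 * r) :=
    (le_sup_left : E ≤ extE p E (2 * r)) e.2
  have hneg : ∀ γ, ¬ Fixes E γ → γ (e : AlgebraicClosure K) = -e := by
    intro γ hγE
    have := apply_of_not_fixes hE hτ hγE e
    rw [he] at this
    exact this
  have he0' : (e : AlgebraicClosure K) ≠ 0 := by simpa using he0
  have h20 : (2 : AlgebraicClosure K) ≠ 0 := by
    rw [← map_ofNat (algebraMap K (AlgebraicClosure K)) 2]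
    exact (map_ne_zero _).2 two_ne_zero
  obtain ⟨η, hη, hηE⟩ := exists_isWeil_not_fixes (f := f) hE hram hfE r
  have hηk : ((2 * r : ℕ) : ℤ) ∣ (r : ℤ) - r := by simp
  have hmemL : ∀ x, x ∈ fieldL p E r ↔ x ∈ extE p E (2 * r) ∧ η x = x := fun x =>
    hf.mem_fieldL_iff hfE hE hram hr hη hηE hηk
  refine nonempty_weilRestriction_unitaryOne_iso_normTorus (K := K) (F := fieldL p E r)
    (Q := extEOverL p E r) (e := ⟨e, hEs⟩) (δ := algebraMap K _ δ) ?_ ?_ ?_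
    ({ (extEOverL p E r).val.toRingHom with commutes' := fun _ => rfl } :
      extEOverL p E r →ₐ[K] AlgebraicClosure K) ?_ ?_ ?_ ?_ ?_
  · intro x hx
    have hx' : (x : AlgebraicClosure K) = e := congrArg Subtype.val hx
    have h1 := ((hmemL x).1 x.2).2
    rw [hx', hneg η hηE, neg_eq_self] at h1
    exact he0' h1
  · rintro ⟨x, hx⟩
    have hx1 : x ∈ extE p E (2 * r) := hx
    have hηx := hf.isWeil_apply_mem_extE hE hs hη hx1
    -- The square of η has degree 2r and fixes E, hence is trivial on E_s.
    have hηη : η (η x) = x := (hf.mem_extE_iff hs).1 hx1 (η * η) _ (hη.mul hη)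
      (fixes_mul_of_not_fixes hE hηE hηE) ⟨1, by push_cast; ring⟩
    have h2m : (2 : AlgebraicClosure K) ∈ extE p E (2 * r) := ofNat_mem _ 2
    have hη2 : η 2 = 2 := map_ofNat η 2
    -- This is the decomposition of x into eigenvectors of η, the odd part being divided by e to
    -- land in L.
    refine ⟨⟨(x + η x) / 2, (hmemL _).2 ⟨div_mem (add_mem hx1 hηx) h2m, ?_⟩⟩,
      ⟨(x - η x) / (2 * e), (hmemL _).2 ⟨div_mem (sub_mem hx1 hηx) (mul_mem h2m hEs), ?_⟩⟩,
      Subtype.ext ?_⟩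
    · rw [map_div₀, map_add, hηη, hη2, add_comm]
    · rw [map_div₀, map_sub, hηη, map_mul, hη2, hneg η hηE]
      field_simp
      ring
    · change x = (x + η x) / 2 + (x - η x) / (2 * e) * e
      field_simp
      ring
  · exact Subtype.ext (congrArg Subtype.val hδ).symm
  · intro x hx
    exact ⟨⟨x, (hf.mem_extE_iff hs).2 hx⟩, rfl⟩
  · intro γ k hγ hγE hk x
    exact (hf.mem_extE_iff hs).1 x.2 γ k hγ hγE hk
  · intro γ k hγ hγE hk x
    exact ((hf.mem_fieldL_iff hfE hE hram hr hγ hγE hk).1 x.2).2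
  · intro γ k _ hγE _
    exact hneg γ hγE
  · exact ⟨η, r, hη, hηE, hηk⟩

end Elemental

/-! ### The structure of relatively unramified anisotropic maximal tori -/

section Products

variable {k : Type u} [CommRing k] {ι : Type}

theorem nonempty_piFunctor_iso {F G : ι → GroupFunctor k} (h : ∀ i, Nonempty (F i ≅ G i)) :
    Nonempty (piFunctor F ≅ piFunctor G) := by
  have e := fun i => Classical.choice (h i)
  let η : piFunctor F ⟶ piFunctor G :=
    { app := fun R => GrpCat.ofHom (MonoidHom.pi fun i =>
        ((e i).hom.app R).hom.comp (Pi.evalMonoidHom _ i))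
      naturality := fun R S h => GrpCat.hom_ext (MonoidHom.ext fun x => funext fun i =>
        congrArg (fun g => g.hom (x i)) ((e i).hom.naturality h)) }
  refine nonempty_iso_of_bijective η fun R => ?_
  have hb : ∀ i, Function.Bijective ((e i).hom.app R).hom := fun i =>
    ((e i).app R).groupIsoToMulEquiv.bijective
  constructor
  · exact fun x y hxy => funext fun i => (hb i).1 (congrFun hxy i)
  · intro y
    choose x hx using fun i => (hb i).2 (y i)
    exact ⟨x, funext hx⟩

theorem nonempty_piFunctor_sum_zero_iso (F : ι ⊕ Fin 0 → GroupFunctor k) :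
    Nonempty (piFunctor F ≅ piFunctor fun i => F (Sum.inl i)) := by
  let η : piFunctor F ⟶ piFunctor fun i => F (Sum.inl i) :=
    { app := fun R => GrpCat.ofHom (MonoidHom.pi fun i => Pi.evalMonoidHom _ (Sum.inl i))
      naturality := fun R S h => rfl }
  refine nonempty_iso_of_bijective η fun R => ⟨fun x y hxy => funext ?_, fun y => ?_⟩
  · rintro (i | i)
    · exact congrFun hxy i
    · exact i.elim0
  · exact ⟨fun i => i.rec y fun i => i.elim0, rfl⟩

theorem nonempty_piFunctor_sum_one_iso (F : ι ⊕ Fin 1 → GroupFunctor k) :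
    Nonempty (piFunctor F ≅ productFunctor (piFunctor fun i => F (Sum.inl i)) (F (Sum.inr 0))) := by
  let η : piFunctor F ⟶ productFunctor (piFunctor fun i => F (Sum.inl i)) (F (Sum.inr 0)) :=
    { app := fun R => GrpCat.ofHom ((MonoidHom.pi fun i => Pi.evalMonoidHom _ (Sum.inl i)).prod
        (Pi.evalMonoidHom _ (Sum.inr 0)))
      naturality := fun R S h => rfl }
  refine nonempty_iso_of_bijective η fun R => ⟨fun x y hxy => funext ?_, fun y => ?_⟩
  · rintro (i | i)
    · exact congrFun (congrArg Prod.fst hxy) i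
    · rw [Subsingleton.elim i 0]
      exact congrArg Prod.snd hxy
  · exact ⟨fun i => i.rec y.1 fun i => i.cases y.2 fun i => i.elim0, rfl⟩

end Products

/-- Powers of w commute with negation, and for d ≤ 1 the index of v_0 is the only one that can equal
its own negative. -/
theorem zpow_inr {m d : ℕ} (hd : d ≤ 1) (w : weylInertia m d) (k : ℤ) (l : Fin d) :
    ((w : Equiv.Perm (Idx m d)) ^ k) (Sum.inr l) = Sum.inr l := by
  have := Fin.subsingleton_iff_le_one.2 hd
  have h := zpow_negIdx w k (Sum.inr l)
  change ((w : Equiv.Perm (Idx m d)) ^ k) (Sum.inr l) = _ at h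
  rcases hx : ((w : Equiv.Perm (Idx m d)) ^ k) (Sum.inr l) with x | l'
  · rw [hx] at h
    have h1 : x.2 = -x.2 := congrArg Prod.snd (Sum.inl_injective h)
    rcases Int.units_eq_one_or x.2 with h2 | h2 <;> rw [h2] at h1 <;> exact absurd h1 (by decide)
  · rw [Subsingleton.elim l' l]

section Structure

variable {p : ℕ} [Fact p.Prime] {K : Type u} [Field K] [Algebra ℚ_[p] K]
  [FiniteDimensional ℚ_[p] K] {E : IntermediateField K (AlgebraicClosure K)}
  {τ : E ≃ₐ[K] E} {m d : ℕ} {c : E}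

/-- Both kinds of unitary groups are treated together: the w-orbits on the index set correspond to
the signed cycles and the d ≤ 1 extra indices, and each orbit contributes one norm torus. -/
theorem isNegative_and_nonempty_iso_piFunctor (hE : Module.finrank K E = 2)
    (hram : ¬ IsUnramified p E) (hτ : τ ≠ 1) (hc : c ≠ 0) (hd : d ≤ 1)
    {T : SubgroupFunctor (unitaryGroup K τ (gram m d c))} (hT : IsTorus T.toFunctor)
    (hani : IsAnisotropic T.toFunctor) {w : weylInertia m d} (hw : CorrespondsTo p T w) :
    (∀ C : SignedCycle w, C.IsNegative) ∧
      Nonempty (T.toFunctor ≅ piFunctor fun i : SignedCycle w ⊕ Fin d =>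
        Sum.elim (fun C => elementalTorus p E C.length) (fun _ => unitaryOne K E) i) := by
  have := charZero_of_padic p K
  obtain ⟨f, hf, hfE⟩ := exists_isFrobenius_fixes (p := p) hE hram
  obtain ⟨g, hg, hgw⟩ := hw
  have hgf : ∀ γ k, IsWeil p f γ k → RepresentsWeyl (g⁻¹ * galAct γ g)
      ((w : Equiv.Perm (Idx m d)) ^ k) := fun γ k hγ =>
    hgw γ f k hf fun x hx => hγ.apply_of_mem_maxUnramified hx
  have hneg : ∀ i : Fin m, ∃ k : ℤ, ((w : Equiv.Perm (Idx m d)) ^ k) (Sum.inl (i, 1)) =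
      Sum.inl (i, -1) := fun i =>
    exists_zpow_eq_neg hE hτ hc hT hg hf (zpow_negIdx w) hgf hani (Sum.inl (i, 1))
  refine ⟨SignedCycle.isNegative hneg, ?_⟩
  obtain ⟨e₁⟩ := nonempty_iso_of_bijective (toWeilTorus hE hτ hc hT hg (zpow_negIdx w) hgf)
    fun R => toWeilTorus_bijective hE hτ hc hT hg (zpow_negIdx w) hgf hf R
  have hout : ∀ C : SignedCycle w, Quotient.mk (signedCycleSetoid w) (Quotient.out C) = C :=
    fun C => Quotient.out_eq C
  -- One base point for each orbit, with orbit size s and an exponent r for which w^r negates the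
  -- base point. The index of v_0 is fixed and its own negative, whence s = 1 and r = 0.
  let b : SignedCycle w ⊕ Fin d → Idx m d :=
    Sum.elim (fun C => Sum.inl (Quotient.out C, 1)) Sum.inr
  let s : SignedCycle w ⊕ Fin d → ℕ := Sum.elim (fun C => 2 * C.length) fun _ => 1
  let r : SignedCycle w ⊕ Fin d → ℕ := Sum.elim (fun C => C.length) fun _ => 0
  have hb : ∀ i (k : ℤ), ((w : Equiv.Perm (Idx m d)) ^ k) (b i) = b i ↔ (s i : ℤ) ∣ k := by
    rintro (C | l) k
    · exact zpow_eq_self_iff hneg (hout C) k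
    · exact iff_of_true (zpow_inr hd w k l) (one_dvd k)
  have hr : ∀ i, ((w : Equiv.Perm (Idx m d)) ^ (r i : ℤ)) (b i) = negIdx m d (b i) := by
    rintro (C | l)
    · exact zpow_length_eq hneg (hout C)
    · exact zpow_inr hd w _ l
  have hcov : ∀ a, ∃ i, ∃ k : ℤ, ((w : Equiv.Perm (Idx m d)) ^ k) (b i) = a := by
    rintro (⟨i, ε⟩ | l)
    · exact ⟨Sum.inl (Quotient.mk _ i), (exists_zpow_eq_inl_iff hneg ε).2 (hout _).symm⟩
    · exact ⟨Sum.inr l, 0, rfl⟩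
  have huniq : ∀ i i' (k : ℤ), ((w : Equiv.Perm (Idx m d)) ^ k) (b i) = b i' → i = i' := by
    rintro (C | l) (C' | l') k h
    · have h1 := (exists_zpow_eq_inl_iff hneg 1).1 ⟨k, h⟩
      rw [hout, hout] at h1
      rw [h1]
    · have h1 := (zpow_inr hd w k l').trans h.symm
      exact absurd (((w : Equiv.Perm (Idx m d)) ^ k).injective h1) (by simp [b])
    · exact absurd ((zpow_inr hd w k l).symm.trans h) (by simp [b])
    · exact congrArg _ (Sum.inr_injective ((zpow_inr hd w k l).symm.trans h))
  obtain ⟨e₂⟩ := nonempty_iso_of_bijective (evalOrbit (p := p) (E := E) (f := f) hb hr)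
    fun R => evalOrbit_bijective hfE (zpow_negIdx w) hE hb hr hcov huniq R
  obtain ⟨e₃⟩ := nonempty_piFunctor_iso (F := fun i => (normTorus p E f (s i) (r i)).toFunctor)
    (G := fun i : SignedCycle w ⊕ Fin d =>
        Sum.elim (fun C => elementalTorus p E C.length) (fun _ => unitaryOne K E) i) (by
      rintro (C | l)
      · exact (elementalTorus_iso_normTorus hf hfE hE hram hτ
          (SignedCycle.length_ne_zero C)).map Iso.symm
      · exact (unitaryOne_iso_normTorus hf hfE hE hram hτ).map Iso.symm)
  exact ⟨e₁ ≪≫ e₂ ≪≫ e₃⟩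

end Structure

end

end UnitaryTori

theorem theorem3p10 (p : ℕ) [Fact p.Prime] (K : Type u) [Field K] [Algebra ℚ_[p] K]
    [FiniteDimensional ℚ_[p] K] (E : IntermediateField K (AlgebraicClosure K))
    (hE : Module.finrank K E = 2) (hram : ¬ IsUnramified p E)
    (τ : E ≃ₐ[K] E) (hτ : τ ≠ 1) (m : ℕ) :
    (∀ c : K, c ≠ 0 →
      ∀ T : SubgroupFunctor (unitaryGroup K τ (gram m 1 (algebraMap K E c))),
        IsMaximalTorus T → IsRelativelyUnramified p T → IsAnisotropic T.toFunctor →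
        ∀ w : weylInertia m 1, CorrespondsTo p T w →
          (∀ C : SignedCycle w, C.IsNegative) ∧
          Nonempty (T.toFunctor ≅ productFunctor
            (piFunctor fun C : SignedCycle w => elementalTorus p E C.length)
            (unitaryOne K E))) ∧
    (∀ T : SubgroupFunctor (unitaryGroup K τ (gram m 0 1)),
        IsMaximalTorus T → IsRelativelyUnramified p T → IsAnisotropic T.toFunctor →
        ∀ w : weylInertia m 0, CorrespondsTo p T w →
          (∀ C : SignedCycle w, C.IsNegative) ∧
          Nonempty (T.toFunctor ≅
            piFunctor fun C : SignedCycle w => elementalTorus p E C.length)) := by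
  constructor
  · intro c hc T hT _ hani w hw
    obtain ⟨h, ⟨e⟩⟩ := isNegative_and_nonempty_iso_piFunctor hE hram hτ
      ((map_ne_zero (algebraMap K E)).2 hc) le_rfl hT.1 hani hw
    obtain ⟨e'⟩ := nonempty_piFunctor_sum_one_iso fun i : SignedCycle w ⊕ Fin 1 =>
      Sum.elim (fun C => elementalTorus p E C.length) (fun _ => unitaryOne K E) i
    exact ⟨h, ⟨e ≪≫ e'⟩⟩
  · intro T hT _ hani w hw
    -- There is no line spanned by v_0 here; the value 1 of the discriminant only serves to be
    -- nonzero.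
    obtain ⟨h, ⟨e⟩⟩ := isNegative_and_nonempty_iso_piFunctor hE hram hτ one_ne_zero
      zero_le_one hT.1 hani hw
    obtain ⟨e'⟩ := nonempty_piFunctor_sum_zero_iso fun i : SignedCycle w ⊕ Fin 0 =>
      Sum.elim (fun C => elementalTorus p E C.length) (fun _ => unitaryOne K E) i
    exact ⟨h, ⟨e ≪≫ e'⟩⟩
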